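/- For $0<\alpha\le 1$ let $\zeta(s,\alpha)$ be the Hurwitz zeta function, and for $0<\alpha,\beta\le 1$ let $\phi(\alpha,\beta,s)$ be the Lerch zeta function, that is, the analytic continuation to $\mathbb C\setminus\{1\}$ of $\sum_{n\ge 0} e^{2\pi i\alpha n}(n+\beta)^{-s}$ ($\operatorname{Re} s>1$). There is an absolute constant $c>0$ such that for all real $T\ge 16$, $H>0$, $0<\varepsilon\le 1$, $0<\alpha\le 1$ and all real $\sigma$ with $$\sigma\ \ge\ 1-\frac{\pi H(1-\varepsilon)}{4\log\log T}$$ one has $$\int_T^{T+H}|\zeta(\sigma+it,\alpha)|\,dt\ \ge\ c\,\min\left(H,\Big(\frac{H}{200}\Big)^{7/(6H\varepsilon)}\right),$$ and, for the same constant $c$ and every $0<\beta\le 1$, $$\int_T^{T+H}|\phi(\alpha,\beta,\sigma+it)|\,dt\ \ge\ c\,\min\left(H,\Big(\frac{H}{200}\Big)^{7/(6H\varepsilon)}\right).$$ -/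

import Mathlib

section Lerch

open Set Filter Topology MeasureTheory

/-- `F` is the Lerch zeta function `φ(a, b, s)`: it is holomorphic on `ℂ \ {1}` and equal to
`∑_{n ≥ 0} e^{2 π i a n} (n + b)^{-s}` for `re s > 1`. By the identity theorem these two properties
determine `F` on `ℂ \ {1}` (see `IsLerchZeta.eqOn`). -/
structure IsLerchZeta (a b : ℝ) (F : ℂ → ℂ) : Prop where
  differentiableOn : DifferentiableOn ℂ F {1}ᶜ
  eq_tsum : ∀ s : ℂ, 1 < s.re →
    F s = ∑' n : ℕ, Complex.exp (2 * Real.pi * Complex.I * a * n) / (n + b : ℂ) ^ s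

theorem differentiableOn_integral_zero_one {U : Set ℂ} (hU : IsOpen U) {g : ℝ → ℂ → ℂ}
    (hc : ContinuousOn (fun p : ℝ × ℂ => g p.1 p.2) (univ ×ˢ U))
    (hd : ∀ u, DifferentiableOn ℂ (g u) U) :
    DifferentiableOn ℂ (fun s => ∫ u in (0:ℝ)..1, g u s) U := by
  intro s₀ hs₀
  obtain ⟨r, hr, hrU⟩ := Metric.isOpen_iff.1 hU s₀ hs₀
  have hK : IsCompact (Icc (0:ℝ) 1 ×ˢ Metric.closedBall s₀ (r / 2)) :=
    isCompact_Icc.prod (isCompact_closedBall _ _)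
  have hsub : Metric.closedBall s₀ (r / 2) ⊆ U :=
    (Metric.closedBall_subset_ball (by linarith)).trans hrU
  obtain ⟨C, hC⟩ := hK.exists_bound_of_continuousOn
    (hc.mono (prod_mono (subset_univ _) hsub))
  have hcu : ∀ s ∈ U, Continuous (fun u => g u s) := fun s hs =>
    hc.comp_continuous (f := fun u : ℝ => (u, s)) (by fun_prop) (fun u => ⟨mem_univ _, hs⟩)
  have hder : ∀ u, ∀ s ∈ U, HasDerivAt (g u) (deriv (g u) s) s := fun u s hs =>
    ((hd u).differentiableAt (hU.mem_nhds hs)).hasDerivAt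
  have key := intervalIntegral.hasDerivAt_integral_of_dominated_loc_of_deriv_le
    (μ := volume) (a := (0:ℝ)) (b := 1) (F := fun s u => g u s)
    (F' := fun s u => deriv (g u) s) (x₀ := s₀) (s := Metric.ball s₀ (r / 4))
    (bound := fun _ => C / (r / 4)) (Metric.ball_mem_nhds _ (by linarith))
    (by
      filter_upwards [hU.mem_nhds hs₀] with s hs
      exact (hcu s hs).aestronglyMeasurable)
    ((hcu s₀ hs₀).intervalIntegrable _ _)
    (by
      obtain ⟨h, hh0, hh⟩ : ∃ h : ℕ → ℂ, (∀ n, h n ≠ 0 ∧ s₀ + h n ∈ U) ∧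
          Tendsto h atTop (𝓝[≠] 0) := by
        have h1 : ∀ᶠ z : ℂ in 𝓝[≠] 0, z ≠ 0 ∧ s₀ + z ∈ U := by
          refine (eventually_mem_nhdsWithin.mono fun z hz => hz).and ?_
          refine nhdsWithin_le_nhds ?_
          have : Tendsto (fun z : ℂ => s₀ + z) (𝓝 0) (𝓝 s₀) := by
            have : Continuous (fun z : ℂ => s₀ + z) := by fun_prop
            simpa using this.tendsto 0
          exact this (hU.mem_nhds hs₀)
        obtain ⟨h, hh, hh'⟩ := exists_seq_forall_of_frequently h1.frequently
        exact ⟨h, hh', hh⟩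
      refine aestronglyMeasurable_of_tendsto_ae atTop
        (f := fun n u => (h n)⁻¹ • (g u (s₀ + h n) - g u s₀)) (fun n => ?_) ?_
      · exact (((hcu _ (hh0 n).2).sub (hcu _ hs₀)).const_smul ((h n)⁻¹)).aestronglyMeasurable
      · exact ae_of_all _ fun u => (hasDerivAt_iff_tendsto_slope_zero.1 (hder u s₀ hs₀)).comp hh)
    (by
      refine ae_of_all _ fun u hu s hs => ?_
      have hu' : u ∈ Icc (0:ℝ) 1 := by
        rw [uIoc_of_le zero_le_one] at hu; exact ⟨hu.1.le, hu.2⟩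
      have hb : Metric.closedBall s (r / 4) ⊆ Metric.closedBall s₀ (r / 2) :=
        Metric.closedBall_subset_closedBall' (by have := Metric.mem_ball.1 hs; linarith)
      refine Complex.norm_deriv_le_of_forall_mem_sphere_norm_le (by linarith) ?_ ?_
      · exact ((hd u).mono (hb.trans hsub)).diffContOnCl_ball subset_rfl
      · intro z hz
        exact hC (u, z) ⟨hu', hb (Metric.sphere_subset_closedBall hz)⟩)
    intervalIntegrable_const
    (by
      refine ae_of_all _ fun u _ s hs => hder u s (hsub ?_)
      exact Metric.ball_subset_closedBall.trans
        (Metric.closedBall_subset_closedBall (by linarith)) hs)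
  exact key.2.differentiableAt.differentiableWithinAt

theorem norm_lerch_term_le {z : ℂ} (hz : ‖z‖ ≤ 1) {b d : ℝ} (hb : 0 < b) (hd : 0 < d) {s : ℂ}
    (hs : d ≤ s.re) (n : ℕ) :
    ‖z ^ (n + 1) * ((n + 1 + b : ℝ) : ℂ) ^ (-s)‖ ≤ 1 / ((n + 1 : ℕ) : ℝ) ^ d := by
  have h1 : (0:ℝ) < n + 1 + b := by positivity
  rw [norm_mul, norm_pow, Complex.norm_cpow_eq_rpow_re_of_pos h1, Complex.neg_re, one_div,
    ← Real.rpow_neg (by positivity)]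
  have h2 : ‖z‖ ^ (n + 1) ≤ 1 := pow_le_one₀ (norm_nonneg _) hz
  have h3 : ((n:ℝ) + 1 + b) ^ (-s.re) ≤ ((n + 1 : ℕ) : ℝ) ^ (-d) := by
    calc ((n:ℝ) + 1 + b) ^ (-s.re) ≤ ((n:ℝ) + 1 + b) ^ (-d) :=
          Real.rpow_le_rpow_of_exponent_le (by linarith [(Nat.cast_nonneg n : (0:ℝ) ≤ n)])
            (by linarith)
      _ ≤ _ := by
          push_cast
          exact Real.rpow_le_rpow_of_nonpos (by positivity) (by linarith) (by linarith)
  calc _ ≤ 1 * ((n:ℝ) + 1 + b) ^ (-s.re) := by gcongr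
    _ ≤ _ := by rw [one_mul]; exact h3

theorem summable_lerch_bound {d : ℝ} (hd : 1 < d) :
    Summable (fun n : ℕ => 1 / ((n + 1 : ℕ) : ℝ) ^ d) :=
  (summable_nat_add_iff 1).2 (Real.summable_one_div_nat_rpow.2 hd)

theorem summable_lerch {z : ℂ} (hz : ‖z‖ ≤ 1) {b : ℝ} (hb : 0 < b) {s : ℂ} (hs : 1 < s.re) :
    Summable (fun n : ℕ => z ^ n * ((n + b : ℝ) : ℂ) ^ (-s)) := by
  rw [← summable_nat_add_iff 1]
  refine Summable.of_norm_bounded (summable_lerch_bound hs) fun n => ?_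
  have := norm_lerch_term_le hz hb (by linarith) le_rfl n (s := s)
  push_cast at this ⊢
  exact this

theorem lerch_series_shift {z : ℂ} (hz : ‖z‖ ≤ 1) {b : ℝ} (hb : 0 < b) {s : ℂ} (hs : 1 < s.re) :
    ∑' n : ℕ, z ^ n * ((n + b : ℝ) : ℂ) ^ (-s) =
      (b : ℂ) ^ (-s) + ∑' n : ℕ, z ^ (n + 1) * ((n + 1 + b : ℝ) : ℂ) ^ (-s) := by
  rw [(summable_lerch hz hb hs).tsum_eq_zero_add]
  simp

/-- Joint continuity and holomorphy of the series -/
theorem lerch_series_regular {z : ℂ} (hz : ‖z‖ ≤ 1) :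
    ContinuousOn (fun p : ℝ × ℂ => ∑' n : ℕ, z ^ n * ((n + p.1 : ℝ) : ℂ) ^ (-p.2))
      {p : ℝ × ℂ | 0 < p.1 ∧ 1 < p.2.re} ∧
    ∀ b : ℝ, 0 < b → DifferentiableOn ℂ (fun s => ∑' n : ℕ, z ^ n * ((n + b : ℝ) : ℂ) ^ (-s))
      {s : ℂ | 1 < s.re} := by
  constructor
  · have hopen : ∀ d : ℝ, IsOpen {p : ℝ × ℂ | 0 < p.1 ∧ d < p.2.re} := fun d =>
      (isOpen_lt continuous_const continuous_fst).inter
        (isOpen_lt continuous_const (Complex.continuous_re.comp continuous_snd))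
    intro p hp
    obtain ⟨d, hd1, hd2⟩ := exists_between hp.2
    have hterm : ∀ (m : ℕ), ContinuousOn
        (fun p : ℝ × ℂ => ((m + p.1 : ℝ) : ℂ) ^ (-p.2)) {p : ℝ × ℂ | 0 < p.1 ∧ d < p.2.re} := by
      intro m
      refine ContinuousOn.cpow (by fun_prop) (by fun_prop) fun q hq => ?_
      exact Complex.ofReal_mem_slitPlane.2 (add_pos_of_nonneg_of_pos (Nat.cast_nonneg m) hq.1)
    have hc : ContinuousOn (fun p : ℝ × ℂ => ((p.1 : ℝ) : ℂ) ^ (-p.2) +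
        ∑' n : ℕ, z ^ (n + 1) * ((n + 1 + p.1 : ℝ) : ℂ) ^ (-p.2))
        {p : ℝ × ℂ | 0 < p.1 ∧ d < p.2.re} := by
      refine ContinuousOn.add (by simpa using hterm 0) ?_
      refine continuousOn_tsum (fun n => ?_) (summable_lerch_bound hd1) fun n q hq => ?_
      · have := hterm (n + 1)
        push_cast at this ⊢
        exact continuousOn_const.mul this
      · exact norm_lerch_term_le hz hq.1 (by linarith) hq.2.le n
    refine ContinuousAt.continuousWithinAt ?_
    refine (hc.continuousAt ((hopen d).mem_nhds ⟨hp.1, hd2⟩)).congr ?_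
    filter_upwards [(hopen d).mem_nhds ⟨hp.1, hd2⟩] with q hq
    exact (lerch_series_shift hz hq.1 (hd1.trans hq.2)).symm
  · intro b hb s hs
    obtain ⟨d, hd1, hd2⟩ := exists_between (show 1 < s.re from hs)
    have hopen : IsOpen {s : ℂ | d < s.re} := isOpen_lt continuous_const Complex.continuous_re
    have hterm : ∀ (m : ℕ), Differentiable ℂ (fun s : ℂ => ((m + b : ℝ) : ℂ) ^ (-s)) := by
      intro m
      have : ((m + b : ℝ) : ℂ) ≠ 0 := by
        exact_mod_cast (add_pos_of_nonneg_of_pos (Nat.cast_nonneg m) hb).ne'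
      intro s
      exact (differentiableAt_id.neg).const_cpow (Or.inl this)
    have hc : DifferentiableOn ℂ (fun s : ℂ => ((b : ℝ) : ℂ) ^ (-s) +
        ∑' n : ℕ, z ^ (n + 1) * ((n + 1 + b : ℝ) : ℂ) ^ (-s)) {s : ℂ | d < s.re} := by
      refine DifferentiableOn.add (by simpa using (hterm 0).differentiableOn) ?_
      refine Complex.differentiableOn_tsum_of_summable_norm (summable_lerch_bound hd1) (fun n => ?_) hopen
        fun n q hq => ?_
      · have := hterm (n + 1)
        push_cast at this ⊢
        exact (this.const_mul _).differentiableOn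
      · exact norm_lerch_term_le hz hb (by linarith) (le_of_lt hq) n
    refine DifferentiableAt.differentiableWithinAt ?_
    refine (hc.differentiableAt (hopen.mem_nhds hd2)).congr_of_eventuallyEq ?_
    filter_upwards [hopen.mem_nhds hd2] with q hq
    exact lerch_series_shift hz hb (hd1.trans hq)

theorem lerch_integral_term {b : ℝ} (hb : 0 < b) (s : ℂ) (hs : s ≠ 0) :
    s * ∫ u in (0:ℝ)..1, ((b + u : ℝ) : ℂ) ^ (-(s + 1)) =
      (b : ℂ) ^ (-s) - ((b + 1 : ℝ) : ℂ) ^ (-s) := by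
  have h1 : ∫ u in (0:ℝ)..1, ((b + u : ℝ) : ℂ) ^ (-(s + 1)) =
      ∫ x in b..(b + 1), (x : ℂ) ^ (-(s + 1)) := by
    rw [intervalIntegral.integral_comp_add_left (fun x : ℝ => (x : ℂ) ^ (-(s + 1))) b]
    simp
  rw [h1, integral_cpow]
  · have : (-(s + 1) + 1) = -s := by ring
    rw [this]
    field_simp
    ring
  · right
    refine ⟨fun h => hs (by linear_combination -h), ?_⟩
    rw [uIcc_of_le (by linarith)]
    intro h
    linarith [h.1]

theorem lerch_ladder {z : ℂ} (hz : ‖z‖ ≤ 1) {b : ℝ} (hb : 0 < b) {s : ℂ} (hs : 1 < s.re) :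
    (1 - z) * ∑' n : ℕ, z ^ n * ((n + b : ℝ) : ℂ) ^ (-s) =
      (b : ℂ) ^ (-s) - s * z * ∫ u in (0:ℝ)..1,
        ∑' n : ℕ, z ^ n * ((n + (b + max u 0) : ℝ) : ℂ) ^ (-(s + 1)) := by
  have hs0 : s ≠ 0 := by rintro rfl; simp at hs; linarith
  have hs1 : 1 < (s + 1).re := by simp; linarith
  let f : ℕ → C(ℝ, ℂ) := fun n =>
    ⟨fun u => z ^ n * ((n + (b + max u 0) : ℝ) : ℂ) ^ (-(s + 1)), by
      refine continuous_const.mul (Continuous.cpow (by fun_prop) (by fun_prop) fun u => ?_)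
      refine Complex.ofReal_mem_slitPlane.2 ?_
      have := le_max_right u 0
      positivity⟩
  have hsum : Summable fun n : ℕ =>
      ‖(f n).restrict (⟨uIcc (0:ℝ) 1, isCompact_uIcc⟩ : TopologicalSpace.Compacts ℝ)‖ := by
    rw [← summable_nat_add_iff 1]
    refine Summable.of_nonneg_of_le (fun n => norm_nonneg _) (fun n => ?_)
      (summable_lerch_bound hs1)
    rw [ContinuousMap.norm_le _ (by positivity)]
    rintro ⟨u, hu⟩
    have := norm_lerch_term_le hz (b := b + max u 0)
      (by have := le_max_right u 0; linarith) (by linarith) le_rfl n (s := s + 1)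
    simp only [f, ContinuousMap.restrict_apply, ContinuousMap.coe_mk]
    push_cast at this ⊢
    exact this
  have key := intervalIntegral.tsum_intervalIntegral_eq_of_summable_norm hsum
  simp only [f, ContinuousMap.coe_mk] at key
  rw [← key]
  have hint : ∀ n : ℕ, s * ∫ u in (0:ℝ)..1,
      z ^ n * ((n + (b + max u 0) : ℝ) : ℂ) ^ (-(s + 1)) =
      z ^ n * ((n + b : ℝ) : ℂ) ^ (-s) - z ^ n * ((n + (b + 1) : ℝ) : ℂ) ^ (-s) := by
    intro n
    have e : ∫ u in (0:ℝ)..1, z ^ n * ((n + (b + max u 0) : ℝ) : ℂ) ^ (-(s + 1)) =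
        z ^ n * ∫ u in (0:ℝ)..1, ((n + b + u : ℝ) : ℂ) ^ (-(s + 1)) := by
      rw [← intervalIntegral.integral_const_mul]
      refine intervalIntegral.integral_congr fun u hu => ?_
      rw [uIcc_of_le zero_le_one] at hu
      simp only [max_eq_left hu.1, add_assoc]
    rw [e, mul_left_comm, lerch_integral_term (by positivity) s hs0]
    rw [mul_sub, add_assoc (n:ℝ)]
  have h1 := summable_lerch hz hb hs
  have h2 := summable_lerch hz (b := b + 1) (by linarith) hs
  have h3 : s * ∑' n : ℕ, ∫ u in (0:ℝ)..1,
      z ^ n * ((n + (b + max u 0) : ℝ) : ℂ) ^ (-(s + 1)) =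
      ∑' n : ℕ, z ^ n * ((n + b : ℝ) : ℂ) ^ (-s) -
        ∑' n : ℕ, z ^ n * ((n + (b + 1) : ℝ) : ℂ) ^ (-s) := by
    rw [← tsum_mul_left, ← h1.tsum_sub h2]
    exact tsum_congr hint
  have h4 : z * ∑' n : ℕ, z ^ n * ((n + (b + 1) : ℝ) : ℂ) ^ (-s) =
      ∑' n : ℕ, z ^ (n + 1) * ((n + 1 + b : ℝ) : ℂ) ^ (-s) := by
    rw [← tsum_mul_left]
    refine tsum_congr fun n => ?_
    rw [pow_succ', mul_assoc, show (n:ℝ) + (b + 1) = n + 1 + b by ring]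
  have h5 := lerch_series_shift hz hb hs
  rw [← h4] at h5
  linear_combination h5 + z * h3

/-- Continuation of the series to `1 - N < re s` -/
theorem lerch_continuation {z : ℂ} (hz : ‖z‖ ≤ 1) (hz1 : z ≠ 1) (N : ℕ) :
    ∃ F : ℝ → ℂ → ℂ,
      ContinuousOn (fun p : ℝ × ℂ => F p.1 p.2) {p : ℝ × ℂ | 0 < p.1 ∧ 1 - (N:ℝ) < p.2.re} ∧
      (∀ b, 0 < b → DifferentiableOn ℂ (F b) {s : ℂ | 1 - (N:ℝ) < s.re}) ∧
      ∀ b, 0 < b → ∀ s : ℂ, 1 < s.re →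
        F b s = ∑' n : ℕ, z ^ n * ((n + b : ℝ) : ℂ) ^ (-s) := by
  induction N with
  | zero =>
    obtain ⟨h1, h2⟩ := lerch_series_regular hz
    exact ⟨fun b s => ∑' n : ℕ, z ^ n * ((n + b : ℝ) : ℂ) ^ (-s), by simpa using h1,
      by simpa using h2, fun b _ s _ => rfl⟩
  | succ N ih =>
    obtain ⟨F, hc, hd, hF⟩ := ih
    have hz1' : 1 - z ≠ 0 := sub_ne_zero.2 (Ne.symm hz1)
    have hre : ∀ s : ℂ, 1 - ((N + 1 : ℕ) : ℝ) < s.re → 1 - (N:ℝ) < (s + 1).re := by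
      intro s hs; push_cast at hs; simp; linarith
    have hmax : ∀ b u : ℝ, 0 < b → 0 < b + max u 0 := fun b u hb => by
      have := le_max_right u 0; linarith
    refine ⟨fun b s => ((b : ℂ) ^ (-s) - s * z * ∫ u in (0:ℝ)..1, F (b + max u 0) (s + 1))
      / (1 - z), ?_, ?_, ?_⟩
    · refine ContinuousOn.div_const (ContinuousOn.sub ?_ (ContinuousOn.mul (by fun_prop) ?_)) _
      · refine ContinuousOn.cpow (by fun_prop) (by fun_prop) fun q hq => ?_
        exact Complex.ofReal_mem_slitPlane.2 hq.1
      · rw [continuousOn_iff_continuous_domRestrict]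
        refine intervalIntegral.continuous_parametric_intervalIntegral_of_continuous'
          (X := {p : ℝ × ℂ | 0 < p.1 ∧ 1 - ((N + 1 : ℕ) : ℝ) < p.2.re})
          (f := fun p u => F (p.1.1 + max u 0) (p.1.2 + 1)) ?_ 0 1
        exact hc.comp_continuous (f := fun q :
          {p : ℝ × ℂ | 0 < p.1 ∧ 1 - ((N + 1 : ℕ) : ℝ) < p.2.re} × ℝ =>
            (q.1.1.1 + max q.2 0, q.1.1.2 + 1)) (by fun_prop)
          (fun q => ⟨hmax _ _ q.1.2.1, hre _ q.1.2.2⟩)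
    · intro b hb
      have hU : IsOpen {s : ℂ | 1 - ((N + 1 : ℕ) : ℝ) < s.re} :=
        isOpen_lt continuous_const Complex.continuous_re
      refine DifferentiableOn.div_const (DifferentiableOn.sub ?_ (DifferentiableOn.mul
        (by fun_prop) ?_)) _
      · intro s _
        exact ((differentiableAt_id.neg).const_cpow
          (Or.inl (by exact_mod_cast hb.ne'))).differentiableWithinAt
      · refine differentiableOn_integral_zero_one hU (g := fun u s => F (b + max u 0) (s + 1)) ?_ ?_
        · exact hc.comp (f := fun q : ℝ × ℂ => (b + max q.1 0, q.2 + 1)) (by fun_prop)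
            (fun q hq => ⟨hmax _ _ hb, hre _ hq.2⟩)
        · intro u
          exact (hd _ (hmax b u hb)).comp (f := fun s : ℂ => s + 1) (by fun_prop)
            (fun s hs => hre s hs)
    · intro b hb s hs
      have hs1 : 1 < (s + 1).re := by simp; linarith
      have : ∫ u in (0:ℝ)..1, F (b + max u 0) (s + 1) = ∫ u in (0:ℝ)..1,
          ∑' n : ℕ, z ^ n * ((n + (b + max u 0) : ℝ) : ℂ) ^ (-(s + 1)) :=
        intervalIntegral.integral_congr fun u _ => hF _ (hmax b u hb) _ hs1
      simp only [this]
      rw [← lerch_ladder hz hb hs]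
      field_simp

theorem lerch_continuation_entire {z : ℂ} (hz : ‖z‖ ≤ 1) (hz1 : z ≠ 1) {b : ℝ} (hb : 0 < b) :
    ∃ F : ℂ → ℂ, Differentiable ℂ F ∧ ∀ s : ℂ, 1 < s.re →
        F s = ∑' n : ℕ, z ^ n * ((n + b : ℝ) : ℂ) ^ (-s) := by
  choose F _ hd hF using fun N => lerch_continuation hz hz1 N
  have hU : ∀ N : ℕ, IsOpen {s : ℂ | 1 - (N:ℝ) < s.re} := fun N =>
    isOpen_lt continuous_const Complex.continuous_re
  have hagree : ∀ M N : ℕ, M ≤ N → ∀ s : ℂ, 1 - (M:ℝ) < s.re → F M b s = F N b s := by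
    intro M N hMN s hs
    have hMN' : (M:ℝ) ≤ N := by exact_mod_cast hMN
    have a1 : AnalyticOnNhd ℂ (F M b) {s : ℂ | 1 - (M:ℝ) < s.re} :=
      (hd M b hb).analyticOnNhd (hU M)
    have a2 : AnalyticOnNhd ℂ (F N b) {s : ℂ | 1 - (M:ℝ) < s.re} :=
      ((hd N b hb).mono fun s hs => by simp only [mem_ofPred_eq] at hs ⊢; linarith).analyticOnNhd
        (hU M)
    have h2 : (2:ℂ) ∈ {s : ℂ | 1 - (M:ℝ) < s.re} := by
      simp only [mem_ofPred_eq, Complex.re_ofNat]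
      linarith [(Nat.cast_nonneg M : (0:ℝ) ≤ M)]
    refine a1.eqOn_of_preconnected_of_eventuallyEq a2
      (convex_halfSpace_re_gt _).isPreconnected h2 ?_ hs
    filter_upwards [(isOpen_lt continuous_const Complex.continuous_re).mem_nhds
      (show (1:ℝ) < (2:ℂ).re by simp)] with w hw
    rw [hF M b hb w hw, hF N b hb w hw]
  have hex : ∀ s : ℂ, ∃ N : ℕ, 1 - (N:ℝ) < s.re := fun s => by
    obtain ⟨N, hN⟩ := exists_nat_gt (1 - s.re)
    exact ⟨N, by linarith⟩
  choose k hk using hex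
  have hloc : ∀ N : ℕ, ∀ s : ℂ, 1 - (N:ℝ) < s.re → F (k s) b s = F N b s := by
    intro N s hs
    rcases le_total (k s) N with h | h
    · exact hagree _ _ h s (hk s)
    · exact (hagree _ _ h s hs).symm
  refine ⟨fun s => F (k s) b s, fun s => ?_, fun s hs => hF _ b hb s hs⟩
  refine (((hd (k s) b hb).differentiableAt ((hU _).mem_nhds (hk s)))).congr_of_eventuallyEq ?_
  filter_upwards [(hU (k s)).mem_nhds (hk s)] with w hw
  exact hloc _ w hw

theorem exists_isLerchZeta (a : ℝ) {b : ℝ} (hb : b ∈ Ioc (0:ℝ) 1) :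
    ∃ F : ℂ → ℂ, IsLerchZeta a b F := by
  set z : ℂ := Complex.exp (2 * Real.pi * Complex.I * a) with hzdef
  have hpow : ∀ n : ℕ, Complex.exp (2 * Real.pi * Complex.I * a * n) = z ^ n := fun n => by
    rw [hzdef, ← Complex.exp_nat_mul]; ring_nf
  have hz : ‖z‖ = 1 := by
    rw [hzdef, show (2 * Real.pi * Complex.I * a : ℂ) = ((2 * Real.pi * a : ℝ) : ℂ) * Complex.I by
      push_cast; ring]
    exact Complex.norm_exp_ofReal_mul_I _
  by_cases hz1 : z = 1
  · refine ⟨HurwitzZeta.hurwitzZeta (b : UnitAddCircle), fun s hs =>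
      (HurwitzZeta.differentiableAt_hurwitzZeta _ hs).differentiableWithinAt, fun s hs => ?_⟩
    rw [← (HurwitzZeta.hasSum_hurwitzZeta_of_one_lt_re ⟨hb.1.le, hb.2⟩ hs).tsum_eq]
    exact tsum_congr fun n => by rw [hpow, hz1, one_pow]
  · obtain ⟨F, hF, hF'⟩ := lerch_continuation_entire hz.le hz1 hb.1
    refine ⟨F, hF.differentiableOn, fun s hs => ?_⟩
    rw [hF' s hs]
    refine tsum_congr fun n => ?_
    rw [hpow, Complex.cpow_neg, div_eq_mul_inv]
    push_cast
    rfl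

theorem IsLerchZeta.eqOn {a b : ℝ} {F G : ℂ → ℂ} (hF : IsLerchZeta a b F)
    (hG : IsLerchZeta a b G) : EqOn F G {1}ᶜ := by
  refine (hF.differentiableOn.analyticOnNhd isOpen_compl_singleton).eqOn_of_preconnected_of_eventuallyEq
    (hG.differentiableOn.analyticOnNhd isOpen_compl_singleton)
    (isConnected_compl_singleton_of_one_lt_rank (by simp) 1).isPreconnected
    (show (2:ℂ) ∈ ({1}ᶜ : Set ℂ) by norm_num) ?_
  filter_upwards [(isOpen_lt continuous_const Complex.continuous_re).mem_nhds
      (show (1:ℝ) < (2:ℂ).re by simp)] with w hw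
  rw [hF.eq_tsum w hw, hG.eq_tsum w hw]

/-- The Lerch zeta function `φ(a, b, s)` for real `a` and `0 < b ≤ 1`: the analytic continuation to
`ℂ \ {1}` of `∑_{n ≥ 0} e^{2 π i a n} (n + b)^{-s}`. Its value at `s = 1` has no meaning. -/
noncomputable def lerchZeta (a b : ℝ) : ℂ → ℂ :=
  Classical.epsilon (IsLerchZeta a b)

theorem isLerchZeta_lerchZeta (a : ℝ) {b : ℝ} (hb : b ∈ Ioc (0:ℝ) 1) :
    IsLerchZeta a b (lerchZeta a b) :=
  Classical.epsilon_spec (exists_isLerchZeta a hb)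

end Lerch

/-!
# Lower bounds for the mean value of the Lerch zeta function over short vertical segments

Since `ζ(s, α) = φ(1, α, s)`, both inequalities concern a function `F = φ(a, b, ·)`, and as `φ` has
period `1` in `a`, one may take `|a| ≤ 1 / 2`. Write `σ = re s`, `L = log log T`, and `J` for the
integral of `‖F‖` over the segment.

The main range is `-1 ≤ σ ≤ 26 / 15`. There the idea is that a Dirichlet series whose first term
dominates at one point cannot be very small on a segment to the left of it. Convolving `F`, suitably
normalized, with the uniform measure on a short vertical segment (`IsLerchZeta.exists_average`) gives
a series `g = ∑ c n (1 + n q) ^ (-s)` with `‖c n‖ ≤ ‖c 0‖ = 1` such that `‖g‖ ≤ δ`, where `δ` is a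
constant times `J / H`, on a segment of the line `re s = 1 - max (1 - σ) 0`. The point
`s₀ = 1 + 11 / 15` is far enough to the right for `‖g s₀‖` to be bounded below. The two constant
theorem compares the two: if `ω` is the harmonic measure of the segment of half-length `X₁` seen from
distance `d = 11 / 15`, then `‖g s₀‖ ≤ δ ^ ω · M ^ (1 - ω)`. Two points need care.

* The segment lies to the left of the line `re s = 1`, where `g` is known only to be of size `T ^ p`.
  The rectangle between this segment and the line is a channel of width about `max (1 - σ) 0`, and
  `norm_le_of_long_rect` says that a bound `exp (A log T)` on its short ends has no effect in the
  middle, if the channel is longer than `L / π` times its width. This is what the hypothesis on `σ`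
  ensures, for the middle part of half-length `X₁` close to `(1 + ε) H / 4`.
* On lines `re s = 1 + w` with small `w`, `g` is only of size `1 / w`, but its mean square against
  the Poisson kernel is of order `1 / w` as well (`poissonAverage_sq_progressionSeries_le`), so `g`
  behaves there like a function of size `w ^ (-1 / 2)`. With `w` proportional to `H` this halves the
  exponent.

The outcome is `exp_neg_le_of_norm_le`: the exponent of `1 / H` is essentially
`π / 4 · d / X₁ ≤ (11 π / 30) / (H ε)`, and `11 π / 30 < 7 / 6`; the slack absorbs all constants. For
bounded `T` the crude two constant theorem `exp_neg_le_of_norm_le_rect` is sufficient, since the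
factor `log (200 / H)` in the exponent grows as `H` tends to `0`.

The polynomial bound for `g` is not available uniformly in `a` and `b`, because the functional
equation has a term `Γ(1 - s) (-2πia) ^ (s - 1)`, the dual term, which is unbounded as `a` tends to
`0`. `IsLerchZeta.norm_sub_cpow_le` separates it from `F`: the remainder, after the term `b ^ (-s)` is
removed too, is bounded by a power of the ordinate uniformly in `a` and `b`. If the dual term
dominates on a whole segment then `‖F‖ ≥ 1` on it and `J` is large; otherwise the dual term is of
polynomial size at one point, hence to the right of and above this point
(`IsLerchZeta.large_or_polynomial`).

For `σ ≥ 26 / 15` the first term of the series dominates, as `ζ(26 / 15) < 2`. For `σ ≤ -1` the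
hypothesis on `σ` forces `H ≥ 8 / π`, and the functional equation
(`IsLerchZeta.eq_add_tsum_dualTerm`) shows `F` as the sum of two series, over positive and negative
frequencies, each of the size of its first term; the ratio of these sizes is `e ^ (π t)` times a
constant, so they can be comparable only on a segment of length less than `8 / π`.
-/

/-! ### Vertical decay of the Gamma function -/

theorem sq_norm_Gamma_half (t : ℝ) :
    ‖Complex.Gamma (1 / 2 + t * Complex.I)‖ ^ 2 = Real.pi / Real.cosh (Real.pi * t) := by
  have h := Complex.Gamma_mul_Gamma_one_sub (1 / 2 + t * Complex.I)
  have h1 : (1 - (1 / 2 + t * Complex.I) : ℂ) = (starRingEnd ℂ) (1 / 2 + t * Complex.I) := by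
    simp [Complex.ext_iff]; norm_num
  have h2 : Complex.sin (Real.pi * (1 / 2 + t * Complex.I)) = (Real.cosh (Real.pi * t) : ℂ) := by
    rw [show (Real.pi * (1 / 2 + t * Complex.I) : ℂ) = (Real.pi * t : ℂ) * Complex.I + Real.pi / 2 by
      ring, Complex.sin_add_pi_div_two, Complex.cos_mul_I]
    push_cast; rfl
  rw [h1, Complex.Gamma_conj, Complex.mul_conj, h2] at h
  rw [← Complex.normSq_eq_norm_sq]
  exact_mod_cast h

theorem norm_betaIntegral_le {s : ℂ} {r : ℝ} (hs : 0 < s.re) (hr : 0 < r) :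
    ‖s.betaIntegral r‖ ≤ Real.Gamma s.re * Real.Gamma r / Real.Gamma (s.re + r) := by
  have h0 : (Real.Gamma s.re * Real.Gamma r / Real.Gamma (s.re + r) : ℝ) =
      ‖(s.re : ℂ).betaIntegral r‖ := by
    have h := Complex.Gamma_mul_Gamma_eq_betaIntegral (s := (s.re : ℂ)) (t := (r : ℂ)) hs hr
    have h' := congrArg norm h
    rw [norm_mul, norm_mul, Complex.Gamma_ofReal, Complex.Gamma_ofReal, ← Complex.ofReal_add,
      Complex.Gamma_ofReal] at h'
    simp only [Complex.norm_real, Real.norm_eq_abs] at h'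
    rw [abs_of_pos (Real.Gamma_pos_of_pos hs), abs_of_pos (Real.Gamma_pos_of_pos hr),
      abs_of_pos (Real.Gamma_pos_of_pos (add_pos hs hr))] at h'
    rw [h']
    field_simp [(Real.Gamma_pos_of_pos (add_pos hs hr)).ne']
  have hint : (s.re : ℂ).betaIntegral r =
      ((∫ x in (0:ℝ)..1, x ^ (s.re - 1) * (1 - x) ^ (r - 1) : ℝ) : ℂ) := by
    rw [Complex.betaIntegral, ← intervalIntegral.integral_ofReal]
    refine intervalIntegral.integral_congr fun x hx => ?_
    rw [Set.uIcc_of_le zero_le_one] at hx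
    push_cast [Complex.ofReal_cpow hx.1, Complex.ofReal_cpow (sub_nonneg.2 hx.2)]
    rfl
  have hnn : 0 ≤ ∫ x in (0:ℝ)..1, x ^ (s.re - 1) * (1 - x) ^ (r - 1) :=
    intervalIntegral.integral_nonneg zero_le_one fun x hx =>
      mul_nonneg (Real.rpow_nonneg hx.1 _) (Real.rpow_nonneg (sub_nonneg.2 hx.2) _)
  rw [h0, hint, Complex.norm_real, Real.norm_of_nonneg hnn, Complex.betaIntegral]
  have hI : IntervalIntegrable (fun x : ℝ => x ^ (s.re - 1) * (1 - x) ^ (r - 1))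
      MeasureTheory.volume 0 1 := by
    have := (Complex.betaIntegral_convergent (u := (s.re : ℂ)) (v := (r : ℂ)) hs hr).norm
    refine this.congr fun x hx => ?_
    rw [Set.uIoc_of_le zero_le_one] at hx
    have h1 : (0:ℝ) ≤ x := hx.1.le
    have h2 : (0:ℝ) ≤ 1 - x := sub_nonneg.2 hx.2
    rw [show ((x:ℂ) ^ ((s.re:ℂ) - 1) * (1 - (x:ℂ)) ^ ((r:ℂ) - 1)) =
      ((x ^ (s.re - 1) * (1 - x) ^ (r - 1) : ℝ) : ℂ) by
        push_cast [Complex.ofReal_cpow h1, Complex.ofReal_cpow h2]; rfl, Complex.norm_real]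
    exact Real.norm_of_nonneg (mul_nonneg (Real.rpow_nonneg h1 _) (Real.rpow_nonneg h2 _))
  refine intervalIntegral.norm_integral_le_of_norm_le zero_le_one ?_ hI
  have hne : ∀ᵐ x : ℝ, x ≠ 1 := by simp [MeasureTheory.ae_iff, MeasureTheory.measure_singleton]
  filter_upwards [hne] with x hx1 hx
  have h2 : (0:ℝ) < 1 - x := sub_pos.2 (lt_of_le_of_ne hx.2 hx1)
  rw [norm_mul, Complex.norm_cpow_eq_rpow_re_of_pos hx.1,
    show (1 - (x:ℂ)) = ((1 - x : ℝ) : ℂ) by push_cast; rfl, Complex.norm_cpow_eq_rpow_re_of_pos h2]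
  simp

/-- On a horizontal line `‖Γ(x + it)‖ / Γ(x)` is nondecreasing in `x > 0`. -/
theorem norm_Gamma_mul_le {s : ℂ} {r : ℝ} (hs : 0 < s.re) (hr : 0 ≤ r) :
    ‖Complex.Gamma s‖ * Real.Gamma (s.re + r) ≤ ‖Complex.Gamma (s + r)‖ * Real.Gamma s.re := by
  rcases hr.eq_or_lt with rfl | hr
  · simp
  have h := congrArg norm (Complex.Gamma_mul_Gamma_eq_betaIntegral (s := s) (t := (r : ℂ)) hs hr)
  rw [norm_mul, norm_mul, Complex.Gamma_ofReal, Complex.norm_real,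
    Real.norm_of_nonneg (Real.Gamma_pos_of_pos hr).le] at h
  have h1 := norm_betaIntegral_le hs hr
  have hr' := Real.Gamma_pos_of_pos hr
  have hsr := Real.Gamma_pos_of_pos (add_pos hs hr)
  rw [le_div_iff₀ hsr] at h1
  have h2 := mul_le_mul_of_nonneg_left h1 (norm_nonneg (Complex.Gamma (s + r)))
  rw [← mul_assoc, ← h] at h2
  nlinarith [h2]

theorem norm_Gamma_half_mul_exp {t : ℝ} (ht : 0 ≤ t) :
    1 ≤ ‖Complex.Gamma (1 / 2 + t * Complex.I)‖ * Real.exp (Real.pi * t / 2) ∧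
      ‖Complex.Gamma (1 / 2 + t * Complex.I)‖ * Real.exp (Real.pi * t / 2) ≤ 3 := by
  have h := sq_norm_Gamma_half t
  have hc : 0 < Real.cosh (Real.pi * t) := Real.cosh_pos _
  set y := ‖Complex.Gamma (1 / 2 + t * Complex.I)‖ * Real.exp (Real.pi * t / 2) with hy
  have hy0 : 0 ≤ y := by positivity
  have hsq : y ^ 2 * Real.cosh (Real.pi * t) = Real.pi * Real.exp (Real.pi * t) := by
    rw [hy, mul_pow, h, ← Real.exp_nat_mul, show ((2:ℕ):ℝ) * (Real.pi * t / 2) = Real.pi * t by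
      push_cast; ring]
    field_simp
  have h1 : Real.cosh (Real.pi * t) ≤ Real.exp (Real.pi * t) := by
    rw [Real.cosh_eq]
    have : Real.exp (-(Real.pi * t)) ≤ Real.exp (Real.pi * t) :=
      Real.exp_le_exp.2 (by nlinarith [Real.pi_pos])
    linarith
  have h2 : Real.exp (Real.pi * t) ≤ 2 * Real.cosh (Real.pi * t) := by
    rw [Real.cosh_eq]
    have := Real.exp_pos (-(Real.pi * t))
    linarith
  have hp3 := Real.pi_gt_three
  have hp4 := Real.pi_lt_d2
  constructor
  · have : 1 * Real.cosh (Real.pi * t) ≤ y ^ 2 * Real.cosh (Real.pi * t) := by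
      rw [hsq]; nlinarith
    have := le_of_mul_le_mul_right this hc
    nlinarith
  · have : y ^ 2 * Real.cosh (Real.pi * t) ≤ (2 * Real.pi) * Real.cosh (Real.pi * t) := by
      rw [hsq]; nlinarith
    have := le_of_mul_le_mul_right this hc
    nlinarith

/-- In a bounded vertical strip `‖Γ(x + it)‖ e^{πt/2}` lies between two powers of `t`. -/
theorem norm_Gamma_mul_exp_bounds (N : ℕ) : ∃ K : ℝ, 1 ≤ K ∧ ∃ p : ℕ, ∀ s : ℂ,
    1 / 2 - (N:ℝ) ≤ s.re → s.re ≤ 3 / 2 + N → 1 ≤ s.im →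
      1 ≤ K * s.im ^ p * (‖Complex.Gamma s‖ * Real.exp (Real.pi * s.im / 2)) ∧
      ‖Complex.Gamma s‖ * Real.exp (Real.pi * s.im / 2) ≤ K * s.im ^ p := by
  induction N with
  | zero =>
    obtain ⟨C, hC⟩ := (isCompact_Icc (a := (1/2:ℝ)) (b := 3/2)).exists_bound_of_continuousOn
      (f := fun x => Real.Gamma x + (Real.Gamma x)⁻¹) (by
        intro x hx
        have hx0 : 0 < x := by linarith [hx.1]
        have h1 : ContinuousAt Real.Gamma x :=
          (Real.differentiableAt_Gamma fun m => by
            have : (0:ℝ) ≤ m := Nat.cast_nonneg m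
            linarith).continuousAt
        exact (h1.add (h1.inv₀ (Real.Gamma_pos_of_pos hx0).ne')).continuousWithinAt)
    have hG : ∀ x : ℝ, 1/2 ≤ x → x ≤ 3/2 → 0 < Real.Gamma x ∧ Real.Gamma x ≤ C ∧
        1 ≤ C * Real.Gamma x := by
      intro x h1 h2
      have hp := Real.Gamma_pos_of_pos (show 0 < x by linarith)
      have := hC x ⟨h1, h2⟩
      rw [Real.norm_of_nonneg (by positivity)] at this
      have hi : 0 < (Real.Gamma x)⁻¹ := by positivity
      refine ⟨hp, by linarith, ?_⟩
      have : (Real.Gamma x)⁻¹ ≤ C := by linarith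
      rwa [inv_le_iff_one_le_mul₀ hp] at this
    have hC0 : 0 < C := (hG 1 (by norm_num) (by norm_num)).1.trans_le
      (hG 1 (by norm_num) (by norm_num)).2.1
    refine ⟨6 * C ^ 2 + 1, by nlinarith, 1, fun s h1 h2 h3 => ?_⟩
    simp only [Nat.cast_zero, sub_zero, add_zero, pow_one] at h1 h2 ⊢
    obtain ⟨b1, b2⟩ := norm_Gamma_half_mul_exp (t := s.im) (by linarith)
    set E := Real.exp (Real.pi * s.im / 2) with hE
    have hE0 : 0 < E := Real.exp_pos _
    set g := ‖Complex.Gamma (1 / 2 + s.im * Complex.I)‖ with hg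
    obtain ⟨g1, g2, g3⟩ := hG s.re h1 h2
    obtain ⟨q1, q2, q3⟩ := hG (1/2) le_rfl (by norm_num)
    obtain ⟨r1, r2, r3⟩ := hG (3/2) (by norm_num) le_rfl
    constructor
    · have := norm_Gamma_mul_le (s := 1 / 2 + s.im * Complex.I) (r := s.re - 1/2)
        (by simp) (by linarith)
      have e1 : (1 / 2 + s.im * Complex.I : ℂ) + ((s.re - 1/2 : ℝ) : ℂ) = s := by
        apply Complex.ext <;> simp
      have e2 : (1 / 2 + s.im * Complex.I : ℂ).re = 1/2 := by simp
      rw [e1, e2, show 1/2 + (s.re - 1/2) = s.re by ring, ← hg] at this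
      have h5 : g * E * Real.Gamma s.re ≤ ‖Complex.Gamma s‖ * E * C := by
        calc g * E * Real.Gamma s.re = (g * Real.Gamma s.re) * E := by ring
          _ ≤ (‖Complex.Gamma s‖ * Real.Gamma (1/2)) * E := by gcongr
          _ ≤ (‖Complex.Gamma s‖ * C) * E := by gcongr
          _ = _ := by ring
      have h6 : Real.Gamma s.re ≤ ‖Complex.Gamma s‖ * E * C := by nlinarith
      have h7 : 1 ≤ C * (‖Complex.Gamma s‖ * E * C) := g3.trans (by gcongr)
      have hnn : 0 ≤ ‖Complex.Gamma s‖ * E := by positivity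
      calc (1:ℝ) ≤ C ^ 2 * 1 * (‖Complex.Gamma s‖ * E) := by linarith
        _ ≤ (6 * C ^ 2 + 1) * s.im * (‖Complex.Gamma s‖ * E) := by gcongr; nlinarith
    · have := norm_Gamma_mul_le (s := s) (r := 3/2 - s.re) (by linarith) (by linarith)
      have e1 : s + ((3/2 - s.re : ℝ) : ℂ) = (1 / 2 + s.im * Complex.I) + 1 := by
        apply Complex.ext <;> simp; norm_num
      have e3 : (1 / 2 + s.im * Complex.I : ℂ) ≠ 0 := by
        intro h; have := congrArg Complex.re h; simp at this
      rw [e1, Complex.Gamma_add_one _ e3, norm_mul, ← hg,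
        show s.re + (3/2 - s.re) = 3/2 by ring] at this
      have e4 : ‖(1 / 2 + s.im * Complex.I : ℂ)‖ ≤ 2 * s.im := by
        refine (Complex.norm_le_abs_re_add_abs_im _).trans ?_
        simp
        rw [abs_of_nonneg (by linarith : (0:ℝ) ≤ s.im)]
        linarith
      have hg0 : 0 ≤ g := norm_nonneg _
      calc ‖Complex.Gamma s‖ * E ≤ ‖Complex.Gamma s‖ * E * (C * Real.Gamma (3/2)) :=
            le_mul_of_one_le_right (by positivity) r3
        _ = C * E * (‖Complex.Gamma s‖ * Real.Gamma (3/2)) := by ring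
        _ ≤ C * E * (‖(1 / 2 + s.im * Complex.I : ℂ)‖ * g * Real.Gamma s.re) := by gcongr
        _ ≤ C * E * (2 * s.im * g * C) := by gcongr
        _ = 2 * C ^ 2 * s.im * (g * E) := by ring
        _ ≤ 2 * C ^ 2 * s.im * 3 := by gcongr
        _ ≤ (6 * C ^ 2 + 1) * s.im := by nlinarith
  | succ N ih =>
    obtain ⟨K, hK, p, h⟩ := ih
    refine ⟨(K + 1) * (N + 4), by nlinarith [(Nat.cast_nonneg N : (0:ℝ) ≤ N)], p + 1,
      fun s h1 h2 h3 => ?_⟩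
    push_cast at h1 h2
    set E := Real.exp (Real.pi * s.im / 2) with hE
    have hE0 : 0 < E := Real.exp_pos _
    have hN0 : (0:ℝ) ≤ N := Nat.cast_nonneg N
    have hpp : 1 ≤ s.im ^ p := one_le_pow₀ h3
    rcases lt_or_ge s.re (1 / 2 - N) with hlo | hlo
    · obtain ⟨i1, i2⟩ := h (s + 1) (by simp; linarith) (by simp; linarith) (by simpa using h3)
      have hs0 : s ≠ 0 := by rintro rfl; simp at h3; linarith
      rw [Complex.Gamma_add_one s hs0, norm_mul] at i1 i2
      simp only [Complex.add_im, Complex.one_im, add_zero] at i1 i2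
      rw [← hE] at i1 i2
      have n1 : 1 ≤ ‖s‖ := h3.trans ((le_abs_self _).trans (Complex.abs_im_le_norm s))
      have n2 : ‖s‖ ≤ (N + 4) * s.im := by
        refine (Complex.norm_le_abs_re_add_abs_im _).trans ?_
        have : |s.re| ≤ N + 3 := abs_le.2 ⟨by linarith, by linarith⟩
        rw [abs_of_nonneg (by linarith : (0:ℝ) ≤ s.im)]
        nlinarith
      constructor
      · calc (1:ℝ) ≤ _ := i1
          _ ≤ K * s.im ^ p * (((N + 4) * s.im) * ‖Complex.Gamma s‖ * E) := by gcongr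
          _ = K * (N + 4) * s.im ^ (p + 1) * (‖Complex.Gamma s‖ * E) := by ring
          _ ≤ _ := by gcongr; linarith
      · calc ‖Complex.Gamma s‖ * E ≤ ‖s‖ * ‖Complex.Gamma s‖ * E := by
              rw [mul_assoc]; exact le_mul_of_one_le_left (by positivity) n1
          _ ≤ K * s.im ^ p := i2
          _ ≤ (K + 1) * (N + 4) * s.im ^ (p + 1) := by
              rw [pow_succ, ← mul_assoc]
              have : K ≤ (K + 1) * (N + 4) := by nlinarith
              calc K * s.im ^ p ≤ (K + 1) * (N + 4) * s.im ^ p := by gcongr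
                _ ≤ _ := le_mul_of_one_le_right (by positivity) h3
    · rcases le_or_gt s.re (3 / 2 + N) with hhi | hhi
      · obtain ⟨i1, i2⟩ := h s hlo hhi h3
        rw [← hE] at i1 i2
        have hKK : K * s.im ^ p ≤ (K + 1) * (N + 4) * s.im ^ (p + 1) := by
          rw [pow_succ, ← mul_assoc]
          have : K ≤ (K + 1) * (N + 4) := by nlinarith
          calc K * s.im ^ p ≤ (K + 1) * (N + 4) * s.im ^ p := by gcongr
            _ ≤ _ := le_mul_of_one_le_right (by positivity) h3
        exact ⟨i1.trans (by gcongr), i2.trans hKK⟩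
      · obtain ⟨i1, i2⟩ := h (s - 1) (by simp; linarith) (by simp; linarith) (by simpa using h3)
        simp only [Complex.sub_im, Complex.one_im, sub_zero] at i1 i2
        rw [← hE] at i1 i2
        have hs0 : s - 1 ≠ 0 := by
          intro h; have := congrArg Complex.im h; simp at this; linarith
        have hG : Complex.Gamma s = (s - 1) * Complex.Gamma (s - 1) := by
          rw [← Complex.Gamma_add_one _ hs0]; ring_nf
        have n1 : 1 ≤ ‖s - 1‖ := by
          have := (le_abs_self _).trans (Complex.abs_im_le_norm (s - 1))
          simp at this; linarith
        have n2 : ‖s - 1‖ ≤ (N + 4) * s.im := by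
          refine (Complex.norm_le_abs_re_add_abs_im _).trans ?_
          have : |(s - 1).re| ≤ N + 3 := abs_le.2 ⟨by simp; linarith, by simp; linarith⟩
          rw [show (s - 1).im = s.im by simp, abs_of_nonneg (by linarith : (0:ℝ) ≤ s.im)]
          nlinarith
        rw [hG, norm_mul]
        constructor
        · calc (1:ℝ) ≤ K * s.im ^ p * (‖Complex.Gamma (s - 1)‖ * E) := i1
            _ ≤ K * s.im ^ p * (‖s - 1‖ * ‖Complex.Gamma (s - 1)‖ * E) := by
                gcongr; exact le_mul_of_one_le_left (by positivity) n1
            _ ≤ _ := by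
                have : K * s.im ^ p ≤ (K + 1) * (N + 4) * s.im ^ (p + 1) := by
                  rw [pow_succ, ← mul_assoc]
                  have : K ≤ (K + 1) * (N + 4) := by nlinarith
                  calc K * s.im ^ p ≤ (K + 1) * (N + 4) * s.im ^ p := by gcongr
                    _ ≤ _ := le_mul_of_one_le_right (by positivity) h3
                gcongr
        · calc ‖s - 1‖ * ‖Complex.Gamma (s - 1)‖ * E
              = ‖s - 1‖ * (‖Complex.Gamma (s - 1)‖ * E) := by ring
            _ ≤ ((N + 4) * s.im) * (K * s.im ^ p) := by gcongr
            _ = K * (N + 4) * s.im ^ (p + 1) := by ring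
            _ ≤ _ := by gcongr; linarith

open Set Filter Topology MeasureTheory

/-! ### The incomplete Gamma integral with imaginary frequency -/


/-- The series `∑ xᵏ / (k! (k + 1 - s))`; for `re s < 1` and `b > 0` the number
`b ^ (1 - s) * lowerSeries (-w b) s` is `∫₀ᵇ e^{-w y} y^{-s} dy`, and it continues that integral
to all non-real `s`. -/
noncomputable def lowerSeries (x s : ℂ) : ℂ :=
  ∑' k : ℕ, x ^ k / (k.factorial * (k + 1 - s))

theorem im_le_norm_natCast_add_one_sub {s : ℂ} (k : ℕ) : s.im ≤ ‖(k + 1 - s : ℂ)‖ := by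
  have := (neg_le_abs _).trans (Complex.abs_im_le_norm (k + 1 - s))
  simpa using this

theorem natCast_add_one_sub_ne_zero {s : ℂ} (hs : 0 < s.im) (k : ℕ) : (k + 1 - s : ℂ) ≠ 0 :=
  norm_pos_iff.1 (hs.trans_le (im_le_norm_natCast_add_one_sub k))

theorem norm_lowerSeries_term_le {x s : ℂ} {δ r : ℝ} (hδ : 0 < δ) (hs : δ ≤ s.im) (hx : ‖x‖ ≤ r)
    (k : ℕ) : ‖x ^ k / (k.factorial * (k + 1 - s))‖ ≤ r ^ k / k.factorial / δ := by
  rw [norm_div, norm_mul, norm_pow, Complex.norm_natCast, div_div]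
  have := hs.trans (im_le_norm_natCast_add_one_sub (s := s) k)
  have h0 : (0:ℝ) < k.factorial := by positivity
  have hr : 0 ≤ r := (norm_nonneg x).trans hx
  gcongr

theorem norm_lowerSeries_le {x s : ℂ} (hs : 0 < s.im) :
    ‖lowerSeries x s‖ ≤ Real.exp ‖x‖ / s.im := by
  have h := (NormedSpace.expSeries_div_hasSum_exp ‖x‖).div_const s.im
  rw [← Real.exp_eq_exp_ℝ] at h
  exact tsum_of_norm_bounded h fun k => norm_lowerSeries_term_le hs le_rfl le_rfl k

theorem continuousOn_lowerSeries :
    ContinuousOn (fun p : ℂ × ℂ => lowerSeries p.1 p.2) {p : ℂ × ℂ | 0 < p.2.im} := by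
  intro p hp
  obtain ⟨δ, hδ, hδp⟩ := exists_between (show 0 < p.2.im from hp)
  have hopen : IsOpen {q : ℂ × ℂ | ‖q.1‖ < ‖p.1‖ + 1 ∧ δ < q.2.im} :=
    (isOpen_lt (continuous_norm.comp continuous_fst) continuous_const).inter
      (isOpen_lt continuous_const (Complex.continuous_im.comp continuous_snd))
  have hc : ContinuousOn (fun q : ℂ × ℂ => lowerSeries q.1 q.2)
      {q : ℂ × ℂ | ‖q.1‖ < ‖p.1‖ + 1 ∧ δ < q.2.im} := by
    refine continuousOn_tsum
      (f := fun (k : ℕ) (q : ℂ × ℂ) => q.1 ^ k / (k.factorial * (k + 1 - q.2)))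
      (u := fun k => (‖p.1‖ + 1) ^ k / k.factorial / δ) (fun k => ?_)
      ((Real.summable_pow_div_factorial _).div_const δ)
      (fun k q hq => norm_lowerSeries_term_le hδ hq.2.le hq.1.le k)
    have h1 : Continuous fun q : ℂ × ℂ => q.1 ^ k := by fun_prop
    have h2 : Continuous fun q : ℂ × ℂ => (k.factorial * (k + 1 - q.2) : ℂ) := by fun_prop
    refine h1.continuousOn.div h2.continuousOn fun q hq => ?_
    exact mul_ne_zero (by exact_mod_cast k.factorial_ne_zero)
      (natCast_add_one_sub_ne_zero (hδ.trans hq.2) k)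
  exact (hc.continuousAt (hopen.mem_nhds ⟨by simp, hδp⟩)).continuousWithinAt

theorem differentiableOn_lowerSeries_right (x : ℂ) :
    DifferentiableOn ℂ (lowerSeries x) {s | 0 < s.im} := by
  intro s hs
  obtain ⟨δ, hδ, hδp⟩ := exists_between (show 0 < s.im from hs)
  have hopen : IsOpen {s : ℂ | δ < s.im} := isOpen_lt continuous_const Complex.continuous_im
  have hc : DifferentiableOn ℂ (lowerSeries x) {s : ℂ | δ < s.im} := by
    refine Complex.differentiableOn_tsum_of_summable_norm (u := fun k => ‖x‖ ^ k / k.factorial / δ)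
      ((Real.summable_pow_div_factorial _).div_const δ) (fun k => ?_) hopen
      (fun k q hq => norm_lowerSeries_term_le hδ (le_of_lt hq) le_rfl k)
    refine DifferentiableOn.div (by fun_prop) (by fun_prop) fun q hq => ?_
    exact mul_ne_zero (by exact_mod_cast k.factorial_ne_zero)
      (natCast_add_one_sub_ne_zero (hδ.trans hq) k)
  exact (hc.differentiableAt (hopen.mem_nhds hδp)).differentiableWithinAt

theorem differentiable_lowerSeries_left {s : ℂ} (hs : 0 < s.im) :
    Differentiable ℂ (fun x => lowerSeries x s) := by
  intro x
  have hopen : IsOpen {y : ℂ | ‖y‖ < ‖x‖ + 1} := isOpen_lt (by fun_prop) continuous_const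
  have hc : DifferentiableOn ℂ (fun x => lowerSeries x s) {y : ℂ | ‖y‖ < ‖x‖ + 1} := by
    refine Complex.differentiableOn_tsum_of_summable_norm
      (u := fun k => (‖x‖ + 1) ^ k / k.factorial / s.im)
      ((Real.summable_pow_div_factorial _).div_const _) (fun k => ?_) hopen
      (fun k q hq => norm_lowerSeries_term_le hs le_rfl (le_of_lt hq) k)
    fun_prop
  exact hc.differentiableAt (hopen.mem_nhds (by simp))

theorem integral_exp_mul_cpow_zero_left (w : ℂ) {b : ℝ} (hb : 0 < b) {s : ℂ} (hs : s.re < 1)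
    (hs' : 0 < s.im) :
    IntegrableOn (fun y : ℝ => Complex.exp (-w * y) * (y : ℂ) ^ (-s)) (Ioc 0 b) ∧
    ∫ y in Ioc 0 b, Complex.exp (-w * y) * (y : ℂ) ^ (-s) =
      (b : ℂ) ^ (1 - s) * lowerSeries (-w * b) s := by
  have hr : -1 < (-s).re := by simp; linarith
  have hI0 : IntegrableOn (fun y : ℝ => (y : ℂ) ^ (-s)) (Ioc 0 b) :=
    (intervalIntegrable_iff_integrableOn_Ioc_of_le hb.le).1
      (intervalIntegral.intervalIntegrable_cpow' hr)
  have hint : IntegrableOn (fun y : ℝ => Complex.exp (-w * y) * (y : ℂ) ^ (-s)) (Ioc 0 b) := by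
    rw [integrableOn_Ioc_iff_integrableOn_Ioo, ← integrableOn_Icc_iff_integrableOn_Ioo] at *
    exact hI0.continuousOn_mul (by fun_prop) isCompact_Icc
  refine ⟨hint, ?_⟩
  have hterm : ∀ k : ℕ, IntegrableOn (fun y : ℝ => (-w) ^ k / k.factorial * (y : ℂ) ^ ((k:ℂ) - s))
      (Ioc 0 b) := fun k => by
    refine Integrable.const_mul ?_ _
    exact (intervalIntegrable_iff_integrableOn_Ioc_of_le hb.le).1
      (intervalIntegral.intervalIntegrable_cpow' (by
        simp; linarith [(Nat.cast_nonneg k : (0:ℝ) ≤ k)]))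
  have hnorm : ∀ k : ℕ, ∫ y in Ioc 0 b, ‖(-w) ^ k / k.factorial * (y : ℂ) ^ ((k:ℂ) - s)‖ =
      ‖w‖ ^ k / k.factorial * (b ^ (k + 1 - s.re) / (k + 1 - s.re)) := fun k => by
    have h1 : ∫ y in Ioc 0 b, ‖(-w) ^ k / k.factorial * (y : ℂ) ^ ((k:ℂ) - s)‖ =
        ∫ y in Ioc 0 b, ‖w‖ ^ k / k.factorial * y ^ ((k:ℝ) - s.re) := by
      refine setIntegral_congr_fun measurableSet_Ioc fun y hy => ?_
      simp [Complex.norm_cpow_eq_rpow_re_of_pos hy.1]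
    rw [h1, integral_const_mul, ← intervalIntegral.integral_of_le hb.le, integral_rpow]
    · rw [show (k:ℝ) - s.re + 1 = k + 1 - s.re by ring, Real.zero_rpow, sub_zero]
      linarith [(Nat.cast_nonneg k : (0:ℝ) ≤ k)]
    · left; linarith [(Nat.cast_nonneg k : (0:ℝ) ≤ k)]
  have hsum : Summable fun k : ℕ => ∫ y in Ioc 0 b,
      ‖(-w) ^ k / k.factorial * (y : ℂ) ^ ((k:ℂ) - s)‖ := by
    simp only [hnorm]
    refine Summable.of_nonneg_of_le (fun k => ?_) (fun k => ?_)
      ((Real.summable_pow_div_factorial (‖w‖ * b)).mul_right (b ^ (1 - s.re) / (1 - s.re)))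
    · have : (0:ℝ) < k + 1 - s.re := by linarith [(Nat.cast_nonneg k : (0:ℝ) ≤ k)]
      positivity
    · rw [show (k:ℝ) + 1 - s.re = k + (1 - s.re) by ring, Real.rpow_add hb, Real.rpow_natCast,
        mul_pow]
      have h2 : (0:ℝ) < 1 - s.re := by linarith
      have h3 : (1 - s.re) ≤ k + (1 - s.re) := by linarith [(Nat.cast_nonneg k : (0:ℝ) ≤ k)]
      calc ‖w‖ ^ k / k.factorial * (b ^ k * b ^ (1 - s.re) / (k + (1 - s.re)))
          ≤ ‖w‖ ^ k / k.factorial * (b ^ k * b ^ (1 - s.re) / (1 - s.re)) := by gcongr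
        _ = _ := by ring
  have key := hasSum_integral_of_summable_integral_norm hterm hsum
  have h1 : ∫ y in Ioc 0 b, Complex.exp (-w * y) * (y : ℂ) ^ (-s) =
      ∫ y in Ioc 0 b, ∑' k : ℕ, (-w) ^ k / k.factorial * (y : ℂ) ^ ((k:ℂ) - s) := by
    refine setIntegral_congr_fun measurableSet_Ioc fun y hy => ?_
    have hy0 : (y : ℂ) ≠ 0 := by exact_mod_cast hy.1.ne'
    rw [Complex.exp_eq_exp_ℂ, ← (NormedSpace.expSeries_div_hasSum_exp (-w * y)).tsum_eq,
      ← tsum_mul_right]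
    refine tsum_congr fun k => ?_
    rw [sub_eq_add_neg, Complex.cpow_add _ _ hy0, Complex.cpow_natCast, mul_pow]
    ring
  rw [h1, ← key.tsum_eq, lowerSeries, ← tsum_mul_left]
  refine tsum_congr fun k => ?_
  rw [integral_const_mul, ← intervalIntegral.integral_of_le hb.le, integral_cpow]
  · have hne := natCast_add_one_sub_ne_zero hs' k
    have hb0 : (b : ℂ) ≠ 0 := by exact_mod_cast hb.ne'
    rw [show (k:ℂ) - s + 1 = k + 1 - s by ring, Complex.ofReal_zero, Complex.zero_cpow hne,
      sub_zero, show (k:ℂ) + 1 - s = k + (1 - s) by ring, Complex.cpow_add _ _ hb0,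
      Complex.cpow_natCast, mul_pow]
    rw [show (k:ℂ) + 1 - s = k + (1 - s) by ring] at hne
    have : (k.factorial : ℂ) ≠ 0 := by exact_mod_cast k.factorial_ne_zero
    field_simp
  · left; simp; linarith [(Nat.cast_nonneg k : (0:ℝ) ≤ k)]

theorem norm_exp_mul_cpow {w s : ℂ} {y : ℝ} (hy : 0 < y) :
    ‖Complex.exp (-w * y) * (y : ℂ) ^ (-s)‖ = Real.exp (-w.re * y) * y ^ (-s.re) := by
  rw [norm_mul, Complex.norm_exp, Complex.norm_cpow_eq_rpow_re_of_pos hy]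
  simp

theorem continuousOn_exp_mul_cpow (w s : ℂ) :
    ContinuousOn (fun y : ℝ => Complex.exp (-w * y) * (y : ℂ) ^ (-s)) (Ioi 0) := by
  refine ContinuousOn.mul (by fun_prop) ?_
  exact ContinuousOn.cpow (by fun_prop) (by fun_prop) fun y hy => Complex.ofReal_mem_slitPlane.2 hy

theorem integrableOn_exp_mul_cpow {w s : ℂ} {b : ℝ} (hb : 0 < b) (hw : 0 ≤ w.re) (hs : 1 < s.re) :
    IntegrableOn (fun y : ℝ => Complex.exp (-w * y) * (y : ℂ) ^ (-s)) (Ioi b) := by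
  refine (integrableOn_Ioi_rpow_of_lt (a := -s.re) (by linarith) hb).mono'
    (((continuousOn_exp_mul_cpow w s).mono (Ioi_subset_Ioi hb.le)).aestronglyMeasurable
      measurableSet_Ioi) ?_
  refine (ae_restrict_mem measurableSet_Ioi).mono fun y hy => ?_
  have hy0 : 0 < y := hb.trans hy
  rw [norm_exp_mul_cpow hy0]
  refine mul_le_of_le_one_left (Real.rpow_nonneg hy0.le _) (Real.exp_le_one_iff.2 ?_)
  nlinarith

theorem differentiable_integral_exp_mul_cpow {w b : ℝ} (hb : 0 < b) (hw : 0 < w) :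
    Differentiable ℂ (fun s : ℂ => ∫ y in Ioi b, Complex.exp (-w * y) * (y : ℂ) ^ (-s)) := by
  intro s
  set f : ℝ → ℂ := (Ioi b).indicator fun y => Complex.exp (-w * y) with hf
  have h1 : ∀ s : ℂ, ∫ y in Ioi b, Complex.exp (-w * y) * (y : ℂ) ^ (-s) = mellin f (1 - s) := by
    intro s
    rw [mellin]
    have : Ioi (0:ℝ) ∩ Ioi b = Ioi b := inter_eq_right.2 (Ioi_subset_Ioi hb.le)
    rw [← this, ← setIntegral_indicator measurableSet_Ioi]
    refine setIntegral_congr_fun measurableSet_Ioi fun y hy => ?_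
    by_cases h : y ∈ Ioi b
    · simp [hf, indicator_of_mem h, mul_comm]
    · simp [hf, indicator_of_notMem h]
  simp only [h1]
  have hd : DifferentiableAt ℂ (mellin f) (1 - s) := by
    refine mellin_differentiableAt_of_isBigO_rpow_exp (a := w) (b := (1 - s).re - 1) hw ?_ ?_ ?_
      (by linarith)
    · refine LocallyIntegrable.locallyIntegrableOn ?_ _
      refine LocallyIntegrable.indicator ?_ measurableSet_Ioi
      exact Continuous.locallyIntegrable (by fun_prop)
    · refine Asymptotics.IsBigO.of_bound 1 (Eventually.of_forall fun y => ?_)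
      by_cases h : y ∈ Ioi b
      · simp [hf, indicator_of_mem h, Complex.norm_exp]
      · rw [hf, indicator_of_notMem h, norm_zero]
        positivity
    · refine (Asymptotics.isBigO_zero _ _).congr' ?_ EventuallyEq.rfl
      filter_upwards [mem_nhdsWithin_of_mem_nhds (Iio_mem_nhds hb)] with y hy
      simp [hf, indicator_of_notMem (s := Ioi b) (a := y) (by simpa using le_of_lt hy)]
  exact hd.comp s (f := fun s => 1 - s) (by fun_prop)

theorem integral_exp_mul_cpow_ofReal {w b : ℝ} (hb : 0 < b) (hw : 0 < w) {s : ℂ} (hs : 0 < s.im) :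
    ∫ y in Ioi b, Complex.exp (-w * y) * (y : ℂ) ^ (-s) =
      Complex.Gamma (1 - s) * (w : ℂ) ^ (s - 1) -
        (b : ℂ) ^ (1 - s) * lowerSeries (-w * b) s := by
  have hU : IsOpen {s : ℂ | 0 < s.im} := isOpen_lt continuous_const Complex.continuous_im
  have hb0 : (b : ℂ) ≠ 0 := by exact_mod_cast hb.ne'
  have hw0 : (w : ℂ) ≠ 0 := by exact_mod_cast hw.ne'
  have a1 : AnalyticOnNhd ℂ (fun s : ℂ => ∫ y in Ioi b, Complex.exp (-w * y) * (y : ℂ) ^ (-s))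
      {s : ℂ | 0 < s.im} :=
    (differentiable_integral_exp_mul_cpow hb hw).differentiableOn.analyticOnNhd hU
  have a2 : AnalyticOnNhd ℂ (fun s : ℂ => Complex.Gamma (1 - s) * (w : ℂ) ^ (s - 1) -
        (b : ℂ) ^ (1 - s) * lowerSeries (-w * b) s) {s : ℂ | 0 < s.im} := by
    refine DifferentiableOn.analyticOnNhd ?_ hU
    refine DifferentiableOn.sub (DifferentiableOn.mul ?_ ?_) (DifferentiableOn.mul ?_ ?_)
    · intro s hs
      refine DifferentiableAt.differentiableWithinAt ?_
      refine DifferentiableAt.comp s (Complex.differentiableAt_Gamma _ fun m h => ?_) (by fun_prop)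
      have := congrArg Complex.im h
      simp at this
      exact (ne_of_gt hs) this
    · intro s _
      exact (DifferentiableAt.const_cpow (by fun_prop) (Or.inl hw0)).differentiableWithinAt
    · intro s _
      exact (DifferentiableAt.const_cpow (by fun_prop) (Or.inl hb0)).differentiableWithinAt
    · exact differentiableOn_lowerSeries_right _
  refine a1.eqOn_of_preconnected_of_eventuallyEq a2 (convex_halfSpace_im_gt 0).isPreconnected
    (show Complex.I ∈ {s : ℂ | 0 < s.im} by simp) ?_ hs
  have hV : IsOpen {s : ℂ | s.re < 1} := isOpen_lt Complex.continuous_re continuous_const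
  filter_upwards [hU.mem_nhds (show Complex.I ∈ {s : ℂ | 0 < s.im} by simp),
    hV.mem_nhds (show Complex.I ∈ {s : ℂ | s.re < 1} by simp)] with s hs hs1
  obtain ⟨i1, e1⟩ := integral_exp_mul_cpow_zero_left (w := w) hb hs1 hs
  have hG := Complex.integral_cpow_mul_exp_neg_mul_Ioi (a := 1 - s) (r := w)
    (by simpa using hs1) hw
  have hG' : ∫ y in Ioi (0:ℝ), Complex.exp (-w * y) * (y : ℂ) ^ (-s) =
      Complex.Gamma (1 - s) * (w : ℂ) ^ (s - 1) := by
    rw [show (w : ℂ) ^ (s - 1) = (1 / (w:ℂ)) ^ (1 - s) by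
      rw [one_div, Complex.inv_cpow _ _ (by
        rw [Complex.arg_ofReal_of_nonneg hw.le]; exact Real.pi_pos.ne), ← Complex.cpow_neg]
      ring_nf, mul_comm, ← hG]
    refine setIntegral_congr_fun measurableSet_Ioi fun y _ => ?_
    rw [show 1 - s - 1 = -s by ring, mul_comm, neg_mul]
  have i2 : IntegrableOn (fun y : ℝ => Complex.exp (-w * y) * (y : ℂ) ^ (-s)) (Ioi b) := by
    have h := Complex.GammaIntegral_convergent (s := 1 - s) (by simpa using hs1)
    by_contra hcon
    have hall : ¬ IntegrableOn (fun y : ℝ => Complex.exp (-w * y) * (y : ℂ) ^ (-s)) (Ioi 0) :=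
      fun h => hcon (h.mono_set (Ioi_subset_Ioi hb.le))
    have h0 := integral_undef hall
    rw [hG'] at h0
    refine (mul_ne_zero (Complex.Gamma_ne_zero_of_re_pos (by simpa using hs1)) ?_) h0
    exact fun h => hw0 ((Complex.cpow_eq_zero_iff _ _).1 h).1
  rw [← Ioc_union_Ioi_eq_Ioi hb.le, setIntegral_union (Ioc_disjoint_Ioi le_rfl) measurableSet_Ioi
    i1 i2, e1] at hG'
  exact eq_sub_of_add_eq' hG'

theorem differentiableOn_integral_exp_mul_cpow_left {b : ℝ} (hb : 0 < b) {s : ℂ} (hs : 1 < s.re) :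
    DifferentiableOn ℂ (fun w : ℂ => ∫ y in Ioi b, Complex.exp (-w * y) * (y : ℂ) ^ (-s))
      {w : ℂ | 0 < w.re} := by
  intro w hw
  have hw' : 0 < w.re := hw
  have hcont : ContinuousOn (fun y : ℝ => (-y : ℂ) * (Complex.exp (-w * y) * (y : ℂ) ^ (-s)))
      (Ioi b) := ContinuousOn.mul (by fun_prop)
        ((continuousOn_exp_mul_cpow w s).mono (Ioi_subset_Ioi hb.le))
  have key := hasDerivAt_integral_of_dominated_loc_of_deriv_le (𝕜 := ℂ)
    (μ := volume.restrict (Ioi b))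
    (F := fun (w : ℂ) (y : ℝ) => Complex.exp (-w * y) * (y : ℂ) ^ (-s))
    (F' := fun (w : ℂ) (y : ℝ) => (-y : ℂ) * (Complex.exp (-w * y) * (y : ℂ) ^ (-s)))
    (x₀ := w) (s := Metric.ball w (w.re / 2)) (bound := fun y => (w.re / 2)⁻¹ * y ^ (-s.re))
    (Metric.ball_mem_nhds _ (by linarith))
    (Eventually.of_forall fun w' => ((continuousOn_exp_mul_cpow w' s).mono
      (Ioi_subset_Ioi hb.le)).aestronglyMeasurable measurableSet_Ioi)
    (integrableOn_exp_mul_cpow hb hw'.le hs)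
    (hcont.aestronglyMeasurable measurableSet_Ioi)
    (by
      refine (ae_restrict_mem measurableSet_Ioi).mono fun y hy w' hw'' => ?_
      have hy0 : 0 < y := hb.trans hy
      have hre : w.re / 2 ≤ w'.re := by
        have := (Complex.abs_re_le_norm (w' - w)).trans (mem_ball_iff_norm.1 hw'').le
        have := abs_le.1 this
        simp at this
        linarith [this.1]
      rw [norm_mul, norm_exp_mul_cpow hy0, norm_neg, Complex.norm_real,
        Real.norm_of_nonneg hy0.le, ← mul_assoc]
      refine mul_le_mul_of_nonneg_right ?_ (Real.rpow_nonneg hy0.le _)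
      have h1 : y * (w.re / 2) ≤ Real.exp (w'.re * y) := by
        have := Real.add_one_le_exp (w'.re * y)
        nlinarith
      rw [neg_mul, Real.exp_neg, ← div_eq_mul_inv, div_le_iff₀ (Real.exp_pos _), inv_mul_eq_div,
        le_div_iff₀ (by linarith)]
      exact h1)
    ((integrableOn_Ioi_rpow_of_lt (a := -s.re) (by linarith) hb).const_mul _)
    (by
      refine (ae_restrict_mem measurableSet_Ioi).mono fun y hy w' hw'' => ?_
      have h1 : HasDerivAt (fun w : ℂ => Complex.exp (-w * y)) (Complex.exp (-w' * y) * (-1 * y)) w' :=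
        (((hasDerivAt_id w').neg).mul_const (y : ℂ)).cexp
      exact (h1.mul_const ((y : ℂ) ^ (-s))).congr_deriv (by ring))
  exact key.2.differentiableAt.differentiableWithinAt

/-- The upper incomplete Gamma integral with `re w ≥ 0`, boundary included. -/
theorem integral_exp_mul_cpow {w : ℂ} {b : ℝ} (hb : 0 < b) (hw : 0 ≤ w.re) {s : ℂ}
    (hs : 1 < s.re) (hs' : 0 < s.im) :
    ∫ y in Ioi b, Complex.exp (-w * y) * (y : ℂ) ^ (-s) =
      Complex.Gamma (1 - s) * w ^ (s - 1) - (b : ℂ) ^ (1 - s) * lowerSeries (-w * b) s := by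
  have hU : IsOpen {w : ℂ | 0 < w.re} := isOpen_lt continuous_const Complex.continuous_re
  have hlow : Differentiable ℂ (fun w : ℂ => lowerSeries (-w * b) s) :=
    (differentiable_lowerSeries_left hs').comp (f := fun w : ℂ => -w * b) (by fun_prop)
  have hpos : ∀ w : ℂ, 0 < w.re →
      ∫ y in Ioi b, Complex.exp (-w * y) * (y : ℂ) ^ (-s) =
        Complex.Gamma (1 - s) * w ^ (s - 1) - (b : ℂ) ^ (1 - s) * lowerSeries (-w * b) s := by
    intro w hw
    have a1 := (differentiableOn_integral_exp_mul_cpow_left hb hs).analyticOnNhd hU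
    have a2 : AnalyticOnNhd ℂ (fun w : ℂ => Complex.Gamma (1 - s) * w ^ (s - 1) -
        (b : ℂ) ^ (1 - s) * lowerSeries (-w * b) s) {w : ℂ | 0 < w.re} := by
      refine DifferentiableOn.analyticOnNhd ?_ hU
      refine DifferentiableOn.sub (DifferentiableOn.const_mul ?_ _)
        (hlow.differentiableOn.const_mul _)
      intro w hw
      have hw' : w ∈ Complex.slitPlane := Or.inl hw
      exact (DifferentiableAt.cpow (f := fun w => w) (by fun_prop) (by fun_prop)
        hw').differentiableWithinAt
    refine a1.eqOn_of_preconnected_of_frequently_eq a2 (convex_halfSpace_re_gt 0).isPreconnected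
      (show (1:ℂ) ∈ {w : ℂ | 0 < w.re} by simp) ?_ hw
    have ht : Tendsto (fun x : ℝ => (x : ℂ)) (𝓝[≠] 1) (𝓝[≠] 1) := by
      refine tendsto_nhdsWithin_iff.2 ⟨?_, ?_⟩
      · have : Continuous fun x : ℝ => (x : ℂ) := by fun_prop
        simpa using (this.tendsto 1).mono_left nhdsWithin_le_nhds
      · filter_upwards [self_mem_nhdsWithin] with x hx
        simpa using hx
    refine ht.frequently (Eventually.frequently ?_)
    filter_upwards [mem_nhdsWithin_of_mem_nhds (Ioi_mem_nhds (zero_lt_one (α := ℝ)))] with x hx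
    exact integral_exp_mul_cpow_ofReal hb hx hs'
  have hs1 : 0 < (s - 1).re := by simpa using hs
  have hseq : Tendsto (fun r : ℝ => w + r) (𝓝[>] 0) (𝓝 w) := by
    have : Continuous fun r : ℝ => w + r := by fun_prop
    simpa using (this.tendsto 0).mono_left nhdsWithin_le_nhds
  have l1 : Tendsto (fun r : ℝ => ∫ y in Ioi b, Complex.exp (-(w + r) * y) * (y : ℂ) ^ (-s))
      (𝓝[>] 0) (𝓝 (∫ y in Ioi b, Complex.exp (-w * y) * (y : ℂ) ^ (-s))) := by
    refine tendsto_integral_filter_of_dominated_convergence (fun y => y ^ (-s.re)) ?_ ?_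
      (integrableOn_Ioi_rpow_of_lt (a := -s.re) (by linarith) hb) ?_
    · exact Eventually.of_forall fun r => ((continuousOn_exp_mul_cpow _ s).mono
        (Ioi_subset_Ioi hb.le)).aestronglyMeasurable measurableSet_Ioi
    · filter_upwards [self_mem_nhdsWithin] with r hr
      refine (ae_restrict_mem measurableSet_Ioi).mono fun y hy => ?_
      have hy0 : 0 < y := hb.trans hy
      rw [norm_exp_mul_cpow hy0]
      refine mul_le_of_le_one_left (Real.rpow_nonneg hy0.le _) (Real.exp_le_one_iff.2 ?_)
      have hr : 0 < r := hr
      simp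
      nlinarith
    · refine Eventually.of_forall fun y => ?_
      have : Continuous fun r : ℝ => Complex.exp (-(w + r) * y) * (y : ℂ) ^ (-s) := by fun_prop
      simpa using (this.tendsto 0).mono_left nhdsWithin_le_nhds
  have l2 : Tendsto (fun w : ℂ => Complex.Gamma (1 - s) * w ^ (s - 1) -
      (b : ℂ) ^ (1 - s) * lowerSeries (-w * b) s) (𝓝 w)
      (𝓝 (Complex.Gamma (1 - s) * w ^ (s - 1) -
        (b : ℂ) ^ (1 - s) * lowerSeries (-w * b) s)) :=
    ((Complex.continuousAt_cpow_const_of_re_pos (Or.inl hw) hs1).const_mul _ |>.sub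
      ((hlow.continuous.continuousAt).const_mul _)).tendsto
  refine tendsto_nhds_unique (l1.congr' ?_) (l2.comp hseq)
  filter_upwards [self_mem_nhdsWithin] with r hr
  have hr : 0 < r := hr
  exact (hpos (w + r) (by simp; linarith)).symm ▸ rfl

/-! ### Continuation of the Lerch series with the dual leading term split off -/

/-- `unitExp x = e^{2πix}`. -/
noncomputable def unitExp (x : ℝ) : ℂ := Complex.exp (2 * Real.pi * Complex.I * x)

theorem norm_unitExp (x : ℝ) : ‖unitExp x‖ = 1 := by
  rw [unitExp, show (2 * Real.pi * Complex.I * x : ℂ) = ((2 * Real.pi * x : ℝ) : ℂ) * Complex.I by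
    push_cast; ring]
  exact Complex.norm_exp_ofReal_mul_I _

theorem unitExp_add (x y : ℝ) : unitExp (x + y) = unitExp x * unitExp y := by
  rw [unitExp, unitExp, unitExp, ← Complex.exp_add]; push_cast; ring_nf

theorem unitExp_zero : unitExp 0 = 1 := by simp [unitExp]

theorem unitExp_neg_mul_self (x : ℝ) : unitExp (-x) * unitExp x = 1 := by
  rw [← unitExp_add]; simp [unitExp_zero]

theorem unitExp_int (m : ℤ) : unitExp m = 1 := by
  rw [unitExp, Complex.exp_eq_one_iff]
  exact ⟨m, by push_cast; ring⟩

theorem unitExp_pow (x : ℝ) (n : ℕ) : unitExp x ^ n = unitExp (n * x) := by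
  rw [unitExp, unitExp, ← Complex.exp_nat_mul]; push_cast; ring_nf

theorem continuous_unitExp : Continuous unitExp := by unfold unitExp; fun_prop

/-- The Lerch series `∑ e(an) (n + b)^{-s}`, for any shift `b > 0`. -/
noncomputable def lerchSeries (a b : ℝ) (s : ℂ) : ℂ :=
  ∑' n : ℕ, unitExp a ^ n * ((n + b : ℝ) : ℂ) ^ (-s)

/-- The dual term of frequency `ν`: `Γ(1 - s) (-2πiν)^{s-1}`, which is `∫₀^∞ e(νy) y^{-s} dy` when
that integral converges. It vanishes for `ν = 0`. -/
noncomputable def dualTerm (ν : ℝ) (s : ℂ) : ℂ :=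
  Complex.Gamma (1 - s) * (-2 * Real.pi * Complex.I * ν) ^ (s - 1)

/-- The continuation of `∫₀ᵇ e(νy) y^{-s} dy`. -/
noncomputable def lowerIntegral (ν b : ℝ) (s : ℂ) : ℂ :=
  (b : ℂ) ^ (1 - s) * lowerSeries (2 * Real.pi * Complex.I * ν * b) s

theorem integral_Ioi_unitExp_mul_cpow (ν : ℝ) {b : ℝ} (hb : 0 < b) {s : ℂ} (hs : 1 < s.re)
    (hs' : 0 < s.im) :
    IntegrableOn (fun y : ℝ => unitExp (ν * y) * (y : ℂ) ^ (-s)) (Ioi b) ∧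
    ∫ y in Ioi b, unitExp (ν * y) * (y : ℂ) ^ (-s) = dualTerm ν s - lowerIntegral ν b s := by
  have hw : (0:ℝ) ≤ (-2 * Real.pi * Complex.I * ν : ℂ).re := by simp
  have e : (fun y : ℝ => unitExp (ν * y) * (y : ℂ) ^ (-s)) =
      fun y : ℝ => Complex.exp (-(-2 * Real.pi * Complex.I * ν) * y) * (y : ℂ) ^ (-s) := by
    funext y
    rw [unitExp]; push_cast; ring_nf
  rw [e]
  refine ⟨integrableOn_exp_mul_cpow hb hw hs, ?_⟩
  rw [integral_exp_mul_cpow hb hw hs hs', dualTerm, lowerIntegral]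
  ring_nf

theorem differentiableOn_dualTerm (ν : ℝ) : DifferentiableOn ℂ (dualTerm ν) {s | 0 < s.im} := by
  intro s hs
  have hs : 0 < s.im := hs
  refine (DifferentiableAt.mul ?_ ?_).differentiableWithinAt
  · refine DifferentiableAt.comp s (Complex.differentiableAt_Gamma _ fun m h => ?_) (by fun_prop)
    have := congrArg Complex.im h
    simp at this
    exact hs.ne' this
  · refine DifferentiableAt.const_cpow (by fun_prop) (Or.inr fun h => ?_)
    have := congrArg Complex.im h
    simp at this
    exact hs.ne' this

theorem dualTerm_add_one (ν : ℝ) {s : ℂ} (hs : 0 < s.im) :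
    s * dualTerm ν (s + 1) = 2 * Real.pi * Complex.I * ν * dualTerm ν s := by
  have hs0 : s ≠ 0 := by rintro rfl; simp at hs
  by_cases hν : ν = 0
  · subst hν
    simp only [dualTerm, Complex.ofReal_zero, mul_zero, add_sub_cancel_right, zero_mul]
    rw [Complex.zero_cpow hs0]; simp
  · have hw : (-2 * Real.pi * Complex.I * ν : ℂ) ≠ 0 := by
      simp [hν, Real.pi_ne_zero]
    have hG : Complex.Gamma (1 - s) = -s * Complex.Gamma (-s) := by
      rw [← Complex.Gamma_add_one _ (neg_ne_zero.2 hs0)]; ring_nf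
    rw [dualTerm, dualTerm, show 1 - (s + 1) = -s by ring, hG, add_sub_cancel_right,
      Complex.cpow_sub _ _ hw, Complex.cpow_one]
    have hν' : (ν : ℂ) ≠ 0 := by exact_mod_cast hν
    field_simp

theorem differentiableOn_lowerIntegral (ν : ℝ) {b : ℝ} (hb : 0 < b) :
    DifferentiableOn ℂ (lowerIntegral ν b) {s | 0 < s.im} := by
  refine DifferentiableOn.mul (fun s _ => ?_) (differentiableOn_lowerSeries_right _)
  exact (DifferentiableAt.const_cpow (by fun_prop)
    (Or.inl (by exact_mod_cast hb.ne'))).differentiableWithinAt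

theorem continuousOn_lowerIntegral (ν : ℝ) :
    ContinuousOn (fun p : ℝ × ℂ => lowerIntegral ν p.1 p.2) {p | 0 < p.1 ∧ 0 < p.2.im} := by
  refine ContinuousOn.mul ?_ ?_
  · exact ContinuousOn.cpow (by fun_prop) (by fun_prop) fun q hq =>
      Complex.ofReal_mem_slitPlane.2 hq.1
  · exact continuousOn_lowerSeries.comp
      (f := fun p : ℝ × ℂ => (2 * Real.pi * Complex.I * ν * p.1, p.2)) (by fun_prop)
      (fun p hp => hp.2)

theorem norm_lowerIntegral_le (ν : ℝ) {b : ℝ} (hb : 0 < b) {s : ℂ} (hs : 0 < s.im) :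
    ‖lowerIntegral ν b s‖ ≤ b ^ (1 - s.re) * (Real.exp (2 * Real.pi * |ν| * b) / s.im) := by
  rw [lowerIntegral, norm_mul, Complex.norm_cpow_eq_rpow_re_of_pos hb]
  have h := norm_lowerSeries_le (x := 2 * Real.pi * Complex.I * ν * b) hs
  have e : ‖(2 * Real.pi * Complex.I * ν * b : ℂ)‖ = 2 * Real.pi * |ν| * b := by
    simp [abs_of_pos Real.pi_pos, abs_of_pos hb]
  rw [e] at h
  simp only [Complex.sub_re, Complex.one_re]
  gcongr

theorem norm_add_ofReal_cpow_neg {n : ℕ} {b : ℝ} (hb : 0 < b) (s : ℂ) :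
    ‖((n + b : ℝ) : ℂ) ^ (-s)‖ = (n + b) ^ (-s.re) := by
  rw [Complex.norm_cpow_eq_rpow_re_of_pos (by positivity), Complex.neg_re]

theorem hasSum_integral_mul_lerchSeries (a : ℝ) {b : ℝ} (hb : 0 < b) {s : ℂ} (hs : 1 < s.re)
    {f : ℝ → ℂ} (hf : Continuous f) :
    HasSum (fun n : ℕ => ∫ u in (0:ℝ)..1, f u * (unitExp a ^ n * ((n + (b + u) : ℝ) : ℂ) ^ (-s)))
      (∫ u in (0:ℝ)..1, f u * lerchSeries a (b + u) s) := by
  have hz : ‖unitExp a‖ ≤ 1 := (norm_unitExp a).le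
  obtain ⟨C, hC⟩ := (isCompact_Icc (a := (0:ℝ)) (b := 1)).exists_bound_of_continuousOn
    hf.continuousOn
  have hbs : Summable fun n : ℕ => C * ((n:ℝ) + b) ^ (-s.re) := by
    refine Summable.mul_left C ?_
    refine (summable_lerch hz hb hs).norm.congr fun n => ?_
    rw [norm_mul, norm_pow, norm_unitExp, one_pow, one_mul, norm_add_ofReal_cpow_neg hb]
  refine intervalIntegral.hasSum_integral_of_dominated_convergence
    (fun n _ => C * ((n:ℝ) + b) ^ (-s.re)) (fun n => ?_) (fun n => ?_) ?_ ?_ ?_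
  · refine ContinuousOn.aestronglyMeasurable ?_ measurableSet_uIoc
    refine hf.continuousOn.mul (continuousOn_const.mul ?_)
    refine ContinuousOn.cpow (by fun_prop) (by fun_prop) fun u hu => ?_
    rw [uIoc_of_le zero_le_one] at hu
    exact Complex.ofReal_mem_slitPlane.2 (by have := hu.1; positivity)
  · refine ae_of_all _ fun u hu => ?_
    rw [uIoc_of_le zero_le_one] at hu
    have hu0 := hu.1
    rw [norm_mul, norm_mul, norm_pow, norm_unitExp, one_pow, one_mul,
      norm_add_ofReal_cpow_neg (by linarith)]
    have h1 := hC u ⟨hu.1.le, hu.2⟩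
    have h2 : (n + (b + u)) ^ (-s.re) ≤ ((n:ℝ) + b) ^ (-s.re) :=
      Real.rpow_le_rpow_of_nonpos (by positivity) (by linarith) (by linarith)
    have h3 : 0 ≤ C := (norm_nonneg _).trans h1
    gcongr
  · exact ae_of_all _ fun _ _ => hbs
  · exact intervalIntegrable_const
  · refine ae_of_all _ fun u hu => ?_
    rw [uIoc_of_le zero_le_one] at hu
    exact (summable_lerch hz (by have := hu.1; linarith) hs).hasSum.mul_left _

/-- Integrating the series over one period against a frequency `ν ≡ a (mod 1)` unfolds it. -/
theorem integral_unitExp_mul_lerchSeries (a : ℝ) (m : ℤ) {b : ℝ} (hb : 0 < b) {s : ℂ}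
    (hs : 1 < s.re) (hs' : 0 < s.im) :
    ∫ u in (0:ℝ)..1, unitExp ((a + m) * u) * lerchSeries a (b + u) s =
      unitExp (-((a + m) * b)) * (dualTerm (a + m) s - lowerIntegral (a + m) b s) := by
  obtain ⟨hi, he⟩ := integral_Ioi_unitExp_mul_cpow (a + m) hb hs hs'
  rw [← he]
  have hf : Continuous fun u : ℝ => unitExp ((a + m) * u) :=
    continuous_unitExp.comp (by fun_prop)
  have h1 := (hasSum_integral_mul_lerchSeries a hb hs hf).tendsto_sum_nat
  have h2 : ∀ n : ℕ, ∫ u in (0:ℝ)..1, unitExp ((a + m) * u) *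
      (unitExp a ^ n * ((n + (b + u) : ℝ) : ℂ) ^ (-s)) =
      unitExp (-((a + m) * b)) * ∫ y in (b + n)..(b + (n + 1 : ℕ)),
        unitExp ((a + m) * y) * (y : ℂ) ^ (-s) := by
    intro n
    have : ∫ y in (b + n)..(b + (n + 1 : ℕ)), unitExp ((a + m) * y) * (y : ℂ) ^ (-s) =
        ∫ u in (0:ℝ)..1, unitExp ((a + m) * (b + n + u)) * ((b + n + u : ℝ) : ℂ) ^ (-s) := by
      rw [intervalIntegral.integral_comp_add_left
        (fun y : ℝ => unitExp ((a + m) * y) * (y : ℂ) ^ (-s)) (b + n)]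
      push_cast; ring_nf
    rw [this, ← intervalIntegral.integral_const_mul]
    refine intervalIntegral.integral_congr fun u _ => ?_
    rw [unitExp_pow, ← mul_assoc, ← mul_assoc, ← unitExp_add, ← unitExp_add,
      show -((a + m) * b) + (a + m) * (b + n + u) = ((a + m) * u + n * a) + ((m * n : ℤ) : ℝ) by
        push_cast; ring, unitExp_add _ ((m * n : ℤ) : ℝ), unitExp_int, mul_one,
      show (n:ℝ) + (b + u) = b + n + u by ring]
  have hii : ∀ x y : ℝ, b ≤ x → b ≤ y → IntervalIntegrable
      (fun y : ℝ => unitExp ((a + m) * y) * (y : ℂ) ^ (-s)) volume x y := by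
    intro x y hx hy
    rw [intervalIntegrable_iff]
    refine hi.mono_set fun v hv => ?_
    exact lt_of_le_of_lt (le_min hx hy) hv.1
  have h3 : ∀ N : ℕ, ∑ n ∈ Finset.range N, ∫ u in (0:ℝ)..1, unitExp ((a + m) * u) *
      (unitExp a ^ n * ((n + (b + u) : ℝ) : ℂ) ^ (-s)) = unitExp (-((a + m) * b)) *
      ∫ y in b..(b + N), unitExp ((a + m) * y) * (y : ℂ) ^ (-s) := by
    intro N
    simp only [h2]
    rw [← Finset.mul_sum, intervalIntegral.sum_integral_adjacent_intervals
      (a := fun n : ℕ => b + (n:ℝ)) (fun k _ => hii _ _ (by simp) (by simp; positivity))]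
    simp
  simp only [h3] at h1
  refine tendsto_nhds_unique h1 (Tendsto.const_mul _ ?_)
  exact intervalIntegral_tendsto_integral_Ioi b hi
    (tendsto_atTop_add_const_left _ _ tendsto_natCast_atTop_atTop)

/-- `∫ᵤ¹ e(av) dv`, the primitive of `-e(a ·)` that vanishes at `1`. -/
noncomputable def unitExpTail (a u : ℝ) : ℂ := ∫ v in u..1, unitExp (a * v)

theorem hasDerivAt_unitExpTail (a u : ℝ) :
    HasDerivAt (unitExpTail a) (-unitExp (a * u)) u := by
  have hc : Continuous fun v => unitExp (a * v) := continuous_unitExp.comp (by fun_prop)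
  exact intervalIntegral.integral_hasDerivAt_left (hc.intervalIntegrable _ _)
    (hc.stronglyMeasurableAtFilter _ _) hc.continuousAt

theorem continuous_unitExpTail (a : ℝ) : Continuous (unitExpTail a) :=
  continuous_iff_continuousAt.2 fun u => (hasDerivAt_unitExpTail a u).continuousAt

theorem unitExpTail_one (a : ℝ) : unitExpTail a 1 = 0 := by simp [unitExpTail]

theorem norm_unitExpTail_le {a u : ℝ} (h0 : 0 ≤ u) (h1 : u ≤ 1) : ‖unitExpTail a u‖ ≤ 1 := by
  have := intervalIntegral.norm_integral_le_of_norm_le_const (a := u) (b := 1) (C := 1)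
    (f := fun v => unitExp (a * v)) fun v _ => (norm_unitExp _).le
  refine this.trans ?_
  rw [abs_of_nonneg (by linarith)]
  linarith

/-- Integration by parts on one period. -/
theorem unitExpTail_zero_mul_cpow (a : ℝ) {x : ℝ} (hx : 0 < x) (s : ℂ) :
    unitExpTail a 0 * (x : ℂ) ^ (-s) =
      (∫ u in (0:ℝ)..1, unitExp (a * u) * ((x + u : ℝ) : ℂ) ^ (-s)) +
      s * ∫ u in (0:ℝ)..1, unitExpTail a u * ((x + u : ℝ) : ℂ) ^ (-(s + 1)) := by
  have hpos : ∀ u ∈ uIcc (0:ℝ) 1, 0 < x + u := fun u hu => by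
    rw [uIcc_of_le zero_le_one] at hu; linarith [hu.1]
  have hd : ∀ u ∈ uIcc (0:ℝ) 1, HasDerivAt (fun u : ℝ => ((x + u : ℝ) : ℂ) ^ (-s))
      (-s * ((x + u : ℝ) : ℂ) ^ (-(s + 1))) u := by
    intro u hu
    have h1 : HasDerivAt (fun u : ℝ => ((x + u : ℝ) : ℂ)) 1 u := by
      have := ((hasDerivAt_id u).const_add x).ofReal_comp
      simpa using this
    have h3 : HasDerivAt (fun w : ℂ => w ^ (-s)) (-s * ((x + u : ℝ) : ℂ) ^ (-s - 1))
        ((x + u : ℝ) : ℂ) := by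
      have := (hasDerivAt_id (𝕜 := ℂ) ((x + u : ℝ) : ℂ)).cpow_const (c := -s)
        (Complex.ofReal_mem_slitPlane.2 (hpos u hu))
      simpa using this
    have h2 := HasDerivAt.comp u h3 h1
    refine h2.congr_deriv ?_
    rw [mul_one, show -(s + 1) = -s - 1 by ring]
  have hcp : ∀ r : ℂ, ContinuousOn (fun u : ℝ => ((x + u : ℝ) : ℂ) ^ r) (uIcc 0 1) := fun r =>
    ContinuousOn.cpow (by fun_prop) (by fun_prop) fun u hu =>
      Complex.ofReal_mem_slitPlane.2 (hpos u hu)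
  have hc : Continuous fun v => unitExp (a * v) := continuous_unitExp.comp (by fun_prop)
  have key := intervalIntegral.integral_mul_deriv_eq_deriv_mul hd
    (fun u _ => hasDerivAt_unitExpTail a u)
    ((continuousOn_const.mul (hcp _)).intervalIntegrable) (hc.neg.intervalIntegrable _ _)
  rw [unitExpTail_one] at key
  have e1 : ∫ u in (0:ℝ)..1, ((x + u : ℝ) : ℂ) ^ (-s) * -unitExp (a * u) =
      -∫ u in (0:ℝ)..1, unitExp (a * u) * ((x + u : ℝ) : ℂ) ^ (-s) := by
    rw [← intervalIntegral.integral_neg]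
    refine intervalIntegral.integral_congr fun u _ => ?_
    ring
  have e2 : ∫ u in (0:ℝ)..1, -s * ((x + u : ℝ) : ℂ) ^ (-(s + 1)) * unitExpTail a u =
      -s * ∫ u in (0:ℝ)..1, unitExpTail a u * ((x + u : ℝ) : ℂ) ^ (-(s + 1)) := by
    rw [← intervalIntegral.integral_const_mul]
    refine intervalIntegral.integral_congr fun u _ => ?_
    ring
  rw [e1, e2] at key
  simp only [add_zero, mul_zero] at key
  linear_combination key

/-- The recursion behind the continuation: up to an explicit term, the series at `s` is a mean of
the series at `s + 1`. The factor `∫₀¹ e(av) dv` on the left is not small if `|a| ≤ 1 / 2`. -/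
theorem unitExpTail_zero_mul_lerchSeries (a : ℝ) {b : ℝ} (hb : 0 < b) {s : ℂ}
    (hs : 1 < s.re) (hs' : 0 < s.im) :
    unitExpTail a 0 * lerchSeries a b s =
      unitExp (-(a * b)) * (dualTerm a s - lowerIntegral a b s) +
      s * ∫ u in (0:ℝ)..1, unitExpTail a u * lerchSeries a (b + u) (s + 1) := by
  have hc : Continuous fun v => unitExp (a * v) := continuous_unitExp.comp (by fun_prop)
  have h1 := hasSum_integral_mul_lerchSeries a hb hs hc
  have h2 := hasSum_integral_mul_lerchSeries a hb (s := s + 1) (by simp; linarith)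
    (continuous_unitExpTail a)
  have h3 := integral_unitExp_mul_lerchSeries a 0 hb hs hs'
  simp only [Int.cast_zero, add_zero] at h3
  rw [h3] at h1
  refine HasSum.unique ?_ (h1.add (h2.mul_left s))
  have h4 := (summable_lerch (norm_unitExp a).le hb hs).hasSum.mul_left (unitExpTail a 0)
  refine h4.congr_fun fun n => Eq.symm ?_
  have hx : (0:ℝ) < n + b := by positivity
  have := unitExpTail_zero_mul_cpow a hx s
  calc _ = unitExp a ^ n * (unitExpTail a 0 * ((n + b : ℝ) : ℂ) ^ (-s)) := by ring
    _ = _ := by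
      rw [this, mul_add, ← intervalIntegral.integral_const_mul, mul_left_comm,
        ← intervalIntegral.integral_const_mul]
      congr 1
      · refine intervalIntegral.integral_congr fun u _ => ?_
        simp only [add_assoc]
        ring
      · congr 1
        refine intervalIntegral.integral_congr fun u _ => ?_
        simp only [add_assoc]
        ring

theorem integral_unitExpTail_mul_unitExp_neg (a : ℝ) :
    2 * Real.pi * Complex.I * a * ∫ u in (0:ℝ)..1, unitExpTail a u * unitExp (-(a * u)) =
      unitExpTail a 0 - 1 := by
  have hd : ∀ u ∈ uIcc (0:ℝ) 1, HasDerivAt (fun u : ℝ => -unitExp (-(a * u)))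
      (2 * Real.pi * Complex.I * a * unitExp (-(a * u))) u := by
    intro u _
    have h1 : HasDerivAt (fun u : ℝ => (2 * Real.pi * Complex.I * ((-(a * u) : ℝ) : ℂ)))
        (2 * Real.pi * Complex.I * ((-(a * 1) : ℝ) : ℂ)) u :=
      ((((hasDerivAt_id u).const_mul a).neg).ofReal_comp).const_mul _
    refine (h1.cexp.neg).congr_deriv ?_
    rw [unitExp]; push_cast; ring
  have hc : Continuous fun v => unitExp (a * v) := continuous_unitExp.comp (by fun_prop)
  have hc' : Continuous fun v => unitExp (-(a * v)) := continuous_unitExp.comp (by fun_prop)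
  have key := intervalIntegral.integral_mul_deriv_eq_deriv_mul
    (fun u _ => hasDerivAt_unitExpTail a u) hd (hc.neg.intervalIntegrable _ _)
    ((continuous_const.mul hc').intervalIntegrable _ _)
  have e1 : ∀ u : ℝ, -unitExp (a * u) * -unitExp (-(a * u)) = 1 := fun u => by
    rw [neg_mul_neg, mul_comm, unitExp_neg_mul_self]
  simp only [e1] at key
  rw [unitExpTail_one] at key
  simp only [zero_mul, mul_zero, neg_zero, unitExp_zero, intervalIntegral.integral_const, sub_zero,
    one_smul] at key
  rw [← intervalIntegral.integral_const_mul]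
  calc _ = ∫ u in (0:ℝ)..1, unitExpTail a u *
        (2 * Real.pi * Complex.I * a * unitExp (-(a * u))) :=
        intervalIntegral.integral_congr fun u _ => by ring
    _ = _ := by rw [key]; ring

/-- The Lerch series minus its dual leading term, continued to `1 - k < re s`, `0 < im s` by `k`
applications of the recursion. The shift is `b + max u 0`, not `b + u`, in order that the integrand
is continuous in all real `u`. -/
noncomputable def lerchReg (a : ℝ) : ℕ → ℝ → ℂ → ℂ
  | 0 => fun b s => lerchSeries a b s - unitExp (-(a * b)) * dualTerm a s
  | k + 1 => fun b s => (unitExpTail a 0)⁻¹ *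
      (s * (∫ u in (0:ℝ)..1, unitExpTail a u * lerchReg a k (b + max u 0) (s + 1)) -
        unitExp (-(a * b)) * lowerIntegral a b s)

theorem unitExpTail_zero_mul_lerchReg_zero (a : ℝ) {b : ℝ} (hb : 0 < b) {s : ℂ}
    (hs : 1 < s.re) (hs' : 0 < s.im) :
    unitExpTail a 0 * lerchReg a 0 b s =
      s * (∫ u in (0:ℝ)..1, unitExpTail a u * lerchReg a 0 (b + u) (s + 1)) -
        unitExp (-(a * b)) * lowerIntegral a b s := by
  have h1 := unitExpTail_zero_mul_lerchSeries a hb hs hs'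
  have h2 := integral_unitExpTail_mul_unitExp_neg a
  have h3 := dualTerm_add_one a hs'
  have hk := continuous_unitExpTail a
  have hc' : Continuous fun v => unitExp (-(a * v)) := continuous_unitExp.comp (by fun_prop)
  have hS : IntervalIntegrable (fun u => unitExpTail a u * lerchSeries a (b + u) (s + 1))
      volume 0 1 := by
    refine ContinuousOn.intervalIntegrable ?_
    refine hk.continuousOn.mul ?_
    have := (lerch_series_regular (norm_unitExp a).le).1
    refine ContinuousOn.congr (this.comp (f := fun u : ℝ => (b + u, s + 1)) (by fun_prop)
      (fun u hu => ?_)) fun u _ => rfl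
    rw [uIcc_of_le zero_le_one] at hu
    exact ⟨by linarith [hu.1], by simp; linarith⟩
  have h4 : ∫ u in (0:ℝ)..1, unitExpTail a u * lerchReg a 0 (b + u) (s + 1) =
      (∫ u in (0:ℝ)..1, unitExpTail a u * lerchSeries a (b + u) (s + 1)) -
      unitExp (-(a * b)) * dualTerm a (s + 1) *
        ∫ u in (0:ℝ)..1, unitExpTail a u * unitExp (-(a * u)) := by
    have hS' : IntervalIntegrable (fun u => unitExp (-(a * b)) * dualTerm a (s + 1) *
        (unitExpTail a u * unitExp (-(a * u)))) volume 0 1 :=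
      Continuous.intervalIntegrable (continuous_const.mul (hk.mul hc')) _ _
    rw [← intervalIntegral.integral_const_mul, ← intervalIntegral.integral_sub hS hS']
    refine intervalIntegral.integral_congr fun u _ => ?_
    simp only [lerchReg]
    rw [show -(a * (b + u)) = -(a * b) + -(a * u) by ring, unitExp_add]
    ring
  rw [h4]
  simp only [lerchReg]
  linear_combination h1 + (unitExp (-(a * b)) * ∫ u in (0:ℝ)..1, unitExpTail a u *
    unitExp (-(a * u))) * h3 + unitExp (-(a * b)) * dualTerm a s * h2

theorem isOpen_re_gt_im_pos (c : ℝ) : IsOpen {s : ℂ | c < s.re ∧ 0 < s.im} :=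
  (isOpen_lt continuous_const Complex.continuous_re).inter
    (isOpen_lt continuous_const Complex.continuous_im)

theorem lerchReg_regular {a : ℝ} (ha : unitExpTail a 0 ≠ 0) (k : ℕ) :
    ContinuousOn (fun p : ℝ × ℂ => lerchReg a k p.1 p.2)
      {p : ℝ × ℂ | 0 < p.1 ∧ 1 - (k:ℝ) < p.2.re ∧ 0 < p.2.im} ∧
    (∀ b, 0 < b → DifferentiableOn ℂ (lerchReg a k b) {s : ℂ | 1 - (k:ℝ) < s.re ∧ 0 < s.im}) ∧
    ∀ b, 0 < b → ∀ s : ℂ, 1 < s.re → 0 < s.im → lerchReg a k b s = lerchReg a 0 b s := by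
  induction k with
  | zero =>
    obtain ⟨h1, h2⟩ := lerch_series_regular (norm_unitExp a).le
    have hd := differentiableOn_dualTerm a
    refine ⟨?_, fun b hb => ?_, fun _ _ _ _ _ => rfl⟩
    · refine ContinuousOn.sub (h1.mono fun p hp => ⟨hp.1, by simpa using hp.2.1⟩)
        (ContinuousOn.mul ?_ ?_)
      · exact (continuous_unitExp.comp (by fun_prop)).continuousOn
      · exact hd.continuousOn.comp (by fun_prop) fun p hp => hp.2.2
    · refine DifferentiableOn.sub ((h2 b hb).mono fun s hs => by simpa using hs.1)
        ((hd.mono fun s hs => hs.2).const_mul _)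
  | succ k ih =>
    obtain ⟨hc, hd, he⟩ := ih
    have hre : ∀ s : ℂ, 1 - ((k + 1 : ℕ) : ℝ) < s.re → 1 - (k:ℝ) < (s + 1).re := by
      intro s hs; push_cast at hs; simp; linarith
    have hmax : ∀ b u : ℝ, 0 < b → 0 < b + max u 0 := fun b u hb => by
      have := le_max_right u 0; linarith
    have hk := continuous_unitExpTail a
    refine ⟨?_, fun b hb => ?_, fun b hb s hs hs' => ?_⟩
    · refine ContinuousOn.mul continuousOn_const (ContinuousOn.sub
        (ContinuousOn.mul (by fun_prop) ?_) (ContinuousOn.mul ?_ ?_))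
      · rw [continuousOn_iff_continuous_domRestrict]
        refine intervalIntegral.continuous_parametric_intervalIntegral_of_continuous'
          (X := {p : ℝ × ℂ | 0 < p.1 ∧ 1 - ((k + 1 : ℕ) : ℝ) < p.2.re ∧ 0 < p.2.im})
          (f := fun p u => unitExpTail a u * lerchReg a k (p.1.1 + max u 0) (p.1.2 + 1)) ?_ 0 1
        refine (hk.comp continuous_snd).mul ?_
        exact hc.comp_continuous (f := fun q :
          {p : ℝ × ℂ | 0 < p.1 ∧ 1 - ((k + 1 : ℕ) : ℝ) < p.2.re ∧ 0 < p.2.im} × ℝ =>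
            (q.1.1.1 + max q.2 0, q.1.1.2 + 1)) (by fun_prop)
          (fun q => ⟨hmax _ _ q.1.2.1, hre _ q.1.2.2.1, by simpa using q.1.2.2.2⟩)
      · exact (continuous_unitExp.comp (by fun_prop)).continuousOn
      · exact (continuousOn_lowerIntegral a).mono fun p hp => ⟨hp.1, hp.2.2⟩
    · refine DifferentiableOn.const_mul (DifferentiableOn.sub (DifferentiableOn.mul (by fun_prop) ?_)
        (((differentiableOn_lowerIntegral a hb).mono fun s hs => hs.2).const_mul _)) _
      refine differentiableOn_integral_zero_one (isOpen_re_gt_im_pos _)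
        (g := fun u s => unitExpTail a u * lerchReg a k (b + max u 0) (s + 1)) ?_ ?_
      · refine ContinuousOn.mul (hk.comp continuous_fst).continuousOn ?_
        exact hc.comp (f := fun q : ℝ × ℂ => (b + max q.1 0, q.2 + 1)) (by fun_prop)
          (fun q hq => ⟨hmax _ _ hb, hre _ hq.2.1, by simpa using hq.2.2⟩)
      · intro u
        refine DifferentiableOn.const_mul ?_ _
        exact (hd _ (hmax b u hb)).comp (f := fun s : ℂ => s + 1) (by fun_prop)
          (fun s hs => ⟨hre s hs.1, by simpa using hs.2⟩)
    · have hs1 : 1 < (s + 1).re := by simp; linarith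
      have e : ∫ u in (0:ℝ)..1, unitExpTail a u * lerchReg a k (b + max u 0) (s + 1) =
          ∫ u in (0:ℝ)..1, unitExpTail a u * lerchReg a 0 (b + u) (s + 1) :=
        intervalIntegral.integral_congr fun u hu => by
          rw [uIcc_of_le zero_le_one] at hu
          rw [he _ (hmax b u hb) _ hs1 (by simpa using hs'), max_eq_left hu.1]
      change (unitExpTail a 0)⁻¹ * (s * (∫ u in (0:ℝ)..1, unitExpTail a u *
        lerchReg a k (b + max u 0) (s + 1)) - unitExp (-(a * b)) * lowerIntegral a b s) = _
      rw [e, ← unitExpTail_zero_mul_lerchReg_zero a hb hs hs', inv_mul_cancel_left₀ ha]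

/-- The Lerch series continued to `1 - k < re s`, `0 < im s`. -/
noncomputable def lerchCont (a : ℝ) (k : ℕ) (b : ℝ) (s : ℂ) : ℂ :=
  lerchReg a k b s + unitExp (-(a * b)) * dualTerm a s

theorem differentiableOn_lerchCont {a : ℝ} (ha : unitExpTail a 0 ≠ 0) (k : ℕ) {b : ℝ} (hb : 0 < b) :
    DifferentiableOn ℂ (lerchCont a k b) {s : ℂ | 1 - (k:ℝ) < s.re ∧ 0 < s.im} :=
  ((lerchReg_regular ha k).2.1 b hb).add
    (((differentiableOn_dualTerm a).mono fun _ hs => hs.2).const_mul _)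

theorem continuousOn_lerchCont {a : ℝ} (ha : unitExpTail a 0 ≠ 0) (k : ℕ) :
    ContinuousOn (fun p : ℝ × ℂ => lerchCont a k p.1 p.2)
      {p : ℝ × ℂ | 0 < p.1 ∧ 1 - (k:ℝ) < p.2.re ∧ 0 < p.2.im} := by
  refine (lerchReg_regular ha k).1.add (ContinuousOn.mul ?_ ?_)
  · exact (continuous_unitExp.comp (by fun_prop)).continuousOn
  · exact (differentiableOn_dualTerm a).continuousOn.comp (by fun_prop) fun p hp => hp.2.2

theorem lerchCont_of_one_lt_re {a : ℝ} (ha : unitExpTail a 0 ≠ 0) (k : ℕ) {b : ℝ} (hb : 0 < b)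
    {s : ℂ} (hs : 1 < s.re) (hs' : 0 < s.im) : lerchCont a k b s = lerchSeries a b s := by
  rw [lerchCont, (lerchReg_regular ha k).2.2 b hb s hs hs', lerchReg]; ring

theorem eq_of_eq_of_one_lt_re {c : ℝ} {f g : ℂ → ℂ}
    (hf : DifferentiableOn ℂ f {s : ℂ | c < s.re ∧ 0 < s.im})
    (hg : DifferentiableOn ℂ g {s : ℂ | c < s.re ∧ 0 < s.im})
    (h : ∀ s : ℂ, 1 < s.re → 0 < s.im → f s = g s) {s : ℂ} (hs : c < s.re) (hs' : 0 < s.im) :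
    f s = g s := by
  have hconv : Convex ℝ {s : ℂ | c < s.re ∧ 0 < s.im} :=
    (convex_halfSpace_re_gt c).inter (convex_halfSpace_im_gt 0)
  set z : ℂ := ⟨max c 1 + 1, 1⟩ with hz
  have hz1 : c < z.re := by simp only [hz]; linarith [le_max_left c 1]
  have hz2 : 1 < z.re := by simp only [hz]; linarith [le_max_right c 1]
  have hz3 : 0 < z.im := by simp [hz]
  refine (hf.analyticOnNhd (isOpen_re_gt_im_pos c)).eqOn_of_preconnected_of_eventuallyEq
    (hg.analyticOnNhd (isOpen_re_gt_im_pos c)) hconv.isPreconnected ⟨hz1, hz3⟩ ?_ ⟨hs, hs'⟩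
  filter_upwards [(isOpen_re_gt_im_pos 1).mem_nhds ⟨hz2, hz3⟩] with w hw
  exact h w hw.1 hw.2

theorem differentiable_ofReal_cpow_neg {b : ℝ} (hb : 0 < b) :
    Differentiable ℂ (fun s : ℂ => (b : ℂ) ^ (-s)) := fun _ =>
  DifferentiableAt.const_cpow (by fun_prop) (Or.inl (by exact_mod_cast hb.ne'))

theorem lerchSeries_eq_add {a b : ℝ} (hb : 0 < b) {s : ℂ} (hs : 1 < s.re) :
    lerchSeries a b s = (b : ℂ) ^ (-s) + unitExp a * lerchSeries a (b + 1) s := by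
  rw [lerchSeries, lerch_series_shift (norm_unitExp a).le hb hs, lerchSeries, ← tsum_mul_left]
  congr 1
  refine tsum_congr fun n => ?_
  rw [pow_succ', mul_assoc, show (n:ℝ) + (b + 1) = n + 1 + b by ring]

theorem lerchCont_eq_add {a : ℝ} (ha : unitExpTail a 0 ≠ 0) (k : ℕ) {b : ℝ} (hb : 0 < b) {s : ℂ}
    (hs : 1 - (k:ℝ) < s.re) (hs' : 0 < s.im) :
    lerchCont a k b s = (b : ℂ) ^ (-s) + unitExp a * lerchCont a k (b + 1) s := by
  have hb1 : 0 < b + 1 := by linarith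
  refine eq_of_eq_of_one_lt_re (differentiableOn_lerchCont ha k hb)
    ((differentiable_ofReal_cpow_neg hb).differentiableOn.add
      ((differentiableOn_lerchCont ha k hb1).const_mul _)) (fun s h1 h2 => ?_) hs hs'
  rw [lerchCont_of_one_lt_re ha k hb h1 h2, Pi.add_apply, lerchSeries_eq_add hb h1,
    lerchCont_of_one_lt_re ha k hb1 h1 h2]

theorem lerchSeries_eq_tsum_div (a : ℝ) {b : ℝ} (s : ℂ) :
    lerchSeries a b s =
      ∑' n : ℕ, Complex.exp (2 * Real.pi * Complex.I * a * n) / (n + b : ℂ) ^ s := by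
  refine tsum_congr fun n => ?_
  rw [unitExp_pow, unitExp, Complex.cpow_neg, div_eq_mul_inv]
  push_cast; ring_nf

theorem IsLerchZeta.eq_lerchCont {a : ℝ} (ha : unitExpTail a 0 ≠ 0) {b : ℝ} (hb : 0 < b)
    {F : ℂ → ℂ} (hF : IsLerchZeta a b F) (k : ℕ) {s : ℂ}
    (hs : 1 - (k:ℝ) < s.re) (hs' : 0 < s.im) : F s = lerchCont a k b s := by
  refine eq_of_eq_of_one_lt_re (hF.differentiableOn.mono fun s hs => ?_)
    (differentiableOn_lerchCont ha k hb) (fun s h1 h2 => ?_) hs hs'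
  · rintro rfl
    simp at hs
  · rw [hF.eq_tsum s h1, lerchCont_of_one_lt_re ha k hb h1 h2, lerchSeries_eq_tsum_div]

/-- The unfolded integral over one period, continued in `s`. In essence these are the Fourier
coefficients of the function in its second parameter. -/
theorem integral_unitExp_mul_lerchCont {a : ℝ} (ha : unitExpTail a 0 ≠ 0) (k : ℕ) (m : ℤ) {b : ℝ}
    (hb : 0 < b) {s : ℂ} (hs : 1 - (k:ℝ) < s.re) (hs' : 0 < s.im) :
    ∫ u in (0:ℝ)..1, unitExp ((a + m) * u) * lerchCont a k (b + u) s =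
      unitExp (-((a + m) * b)) * (dualTerm (a + m) s - lowerIntegral (a + m) b s) := by
  have hmax : ∀ u : ℝ, 0 < b + max u 0 := fun u => by
    have := le_max_right u 0; linarith
  have hcl : ∀ s : ℂ, ∫ u in (0:ℝ)..1, unitExp ((a + m) * u) * lerchCont a k (b + u) s =
      ∫ u in (0:ℝ)..1, unitExp ((a + m) * u) * lerchCont a k (b + max u 0) s := fun s =>
    intervalIntegral.integral_congr fun u hu => by
      rw [uIcc_of_le zero_le_one] at hu
      simp only [max_eq_left hu.1]
  have h1 : DifferentiableOn ℂ (fun s => ∫ u in (0:ℝ)..1,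
      unitExp ((a + m) * u) * lerchCont a k (b + max u 0) s)
      {s : ℂ | 1 - (k:ℝ) < s.re ∧ 0 < s.im} := by
    refine differentiableOn_integral_zero_one (isOpen_re_gt_im_pos _)
      (g := fun u s => unitExp ((a + m) * u) * lerchCont a k (b + max u 0) s) ?_ ?_
    · refine ContinuousOn.mul (continuous_unitExp.comp (by fun_prop)).continuousOn ?_
      exact (continuousOn_lerchCont ha k).comp (f := fun q : ℝ × ℂ => (b + max q.1 0, q.2))
        (by fun_prop) (fun q hq => ⟨hmax _, hq.2.1, hq.2.2⟩)
    · intro u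
      exact (differentiableOn_lerchCont ha k (hmax u)).const_mul _
  rw [hcl]
  refine eq_of_eq_of_one_lt_re h1 (g := fun s => unitExp (-((a + m) * b)) *
    (dualTerm (a + m) s - lowerIntegral (a + m) b s)) (DifferentiableOn.const_mul
    (((differentiableOn_dualTerm _).mono fun _ hs => hs.2).sub
      ((differentiableOn_lowerIntegral _ hb).mono fun _ hs => hs.2)) _) (fun s h2 h3 => ?_) hs hs'
  rw [← hcl, ← integral_unitExp_mul_lerchSeries a m hb h2 h3]
  refine intervalIntegral.integral_congr fun u hu => ?_
  rw [uIcc_of_le zero_le_one] at hu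
  rw [lerchCont_of_one_lt_re ha k (by linarith [hu.1]) h2 h3]

/-! ### Size of the dual term and uniform polynomial bounds -/

theorem norm_dualTerm_of_pos {ν : ℝ} (hν : 0 < ν) (s : ℂ) :
    ‖dualTerm ν s‖ = ‖Complex.Gamma (1 - s)‖ * Real.exp (Real.pi * s.im / 2) *
      (2 * Real.pi * ν) ^ (s.re - 1) := by
  have hw : (-2 * Real.pi * Complex.I * ν : ℂ) = ((2 * Real.pi * ν : ℝ) : ℂ) * -Complex.I := by
    push_cast; ring
  have hpos : 0 < 2 * Real.pi * ν := by positivity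
  have hne : ((2 * Real.pi * ν : ℝ) : ℂ) * -Complex.I ≠ 0 :=
    mul_ne_zero (by exact_mod_cast hpos.ne') (neg_ne_zero.2 Complex.I_ne_zero)
  rw [dualTerm, norm_mul, hw, Complex.norm_cpow_of_ne_zero hne, Complex.arg_real_mul _ hpos,
    Complex.arg_neg_I, norm_mul, norm_neg, Complex.norm_I, mul_one, Complex.norm_real,
    Real.norm_of_nonneg hpos.le]
  simp only [Complex.sub_re, Complex.one_re, Complex.sub_im, Complex.one_im, sub_zero]
  rw [show -(Real.pi / 2) * s.im = -(Real.pi * s.im / 2) by ring, Real.exp_neg, div_inv_eq_mul]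
  ring

theorem norm_dualTerm_of_neg {ν : ℝ} (hν : ν < 0) (s : ℂ) :
    ‖dualTerm ν s‖ = ‖Complex.Gamma (1 - s)‖ * Real.exp (-(Real.pi * s.im / 2)) *
      (2 * Real.pi * |ν|) ^ (s.re - 1) := by
  have hw : (-2 * Real.pi * Complex.I * ν : ℂ) = ((2 * Real.pi * |ν| : ℝ) : ℂ) * Complex.I := by
    rw [abs_of_neg hν]; push_cast; ring
  have hpos : 0 < 2 * Real.pi * |ν| := by have := abs_pos.2 hν.ne; positivity
  have hne : ((2 * Real.pi * |ν| : ℝ) : ℂ) * Complex.I ≠ 0 :=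
    mul_ne_zero (by exact_mod_cast hpos.ne') Complex.I_ne_zero
  rw [dualTerm, norm_mul, hw, Complex.norm_cpow_of_ne_zero hne, Complex.arg_real_mul _ hpos,
    Complex.arg_I, norm_mul, Complex.norm_I, mul_one, Complex.norm_real,
    Real.norm_of_nonneg hpos.le]
  simp only [Complex.sub_re, Complex.one_re, Complex.sub_im, Complex.one_im, sub_zero]
  rw [show Real.pi / 2 * s.im = Real.pi * s.im / 2 by ring, Real.exp_neg]
  ring

theorem dualTerm_zero {s : ℂ} (hs : s ≠ 1) : dualTerm 0 s = 0 := by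
  rw [dualTerm]
  simp [Complex.zero_cpow (sub_ne_zero.2 hs)]

theorem norm_Gamma_one_sub (s : ℂ) :
    ‖Complex.Gamma (1 - s)‖ = ‖Complex.Gamma ⟨1 - s.re, s.im⟩‖ := by
  have : (1 - s : ℂ) = (starRingEnd ℂ) ⟨1 - s.re, s.im⟩ := by
    apply Complex.ext <;> simp
  rw [this, Complex.Gamma_conj, Complex.norm_conj]

theorem norm_Gamma_one_sub_mul_exp_bounds (N : ℕ) : ∃ K : ℝ, 1 ≤ K ∧ ∃ p : ℕ, ∀ s : ℂ,
    -(N:ℝ) ≤ s.re → s.re ≤ N → 1 ≤ s.im →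
      1 ≤ K * s.im ^ p * (‖Complex.Gamma (1 - s)‖ * Real.exp (Real.pi * s.im / 2)) ∧
      ‖Complex.Gamma (1 - s)‖ * Real.exp (Real.pi * s.im / 2) ≤ K * s.im ^ p := by
  obtain ⟨K, hK, p, h⟩ := norm_Gamma_mul_exp_bounds (N + 1)
  refine ⟨K, hK, p, fun s h1 h2 h3 => ?_⟩
  rw [norm_Gamma_one_sub]
  push_cast at h
  exact h ⟨1 - s.re, s.im⟩ (by simp only; linarith) (by simp only; linarith) h3

theorem norm_dualTerm_le {ν : ℝ} {s : ℂ} (hs : 0 < s.im) :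
    ‖dualTerm ν s‖ ≤ ‖Complex.Gamma (1 - s)‖ * Real.exp (Real.pi * s.im / 2) *
      (2 * Real.pi * |ν|) ^ (s.re - 1) := by
  rcases lt_trichotomy ν 0 with h | rfl | h
  · rw [norm_dualTerm_of_neg h]
    have : 0 ≤ (2 * Real.pi * |ν|) ^ (s.re - 1) := by positivity
    gcongr
    have := Real.pi_pos
    nlinarith
  · rw [dualTerm_zero (by rintro rfl; simp at hs), norm_zero]
    positivity
  · rw [norm_dualTerm_of_pos h, abs_of_pos h]

/-- The recursion for the continuation is uniform in `|a| ≤ 1 / 2`. -/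
theorem half_le_norm_unitExpTail_zero {a : ℝ} (ha : |a| ≤ 1 / 2) : 1 / 2 ≤ ‖unitExpTail a 0‖ := by
  have e : unitExp (-(a / 2)) * unitExpTail a 0 = ∫ v in (0:ℝ)..1, unitExp (a * (v - 1 / 2)) := by
    rw [unitExpTail, ← intervalIntegral.integral_const_mul]
    refine intervalIntegral.integral_congr fun v _ => ?_
    rw [← unitExp_add]; ring_nf
  have hn : ‖unitExpTail a 0‖ = ‖∫ v in (0:ℝ)..1, unitExp (a * (v - 1 / 2))‖ := by
    rw [← e, norm_mul, norm_unitExp, one_mul]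
  have hc : Continuous fun v : ℝ => unitExp (a * (v - 1 / 2)) :=
    continuous_unitExp.comp (by fun_prop)
  rw [hn]
  refine le_trans ?_ (Complex.re_le_norm _)
  have hre : (∫ v in (0:ℝ)..1, unitExp (a * (v - 1 / 2))).re =
      ∫ v in (0:ℝ)..1, Real.cos (2 * Real.pi * (a * (v - 1 / 2))) := by
    have := Complex.reCLM.intervalIntegral_comp_comm (hc.intervalIntegrable (μ := volume) 0 1)
    rw [Complex.reCLM_apply] at this
    rw [← this]
    refine intervalIntegral.integral_congr fun v _ => ?_
    simp only [Complex.reCLM_apply]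
    rw [unitExp, Complex.exp_re]
    simp
  rw [hre]
  have hle : ∫ v in (0:ℝ)..1, (1 - (2 * Real.pi * a) ^ 2 / 2 * (v - 1 / 2) ^ 2) ≤
      ∫ v in (0:ℝ)..1, Real.cos (2 * Real.pi * (a * (v - 1 / 2))) := by
    refine intervalIntegral.integral_mono_on zero_le_one (Continuous.intervalIntegrable (by fun_prop) _ _)
      (Continuous.intervalIntegrable (by fun_prop) _ _) fun v _ => ?_
    refine le_trans (le_of_eq ?_) (Real.one_sub_sq_div_two_le_cos)
    ring
  refine le_trans ?_ hle
  have hval : ∫ v in (0:ℝ)..1, (1 - (2 * Real.pi * a) ^ 2 / 2 * (v - 1 / 2) ^ 2) =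
      1 - (2 * Real.pi * a) ^ 2 / 24 := by
    have h1 : ∫ v in (0:ℝ)..1, (v - 1 / 2) ^ 2 = 1 / 12 := by
      rw [intervalIntegral.integral_comp_sub_right (fun v : ℝ => v ^ 2) (1 / 2), integral_pow]
      norm_num
    rw [intervalIntegral.integral_sub (Continuous.intervalIntegrable (by fun_prop) _ _)
      (Continuous.intervalIntegrable (by fun_prop) _ _), intervalIntegral.integral_const_mul, h1]
    simp; ring
  rw [hval]
  have h2 : a ^ 2 ≤ (1 / 2) ^ 2 := sq_le_sq' (by linarith [(abs_le.1 ha).1]) (abs_le.1 ha).2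
  have h3 := Real.pi_lt_d2
  have h4 := Real.pi_pos
  have h5 : Real.pi ^ 2 < 10 := by nlinarith
  nlinarith [mul_nonneg (sq_nonneg Real.pi) (sub_nonneg.2 h2)]

theorem unitExpTail_zero_ne_zero {a : ℝ} (ha : |a| ≤ 1 / 2) : unitExpTail a 0 ≠ 0 :=
  norm_pos_iff.1 (lt_of_lt_of_le (by norm_num) (half_le_norm_unitExpTail_zero ha))

theorem norm_lerchSeries_le {a b : ℝ} (hb : 1 ≤ b) {d : ℝ} (hd : 1 < d) {s : ℂ} (hs : d ≤ s.re) :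
    ‖lerchSeries a b s‖ ≤ ∑' n : ℕ, 1 / ((n + 1 : ℕ) : ℝ) ^ d := by
  refine tsum_of_norm_bounded (summable_lerch_bound hd).hasSum fun n => ?_
  rw [norm_mul, norm_pow, norm_unitExp, one_pow, one_mul, norm_add_ofReal_cpow_neg (by linarith),
    one_div, ← Real.rpow_neg (by positivity)]
  calc ((n:ℝ) + b) ^ (-s.re) ≤ ((n + 1 : ℕ) : ℝ) ^ (-s.re) :=
        Real.rpow_le_rpow_of_nonpos (by positivity) (by push_cast; linarith) (by linarith)
    _ ≤ _ := Real.rpow_le_rpow_of_exponent_le (by push_cast; linarith [(Nat.cast_nonneg n : (0:ℝ) ≤ n)])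
        (by linarith)

/-- The regular part is bounded by a power of the ordinate, uniformly in the frequency `a`. -/
theorem norm_lerchReg_le (k : ℕ) : ∀ N : ℕ, ∃ K : ℝ, 1 ≤ K ∧ ∃ p : ℕ, ∀ (a b : ℝ) (s : ℂ),
    |a| ≤ 1 / 2 → 1 ≤ b → b ≤ N → 5 / 4 - (k:ℝ) ≤ s.re → s.re ≤ N → 1 ≤ s.im →
      ‖lerchReg a k b s‖ ≤ K * s.im ^ p := by
  induction k with
  | zero =>
    intro N
    obtain ⟨K, hK, p, h⟩ := norm_Gamma_one_sub_mul_exp_bounds N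
    set Z := ∑' n : ℕ, 1 / ((n + 1 : ℕ) : ℝ) ^ (5 / 4 : ℝ) with hZ
    have hZ0 : 0 ≤ Z := tsum_nonneg fun n => by positivity
    have hpi1 : (1:ℝ) ≤ Real.pi := by linarith [Real.pi_gt_three]
    refine ⟨Z + K * Real.pi ^ N, by nlinarith [one_le_pow₀ hpi1 (n := N)], p,
      fun a b s ha hb hbN hs hsN ht => ?_⟩
    simp only [Nat.cast_zero, sub_zero] at hs
    have hp1 : 1 ≤ s.im ^ p := one_le_pow₀ ht
    have h1 := norm_lerchSeries_le (a := a) hb (by norm_num : (1:ℝ) < 5 / 4) hs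
    have h2 := norm_dualTerm_le (ν := a) (s := s) (by linarith)
    have h3 := (h s (by linarith [(Nat.cast_nonneg N : (0:ℝ) ≤ N)]) hsN ht).2
    have h4 : (2 * Real.pi * |a|) ^ (s.re - 1) ≤ Real.pi ^ N := by
      calc (2 * Real.pi * |a|) ^ (s.re - 1) ≤ Real.pi ^ (s.re - 1) :=
            Real.rpow_le_rpow (by positivity) (by nlinarith) (by linarith)
        _ ≤ Real.pi ^ (N:ℝ) := Real.rpow_le_rpow_of_exponent_le hpi1 (by linarith)
        _ = _ := Real.rpow_natCast _ _
    calc ‖lerchReg a 0 b s‖ ≤ ‖lerchSeries a b s‖ + ‖unitExp (-(a * b)) * dualTerm a s‖ :=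
          norm_sub_le _ _
      _ ≤ Z + K * s.im ^ p * Real.pi ^ N := by
          rw [norm_mul, norm_unitExp, one_mul]
          refine add_le_add h1 (h2.trans ?_)
          gcongr
      _ ≤ Z * s.im ^ p + K * s.im ^ p * Real.pi ^ N := by
          gcongr; exact le_mul_of_one_le_right hZ0 hp1
      _ = _ := by ring
  | succ k ih =>
    intro N
    obtain ⟨K, hK, p, h⟩ := ih (N + 1)
    have hN0 : (0:ℝ) ≤ N := Nat.cast_nonneg N
    have hN1 : (1:ℝ) ≤ N + 1 := by linarith
    set E := Real.exp (Real.pi * N) with hE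
    have hE1 : 1 ≤ E := Real.one_le_exp (by positivity)
    refine ⟨2 * ((N + k + 2) * K + (N + 1) ^ (k + 2) * E), by
      nlinarith [one_le_pow₀ hN1 (n := k + 2), (Nat.cast_nonneg k : (0:ℝ) ≤ k)], p + 1,
      fun a b s ha hb hbN hs hsN ht => ?_⟩
    push_cast at hs
    have hA := half_le_norm_unitExpTail_zero ha
    have hb0 : 0 < b := by linarith
    have hint : ‖∫ u in (0:ℝ)..1, unitExpTail a u * lerchReg a k (b + max u 0) (s + 1)‖ ≤
        K * s.im ^ p := by
      have := intervalIntegral.norm_integral_le_of_norm_le_const (a := (0:ℝ)) (b := 1)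
        (C := K * s.im ^ p)
        (f := fun u => unitExpTail a u * lerchReg a k (b + max u 0) (s + 1)) fun u hu => by
          rw [uIoc_of_le zero_le_one] at hu
          rw [norm_mul, max_eq_left hu.1.le]
          have h1 := norm_unitExpTail_le (a := a) hu.1.le hu.2
          have h2 := h a (b + u) (s + 1) ha (by linarith [hu.1]) (by push_cast; linarith [hu.2])
            (by simp; linarith) (by simp; linarith) (by simpa using ht)
          simp only [Complex.add_im, Complex.one_im, add_zero] at h2
          calc _ ≤ 1 * (K * s.im ^ p) := by gcongr
            _ = _ := one_mul _
      simpa using this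
    have hs_norm : ‖s‖ ≤ (N + k + 2) * s.im := by
      refine (Complex.norm_le_abs_re_add_abs_im _).trans ?_
      have : |s.re| ≤ N + k + 1 := abs_le.2 ⟨by linarith [(Nat.cast_nonneg k : (0:ℝ) ≤ k)],
        by linarith [(Nat.cast_nonneg k : (0:ℝ) ≤ k)]⟩
      rw [abs_of_nonneg (by linarith : (0:ℝ) ≤ s.im)]
      nlinarith [(Nat.cast_nonneg k : (0:ℝ) ≤ k)]
    have hlow : ‖unitExp (-(a * b)) * lowerIntegral a b s‖ ≤ (N + 1) ^ (k + 2) * E := by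
      rw [norm_mul, norm_unitExp, one_mul]
      refine (norm_lowerIntegral_le a hb0 (by linarith)).trans ?_
      have e1 : b ^ (1 - s.re) ≤ ((N:ℝ) + 1) ^ (k + 2) := by
        calc b ^ (1 - s.re) ≤ b ^ ((k + 2 : ℕ) : ℝ) :=
              Real.rpow_le_rpow_of_exponent_le hb (by push_cast; linarith)
          _ = b ^ (k + 2) := Real.rpow_natCast _ _
          _ ≤ _ := by gcongr; linarith
      have e2 : Real.exp (2 * Real.pi * |a| * b) / s.im ≤ E := by
        rw [div_le_iff₀ (by linarith)]
        have : Real.exp (2 * Real.pi * |a| * b) ≤ E := by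
          refine Real.exp_le_exp.2 ?_
          have hp := Real.pi_pos
          calc 2 * Real.pi * |a| * b ≤ 2 * Real.pi * (1 / 2) * N := by gcongr
            _ = _ := by ring
        nlinarith
      gcongr
    have hinv : ‖(unitExpTail a 0)⁻¹‖ ≤ 2 := by
      rw [norm_inv]
      calc ‖unitExpTail a 0‖⁻¹ ≤ (1 / 2)⁻¹ := by gcongr
        _ = 2 := by norm_num
    change ‖(unitExpTail a 0)⁻¹ * (s * (∫ u in (0:ℝ)..1, unitExpTail a u *
        lerchReg a k (b + max u 0) (s + 1)) - unitExp (-(a * b)) * lowerIntegral a b s)‖ ≤ _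
    rw [norm_mul]
    have hp1 : 1 ≤ s.im ^ (p + 1) := one_le_pow₀ ht
    calc _ ≤ 2 * (‖s‖ * ‖∫ u in (0:ℝ)..1, unitExpTail a u *
          lerchReg a k (b + max u 0) (s + 1)‖ + ‖unitExp (-(a * b)) * lowerIntegral a b s‖) := by
          gcongr
          refine (norm_sub_le _ _).trans ?_
          rw [norm_mul]
      _ ≤ 2 * (((N + k + 2) * s.im) * (K * s.im ^ p) + (N + 1) ^ (k + 2) * E) := by gcongr
      _ ≤ 2 * (((N + k + 2) * s.im) * (K * s.im ^ p) + (N + 1) ^ (k + 2) * E * s.im ^ (p + 1)) := by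
          have h9 : (N + 1) ^ (k + 2) * E ≤ (N + 1) ^ (k + 2) * E * s.im ^ (p + 1) :=
            le_mul_of_one_le_right (by positivity) hp1
          linarith
      _ = _ := by ring

/-! ### The Poisson formula in a half-plane -/

theorem integrable_univ_inv_sq_add_sq {d : ℝ} (hd : 0 < d) :
    Integrable fun y : ℝ => (d ^ 2 + y ^ 2)⁻¹ := by
  have h := (integrable_inv_one_add_sq.comp_div hd.ne').const_mul ((d ^ 2)⁻¹)
  refine h.congr (ae_of_all _ fun y => ?_)
  change (d ^ 2)⁻¹ * (1 + (y / d) ^ 2)⁻¹ = _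
  rw [← mul_inv]
  congr 1
  field_simp

theorem integral_univ_inv_sq_add_sq {d : ℝ} (hd : 0 < d) :
    ∫ y : ℝ, (d ^ 2 + y ^ 2)⁻¹ = Real.pi / d := by
  have h : ∀ y : ℝ, (d ^ 2 + y ^ 2)⁻¹ = (d ^ 2)⁻¹ * (1 + (y / d) ^ 2)⁻¹ := fun y => by
    rw [← mul_inv]
    congr 1
    field_simp
  simp_rw [h]
  rw [integral_const_mul, Measure.integral_comp_div (fun y : ℝ => (1 + y ^ 2)⁻¹) d,
    integral_univ_inv_one_add_sq, abs_of_pos hd, smul_eq_mul]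
  field_simp

/-- The Poisson formula at a point of the real axis, for a bounded holomorphic function on the right
half-plane: Cauchy's theorem on large rectangles for `(f z - f d) / (z ^ 2 - d ^ 2)`. -/
theorem integral_poisson_halfPlane {f : ℂ → ℂ} {B d : ℝ} (hd : 0 < d)
    (hc : ContinuousOn f {z | 0 ≤ z.re}) (hf : DifferentiableOn ℂ f {z | 0 < z.re})
    (hB : ∀ z : ℂ, 0 ≤ z.re → ‖f z‖ ≤ B) :
    ∫ y : ℝ, (((d ^ 2 + y ^ 2)⁻¹ : ℝ) : ℂ) * f (y * Complex.I) = (Real.pi / d : ℝ) * f d := by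
  have hB0 : 0 ≤ B := (norm_nonneg _).trans (hB 0 (by simp))
  have hopen : IsOpen {z : ℂ | 0 < z.re} := isOpen_lt continuous_const Complex.continuous_re
  have hnear : ∀ z : ℂ, 0 < z.re → {z : ℂ | 0 ≤ z.re} ∈ 𝓝 z := fun z hz =>
    mem_of_superset (hopen.mem_nhds hz) fun w hw => le_of_lt (show 0 < w.re from hw)
  have hdd : DifferentiableAt ℂ f d := hf.differentiableAt (hopen.mem_nhds (by simpa using hd))
  set K : ℂ → ℂ := fun z => dslope f d z / (z + d) with hK
  have hne : ∀ z : ℂ, 0 ≤ z.re → z + d ≠ 0 := fun z hz h => by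
    have := congrArg Complex.re h
    simp at this; linarith
  have hKc : ContinuousOn K {z | 0 ≤ z.re} := by
    refine ContinuousOn.div ?_ (by fun_prop) hne
    exact (continuousOn_dslope (hnear _ (by simpa using hd))).2 ⟨hc, hdd⟩
  have hKd : ∀ z : ℂ, 0 < z.re → z ≠ d → DifferentiableAt ℂ K z := by
    intro z hz hzd
    refine DifferentiableAt.div ?_ (by fun_prop) (hne z hz.le)
    exact (differentiableAt_dslope_of_ne hzd).2 (hf.differentiableAt (hopen.mem_nhds hz))
  have hKb : ∀ z : ℂ, 0 ≤ z.re → z ≠ d → K z = (f z - f d) / ((z - d) * (z + d)) := by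
    intro z hz hzd
    simp only [hK]
    rw [dslope_of_ne _ hzd, slope_def_field, div_div]
  have hKn : ∀ (z : ℂ) (M : ℝ), 0 ≤ z.re → z ≠ d → 0 < M → M ≤ ‖z - d‖ → M ≤ ‖z + d‖ →
      ‖K z‖ ≤ 2 * B / M ^ 2 := by
    intro z M hz hzd hM h1 h2
    rw [hKb z hz hzd, norm_div, norm_mul]
    have := norm_sub_le (f z) (f d)
    have h3 := hB z hz
    have h4 := hB d (by simpa using hd.le)
    rw [sq]
    gcongr
    linarith
  have hKI : ∀ y : ℝ, K (y * Complex.I) =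
      (((d ^ 2 + y ^ 2)⁻¹ : ℝ) : ℂ) * f d - (((d ^ 2 + y ^ 2)⁻¹ : ℝ) : ℂ) * f (y * Complex.I) := by
    intro y
    have h1 : (y * Complex.I : ℂ) ≠ d := fun h => by
      have := congrArg Complex.re h
      simp at this; linarith
    have h2 : (d ^ 2 + y ^ 2 : ℂ) ≠ 0 := by
      have : (d ^ 2 + y ^ 2 : ℝ) ≠ 0 := by positivity
      exact_mod_cast this
    have h3 : ((y * Complex.I - d) * (y * Complex.I + d) : ℂ) = -(d ^ 2 + y ^ 2) := by
      linear_combination (y:ℂ) ^ 2 * Complex.I_sq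
    rw [hKb _ (by simp) h1, h3]
    push_cast
    field_simp
    ring
  have hIc : Continuous fun y : ℝ => f (y * Complex.I) :=
    hc.comp_continuous (by fun_prop) fun y => by simp
  have hint1 : Integrable fun y : ℝ => (((d ^ 2 + y ^ 2)⁻¹ : ℝ) : ℂ) * f (y * Complex.I) := by
    refine ((integrable_univ_inv_sq_add_sq hd).ofReal (𝕜 := ℂ)).mul_bdd (c := B)
      hIc.aestronglyMeasurable (ae_of_all _ fun y => hB _ (by simp))
  have hint2 : Integrable fun y : ℝ => (((d ^ 2 + y ^ 2)⁻¹ : ℝ) : ℂ) * f d :=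
    ((integrable_univ_inv_sq_add_sq hd).ofReal (𝕜 := ℂ)).mul_const _
  have hKint : Integrable fun y : ℝ => K (y * Complex.I) := by
    simp_rw [hKI]; exact hint2.sub hint1
  have hlim := intervalIntegral_tendsto_integral hKint tendsto_neg_atTop_atBot tendsto_id
  have hrect : ∀ R : ℝ, 2 * d < R → ‖∫ y in (-R)..R, K (y * Complex.I)‖ ≤ 20 * B * R⁻¹ := by
    intro R hR
    have hR0 : 0 < R := by linarith
    have key := Complex.integral_boundary_rect_eq_zero_of_differentiable_on_off_countable K
      (⟨0, -R⟩ : ℂ) ⟨R, R⟩ {(d : ℂ)} (countable_singleton _)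
      (hKc.mono fun z hz => by
        have := hz.1
        rw [mem_preimage, uIcc_of_le hR0.le] at this
        exact this.1)
      (fun z hz => by
        have h1 := hz.1.1
        rw [mem_preimage, min_eq_left hR0.le] at h1
        exact hKd z h1.1 hz.2)
    simp only [Complex.ofReal_neg, Complex.ofReal_zero, zero_add, smul_eq_mul] at key
    have hb : ‖∫ x in (0:ℝ)..R, K (x + -R * Complex.I)‖ ≤ 2 * B / R ^ 2 * |R - 0| := by
      refine intervalIntegral.norm_integral_le_of_norm_le_const fun x hx => ?_
      rw [uIoc_of_le hR0.le] at hx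
      refine hKn _ _ (by simpa using hx.1.le) (fun h => ?_) hR0 ?_ ?_
      · have := congrArg Complex.im h
        simp at this; linarith
      · refine le_trans ?_ (Complex.abs_im_le_norm _)
        simp [abs_of_pos hR0]
      · refine le_trans ?_ (Complex.abs_im_le_norm _)
        simp [abs_of_pos hR0]
    have ht : ‖∫ x in (0:ℝ)..R, K (x + R * Complex.I)‖ ≤ 2 * B / R ^ 2 * |R - 0| := by
      refine intervalIntegral.norm_integral_le_of_norm_le_const fun x hx => ?_
      rw [uIoc_of_le hR0.le] at hx
      refine hKn _ _ (by simpa using hx.1.le) (fun h => ?_) hR0 ?_ ?_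
      · have := congrArg Complex.im h
        simp at this; linarith
      · refine le_trans ?_ (Complex.abs_im_le_norm _)
        simp [abs_of_pos hR0]
      · refine le_trans ?_ (Complex.abs_im_le_norm _)
        simp [abs_of_pos hR0]
    have hr : ‖∫ y in (-R)..R, K (R + y * Complex.I)‖ ≤ 2 * B / (R / 2) ^ 2 * |R - -R| := by
      refine intervalIntegral.norm_integral_le_of_norm_le_const fun y _ => ?_
      refine hKn _ _ (by simpa using hR0.le) (fun h => ?_) (by linarith) ?_ ?_
      · have := congrArg Complex.re h
        simp at this; linarith
      · refine le_trans ?_ (Complex.re_le_norm _)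
        simp; linarith
      · refine le_trans ?_ (Complex.re_le_norm _)
        simp; linarith
    have e : (∫ y in (-R)..R, K (y * Complex.I)) = -Complex.I *
        ((∫ x in (0:ℝ)..R, K (x + -R * Complex.I)) - ∫ x in (0:ℝ)..R, K (x + R * Complex.I)) +
        ∫ y in (-R)..R, K (R + y * Complex.I) := by
      linear_combination Complex.I * key + ((∫ y in (-R)..R, K (y * Complex.I)) -
        ∫ y in (-R)..R, K (R + y * Complex.I)) * Complex.I_sq
    rw [e]
    rw [abs_of_pos (by linarith : 0 < R - 0)] at hb ht
    rw [abs_of_pos (by linarith : 0 < R - -R)] at hr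
    refine (norm_add_le _ _).trans ?_
    rw [norm_mul, norm_neg, Complex.norm_I, one_mul]
    have := norm_sub_le (∫ x in (0:ℝ)..R, K (x + -R * Complex.I))
      (∫ x in (0:ℝ)..R, K (x + R * Complex.I))
    have e2 : 20 * B * R⁻¹ = 2 * B / R ^ 2 * (R - 0) + 2 * B / R ^ 2 * (R - 0) +
        2 * B / (R / 2) ^ 2 * (R - -R) := by
      field_simp; ring
    linarith
  have hzero : ∫ y : ℝ, K (y * Complex.I) = 0 := by
    refine tendsto_nhds_unique hlim (squeeze_zero_norm' (a := fun R : ℝ => 20 * B * R⁻¹) ?_ ?_)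
    · filter_upwards [eventually_gt_atTop (2 * d)] with R hR using hrect R hR
    · simpa using tendsto_inv_atTop_zero.const_mul (20 * B)
  simp_rw [hKI] at hzero
  rw [integral_sub hint2 hint1, integral_mul_const, integral_complex_ofReal,
    integral_univ_inv_sq_add_sq hd] at hzero
  linear_combination -hzero

/-- Integration against the Poisson kernel of the half-plane `a < re s`, at the point `a + d`. -/
noncomputable def poissonAverage (d : ℝ) (f : ℝ → ℝ) : ℝ :=
  d / Real.pi * ∫ y : ℝ, (d ^ 2 + y ^ 2)⁻¹ * f y

theorem norm_le_poissonAverage {f : ℂ → ℂ} {B d a : ℝ} (hd : 0 < d)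
    (hc : ContinuousOn f {z | a ≤ z.re}) (hf : DifferentiableOn ℂ f {z | a < z.re})
    (hB : ∀ z : ℂ, a ≤ z.re → ‖f z‖ ≤ B) :
    ‖f (a + d : ℝ)‖ ≤ poissonAverage d fun y => ‖f (a + y * Complex.I)‖ := by
  have h := integral_poisson_halfPlane (f := fun z => f (a + z)) hd
    (hc.comp (by fun_prop) fun z hz => by simpa using hz)
    (hf.comp (by fun_prop) fun z hz => by simpa using hz)
    (fun z hz => hB _ (by simpa using hz))
  have h2 : f (a + d : ℝ) = (d / Real.pi : ℝ) *
      ∫ y : ℝ, (((d ^ 2 + y ^ 2)⁻¹ : ℝ) : ℂ) * f (a + y * Complex.I) := by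
    rw [h]
    have := Real.pi_ne_zero
    have : (Real.pi : ℂ) ≠ 0 := by exact_mod_cast this
    have : (d : ℂ) ≠ 0 := by exact_mod_cast hd.ne'
    push_cast
    field_simp
  rw [h2, poissonAverage, norm_mul, Complex.norm_real, Real.norm_of_nonneg
    (by have := Real.pi_pos; positivity)]
  have := Real.pi_pos
  gcongr
  refine (norm_integral_le_integral_norm _).trans_eq ?_
  refine integral_congr_ae (ae_of_all _ fun y => ?_)
  change ‖_ * _‖ = _
  rw [norm_mul, Complex.norm_real, Real.norm_of_nonneg (by positivity)]

theorem integrable_poisson_mul {d B : ℝ} (hd : 0 < d) {f : ℝ → ℝ} (hf : AEStronglyMeasurable f)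
    (hB : ∀ y, |f y| ≤ B) : Integrable fun y => (d ^ 2 + y ^ 2)⁻¹ * f y :=
  (integrable_univ_inv_sq_add_sq hd).mul_bdd (c := B) hf (ae_of_all _ hB)

/-! ### Mean squares of generalized Dirichlet series against the Poisson kernel -/

/-- The generalized Dirichlet series `∑ c n (1 + n q)^{-s}`. -/
noncomputable def progressionSeries (c : ℕ → ℂ) (q : ℝ) (s : ℂ) : ℂ :=
  ∑' n : ℕ, c n * ((1 + n * q : ℝ) : ℂ) ^ (-s)

theorem mul_rpow_neg_le_sub {x y w : ℝ} (hx : 0 < x) (hxy : x ≤ y) (hw : 0 ≤ w) :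
    w * ((y - x) * y ^ (-1 - w)) ≤ x ^ (-w) - y ^ (-w) := by
  have hy : 0 < y := hx.trans_le hxy
  have h1 : 1 + w * (1 - x / y) ≤ (x / y) ^ (-w) := by
    rw [Real.rpow_def_of_pos (by positivity)]
    have h2 := Real.add_one_le_exp (Real.log (x / y) * -w)
    have h3 := Real.log_le_sub_one_of_pos (div_pos hx hy)
    nlinarith
  rw [Real.div_rpow hx.le hy.le, le_div_iff₀ (by positivity)] at h1
  have h4 : y ^ (-1 - w) = y ^ (-w) / y := by
    rw [show -1 - w = -w - 1 by ring, Real.rpow_sub_one hy.ne']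
  rw [h4]
  have h5 : w * ((y - x) * (y ^ (-w) / y)) = w * (1 - x / y) * y ^ (-w) := by
    field_simp
  rw [h5]
  linarith

theorem one_le_progression {q : ℝ} (hq : 1 / 2 ≤ q) (n : ℕ) : 1 ≤ 1 + n * q := by
  have : 0 ≤ (n:ℝ) * q := by positivity
  linarith

theorem sum_progression_rpow_le {q w : ℝ} (hq : 1 / 2 ≤ q) (hw : 0 < w) (N : ℕ) :
    ∑ n ∈ Finset.range N, (1 + n * q) ^ (-1 - w) ≤ 1 + 2 / w := by
  have key : ∑ n ∈ Finset.range (N + 1), (1 + n * q) ^ (-1 - w) ≤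
      1 + 2 / w * (1 - (1 + N * q) ^ (-w)) := by
    induction N with
    | zero => simp
    | succ N ih =>
      rw [Finset.sum_range_succ]
      have h0 := one_le_progression hq N
      have h := mul_rpow_neg_le_sub (x := 1 + N * q) (y := 1 + (N + 1 : ℕ) * q) (w := w)
        (by linarith) (by push_cast; nlinarith) hw.le
      have h3 : 0 ≤ (1 + ((N + 1 : ℕ) : ℝ) * q) ^ (-1 - w) := by positivity
      rw [show (1 + ((N + 1 : ℕ) : ℝ) * q) - (1 + N * q) = q by push_cast; ring] at h
      have h4 : (1 + ((N + 1 : ℕ) : ℝ) * q) ^ (-1 - w) ≤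
          2 / w * ((1 + N * q) ^ (-w) - (1 + ((N + 1 : ℕ) : ℝ) * q) ^ (-w)) := by
        rw [div_mul_eq_mul_div, le_div_iff₀ hw]
        have : w * (1 / 2 * (1 + ((N + 1 : ℕ) : ℝ) * q) ^ (-1 - w)) ≤
          w * (q * (1 + ((N + 1 : ℕ) : ℝ) * q) ^ (-1 - w)) := by gcongr
        linarith
      linarith
  calc _ ≤ ∑ n ∈ Finset.range (N + 1), (1 + n * q) ^ (-1 - w) := by
        rw [Finset.sum_range_succ]
        have : 0 ≤ (1 + N * q) ^ (-1 - w) := by positivity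
        linarith
    _ ≤ _ := key
    _ ≤ 1 + 2 / w * 1 := by
        gcongr
        have : 0 ≤ (1 + N * q) ^ (-w) := by positivity
        linarith
    _ = _ := by ring

theorem summable_progression_rpow {q w : ℝ} (hq : 1 / 2 ≤ q) (hw : 0 < w) :
    Summable fun n : ℕ => (1 + n * q) ^ (-1 - w) :=
  summable_of_sum_range_le (fun n => by positivity) (sum_progression_rpow_le hq hw)

theorem tsum_progression_rpow_le {q w : ℝ} (hq : 1 / 2 ≤ q) (hw : 0 < w) :
    ∑' n : ℕ, (1 + n * q) ^ (-1 - w) ≤ 1 + 2 / w :=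
  Real.tsum_le_of_sum_range_le (fun n => by positivity) (sum_progression_rpow_le hq hw)

theorem norm_progressionSeries_term {c : ℕ → ℂ} {q : ℝ} (hq : 1 / 2 ≤ q) (hc : ∀ n, ‖c n‖ ≤ 1)
    {s : ℂ} {w : ℝ} (hs : 1 + w ≤ s.re) (n : ℕ) :
    ‖c n * ((1 + n * q : ℝ) : ℂ) ^ (-s)‖ ≤ (1 + n * q) ^ (-1 - w) := by
  have h0 := one_le_progression hq n
  rw [norm_mul, Complex.norm_cpow_eq_rpow_re_of_pos (by linarith), Complex.neg_re]
  have h1 : (1 + n * q) ^ (-s.re) ≤ (1 + n * q) ^ (-1 - w) :=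
    Real.rpow_le_rpow_of_exponent_le h0 (by linarith)
  calc _ ≤ 1 * (1 + n * q) ^ (-s.re) := by gcongr; exact hc n
    _ ≤ _ := by rw [one_mul]; exact h1

theorem norm_progressionSeries_le {c : ℕ → ℂ} {q : ℝ} (hq : 1 / 2 ≤ q) (hc : ∀ n, ‖c n‖ ≤ 1)
    {s : ℂ} {w : ℝ} (hw : 0 < w) (hs : 1 + w ≤ s.re) :
    ‖progressionSeries c q s‖ ≤ 1 + 2 / w :=
  (tsum_of_norm_bounded (summable_progression_rpow hq hw).hasSum
    (norm_progressionSeries_term hq hc hs)).trans (tsum_progression_rpow_le hq hw)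

theorem sum_progression_rpow_neg_half_le {q : ℝ} (hq : 1 / 2 ≤ q) (n : ℕ) :
    ∑ m ∈ Finset.range (n + 1), (1 + m * q) ^ (-(1 / 2) : ℝ) ≤ 5 * (1 + n * q) ^ (1 / 2 : ℝ) := by
  induction n with
  | zero => norm_num
  | succ n ih =>
    rw [Finset.sum_range_succ]
    have h0 := one_le_progression hq n
    set x : ℝ := 1 + n * q with hx
    have hy : 1 + ((n + 1 : ℕ) : ℝ) * q = x + q := by push_cast; ring
    rw [hy, Real.rpow_neg (by linarith), ← Real.sqrt_eq_rpow]
    rw [← Real.sqrt_eq_rpow] at ih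
    have hs : 0 < √(x + q) := Real.sqrt_pos.2 (by linarith)
    have h1 := Real.sq_sqrt (show 0 ≤ x + q by linarith)
    have h2 := Real.sq_sqrt (show 0 ≤ x by linarith)
    have h3 : √x ≤ √(x + q) := Real.sqrt_le_sqrt (by linarith)
    have h4 : (√(x + q))⁻¹ ≤ 5 * (√(x + q) - √x) := by
      rw [inv_le_iff_one_le_mul₀ hs]
      nlinarith [Real.sqrt_nonneg x]
    linarith

theorem norm_integral_poisson_exp {d : ℝ} (hd : 0 < d) (l : ℝ) :
    ‖∫ y : ℝ, (((d ^ 2 + y ^ 2)⁻¹ : ℝ) : ℂ) * Complex.exp (-(l * (y * Complex.I)))‖ ≤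
      Real.pi / d * Real.exp (-(d * |l|)) := by
  have key : ∀ l : ℝ, 0 ≤ l →
      ‖∫ y : ℝ, (((d ^ 2 + y ^ 2)⁻¹ : ℝ) : ℂ) * Complex.exp (-(l * (y * Complex.I)))‖ ≤
      Real.pi / d * Real.exp (-(d * |l|)) := by
    intro l hl
    have h := integral_poisson_halfPlane (f := fun z => Complex.exp (-(l * z))) (B := 1) hd
      (by fun_prop) (by fun_prop) (fun z hz => by
        rw [Complex.norm_exp]
        refine Real.exp_le_one_iff.2 ?_
        simp
        positivity)
    rw [h, norm_mul, Complex.norm_real, Real.norm_of_nonneg (by have := Real.pi_pos; positivity),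
      Complex.norm_exp, abs_of_nonneg hl]
    simp [mul_comm]
  rcases le_total 0 l with hl | hl
  · exact key l hl
  · have h := key (-l) (by linarith)
    rw [abs_neg] at h
    rw [← integral_neg_eq_self]
    convert! h using 6 with y
    · rw [neg_sq]
    · push_cast; ring

/-- The diagonal-dominated bound for the mean square of an exponential sum: the Poisson kernel has
Fourier transform `exp (-d |l|)`. -/
theorem poissonAverage_sq_norm_sum_le {ι : Type*} (S : Finset ι) (a : ι → ℂ) (l : ι → ℝ) {d : ℝ}
    (hd : 0 < d) :
    poissonAverage d (fun y => ‖∑ n ∈ S, a n * Complex.exp (-(l n * (y * Complex.I)))‖ ^ 2) ≤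
      ∑ m ∈ S, ∑ n ∈ S, ‖a m‖ * ‖a n‖ * Real.exp (-(d * |l m - l n|)) := by
  have hexp : ∀ y : ℝ, (((d ^ 2 + y ^ 2)⁻¹ * ‖∑ n ∈ S, a n *
      Complex.exp (-(l n * (y * Complex.I)))‖ ^ 2 : ℝ) : ℂ) = ∑ m ∈ S, ∑ n ∈ S,
      a m * (starRingEnd ℂ) (a n) * ((((d ^ 2 + y ^ 2)⁻¹ : ℝ) : ℂ) *
        Complex.exp (-((l m - l n : ℝ) * (y * Complex.I)))) := by
    intro y
    push_cast
    rw [← Complex.mul_conj', map_sum, Finset.sum_mul_sum, Finset.mul_sum]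
    refine Finset.sum_congr rfl fun m _ => ?_
    rw [Finset.mul_sum]
    refine Finset.sum_congr rfl fun n _ => ?_
    rw [map_mul, ← Complex.exp_conj]
    simp only [map_neg, map_mul, Complex.conj_ofReal, Complex.conj_I]
    rw [show (-((l m - l n : ℂ) * (y * Complex.I))) = -(l m * (y * Complex.I)) +
      -(l n * (y * -Complex.I)) by ring, Complex.exp_add]
    ring
  have hint : ∀ m n, Integrable fun y : ℝ => a m * (starRingEnd ℂ) (a n) *
      ((((d ^ 2 + y ^ 2)⁻¹ : ℝ) : ℂ) * Complex.exp (-((l m - l n : ℝ) * (y * Complex.I)))) := by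
    intro m n
    refine Integrable.const_mul ?_ _
    refine ((integrable_univ_inv_sq_add_sq hd).ofReal (𝕜 := ℂ)).mul_bdd (c := 1)
      (by fun_prop) (ae_of_all _ fun y => ?_)
    rw [Complex.norm_exp]
    simp
  have hval : ((∫ y : ℝ, (d ^ 2 + y ^ 2)⁻¹ * ‖∑ n ∈ S, a n *
      Complex.exp (-(l n * (y * Complex.I)))‖ ^ 2 : ℝ) : ℂ) = ∑ m ∈ S, ∑ n ∈ S,
      a m * (starRingEnd ℂ) (a n) * ∫ y : ℝ, ((((d ^ 2 + y ^ 2)⁻¹ : ℝ) : ℂ) *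
        Complex.exp (-((l m - l n : ℝ) * (y * Complex.I)))) := by
    rw [← integral_complex_ofReal]
    simp_rw [hexp]
    rw [integral_finsetSum _ fun m _ => integrable_finsetSum _ fun n _ => hint m n]
    refine Finset.sum_congr rfl fun m _ => ?_
    rw [integral_finsetSum _ fun n _ => hint m n]
    refine Finset.sum_congr rfl fun n _ => ?_
    rw [integral_const_mul]
  have hpi := Real.pi_pos
  have hle : (∫ y : ℝ, (d ^ 2 + y ^ 2)⁻¹ * ‖∑ n ∈ S, a n *
      Complex.exp (-(l n * (y * Complex.I)))‖ ^ 2) ≤ ∑ m ∈ S, ∑ n ∈ S, ‖a m‖ * ‖a n‖ *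
        (Real.pi / d * Real.exp (-(d * |l m - l n|))) := by
    refine (le_abs_self _).trans ?_
    rw [← Real.norm_eq_abs, ← Complex.norm_real, hval]
    refine (norm_sum_le _ _).trans (Finset.sum_le_sum fun m _ => (norm_sum_le _ _).trans
      (Finset.sum_le_sum fun n _ => ?_))
    rw [norm_mul, norm_mul, RCLike.norm_conj]
    gcongr
    exact norm_integral_poisson_exp hd _
  rw [poissonAverage]
  calc _ ≤ d / Real.pi * ∑ m ∈ S, ∑ n ∈ S, ‖a m‖ * ‖a n‖ *
        (Real.pi / d * Real.exp (-(d * |l m - l n|))) := by gcongr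
    _ = _ := by
      rw [Finset.mul_sum]
      refine Finset.sum_congr rfl fun m _ => ?_
      rw [Finset.mul_sum]
      refine Finset.sum_congr rfl fun n _ => ?_
      field_simp

theorem sum_sum_le_two_mul_of_symm {f : ℕ → ℕ → ℝ} (hf : ∀ m n, 0 ≤ f m n)
    (hs : ∀ m n, f m n = f n m) (N : ℕ) :
    ∑ m ∈ Finset.range N, ∑ n ∈ Finset.range N, f m n ≤
      2 * ∑ n ∈ Finset.range N, ∑ m ∈ Finset.range (n + 1), f m n := by
  induction N with
  | zero => simp
  | succ N ih =>
    rw [Finset.sum_range_succ, Finset.sum_range_succ (fun n => ∑ m ∈ Finset.range (n + 1), f m n)]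
    simp_rw [Finset.sum_range_succ (fun n => f _ n) N]
    rw [Finset.sum_add_distrib, Finset.sum_range_succ (fun m => f m N)]
    have : ∑ n ∈ Finset.range N, f N n = ∑ n ∈ Finset.range N, f n N :=
      Finset.sum_congr rfl fun n _ => hs N n
    rw [this]
    have := hf N N
    linarith

/-- On the line `re s = 1 + w` the series may be of size `1 / w`, but its mean square is only of
order `1 / w` too: the frequencies `log (1 + n q)` interact with weight `(min / max) ^ d`, and
`d ≥ 1 / 2` makes the double sum comparable to its diagonal. -/
theorem poissonAverage_sq_progressionSeries_le {c : ℕ → ℂ} {q : ℝ} (hq : 1 / 2 ≤ q)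
    (hc : ∀ n, ‖c n‖ ≤ 1) {w d : ℝ} (hw : 0 < w) (hd : 1 / 2 ≤ d) :
    poissonAverage d (fun y => ‖progressionSeries c q ((1 + w : ℝ) + y * Complex.I)‖ ^ 2) ≤
      10 * (1 + 2 / w) := by
  have hd0 : 0 < d := by linarith
  have hpi := Real.pi_pos
  set P : ℕ → ℝ → ℂ := fun N y => ∑ n ∈ Finset.range N,
    c n * ((1 + n * q : ℝ) : ℂ) ^ (-((1 + w : ℝ) + y * Complex.I)) with hP
  have hre : ∀ y : ℝ, 1 + w ≤ ((1 + w : ℝ) + y * Complex.I : ℂ).re := fun y => by simp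
  have hpart : ∀ N, poissonAverage d (fun y => ‖P N y‖ ^ 2) ≤ 10 * (1 + 2 / w) := by
    intro N
    have hterm : ∀ (n : ℕ) (y : ℝ), c n * ((1 + n * q : ℝ) : ℂ) ^ (-((1 + w : ℝ) + y * Complex.I))
        = (c n * (((1 + n * q) ^ (-1 - w) : ℝ) : ℂ)) *
          Complex.exp (-((Real.log (1 + n * q) : ℝ) * (y * Complex.I))) := by
      intro n y
      have h0 := one_le_progression hq n
      have hne : ((1 + n * q : ℝ) : ℂ) ≠ 0 := by exact_mod_cast (by linarith : (1 + n * q) ≠ 0)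
      rw [mul_assoc, Complex.ofReal_cpow (by linarith),
        show (-((1 + w : ℝ) + y * Complex.I) : ℂ) = ((-1 - w : ℝ) : ℂ) + -(y * Complex.I) by
          push_cast; ring, Complex.cpow_add _ _ hne,
        Complex.cpow_def_of_ne_zero hne (-(y * Complex.I)), Complex.ofReal_log (by linarith)]
      ring_nf
    simp_rw [hP, hterm]
    refine (poissonAverage_sq_norm_sum_le _ _ _ hd0).trans ?_
    set A : ℕ → ℝ := fun n => ‖c n * (((1 + n * q) ^ (-1 - w) : ℝ) : ℂ)‖ with hA
    have hAle : ∀ n, A n ≤ (1 + n * q) ^ (-1 - w) := by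
      intro n
      have h0 := one_le_progression hq n
      simp only [hA]
      rw [norm_mul, Complex.norm_real, Real.norm_of_nonneg (by positivity)]
      exact mul_le_of_le_one_left (by positivity) (hc n)
    have hA0 : ∀ n, 0 ≤ A n := fun n => norm_nonneg _
    refine (sum_sum_le_two_mul_of_symm (f := fun m n => A m * A n *
      Real.exp (-(d * |Real.log (1 + m * q) - Real.log (1 + n * q)|)))
      (fun m n => by have := hA0 m; have := hA0 n; positivity)
      (fun m n => by rw [abs_sub_comm, mul_comm (A m)]) N).trans ?_
    have hin : ∀ n, ∑ m ∈ Finset.range (n + 1), A m * A n *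
        Real.exp (-(d * |Real.log (1 + m * q) - Real.log (1 + n * q)|)) ≤
        5 * (1 + n * q) ^ (-1 - w) := by
      intro n
      have hn := one_le_progression hq n
      have hb : ∀ m ∈ Finset.range (n + 1), A m * A n *
          Real.exp (-(d * |Real.log (1 + m * q) - Real.log (1 + n * q)|)) ≤
          (1 + n * q) ^ (-1 - w) * (1 + n * q) ^ (-(1 / 2) : ℝ) *
            (1 + m * q) ^ (-(1 / 2) : ℝ) := by
        intro m hm
        have h0 := one_le_progression hq m
        have hmn : (m:ℝ) ≤ n := by
          have := Finset.mem_range.1 hm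
          exact_mod_cast Nat.lt_succ_iff.1 this
        have hle : 1 + m * q ≤ 1 + n * q := by gcongr
        have hlog : Real.log (1 + m * q) ≤ Real.log (1 + n * q) :=
          Real.log_le_log (by linarith) hle
        rw [abs_of_nonpos (by linarith)]
        have e1 : Real.exp (-(d * -(Real.log (1 + m * q) - Real.log (1 + n * q)))) ≤
            (1 + n * q) ^ (-(1 / 2) : ℝ) * (1 + m * q) ^ (1 / 2 : ℝ) := by
          rw [Real.rpow_def_of_pos (by linarith), Real.rpow_def_of_pos (by linarith),
            ← Real.exp_add]
          refine Real.exp_le_exp.2 ?_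
          nlinarith
        have e2 : (1 + m * q) ^ (-1 - w) ≤ (1 + m * q) ^ (-1 : ℝ) :=
          Real.rpow_le_rpow_of_exponent_le h0 (by linarith)
        calc _ ≤ (1 + m * q) ^ (-1 : ℝ) * (1 + n * q) ^ (-1 - w) *
              ((1 + n * q) ^ (-(1 / 2) : ℝ) * (1 + m * q) ^ (1 / 2 : ℝ)) := by
              have := hA0 m
              have := hA0 n
              gcongr
              · exact (hAle m).trans e2
              · exact hAle n
          _ = _ := by
              rw [show (-(1 / 2) : ℝ) = -1 + 1 / 2 by norm_num,
                Real.rpow_add (by linarith : 0 < 1 + m * q)]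
              ring
      refine (Finset.sum_le_sum hb).trans ?_
      rw [← Finset.mul_sum]
      calc _ ≤ (1 + n * q) ^ (-1 - w) * (1 + n * q) ^ (-(1 / 2) : ℝ) *
            (5 * (1 + n * q) ^ (1 / 2 : ℝ)) := by
            gcongr
            exact sum_progression_rpow_neg_half_le hq n
        _ = 5 * (1 + n * q) ^ (-1 - w) * ((1 + n * q) ^ (-(1 / 2) : ℝ) *
            (1 + n * q) ^ (1 / 2 : ℝ)) := by ring
        _ = _ := by rw [← Real.rpow_add (by linarith)]; norm_num
    calc _ ≤ 2 * ∑ n ∈ Finset.range N, 5 * (1 + n * q) ^ (-1 - w) := by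
          gcongr with n _
          exact hin n
      _ = 10 * ∑ n ∈ Finset.range N, (1 + n * q) ^ (-1 - w) := by
          rw [← Finset.mul_sum]; ring
      _ ≤ _ := by gcongr; exact sum_progression_rpow_le hq hw N
  have hsum : ∀ y : ℝ, Summable fun n : ℕ =>
      c n * ((1 + n * q : ℝ) : ℂ) ^ (-((1 + w : ℝ) + y * Complex.I)) := fun y =>
    Summable.of_norm_bounded (summable_progression_rpow hq hw)
      (norm_progressionSeries_term hq hc (hre y))
  have hPc : ∀ N, Continuous (P N) := by
    intro N
    refine continuous_finsetSum _ fun n _ => continuous_const.mul ?_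
    have h0 := one_le_progression hq n
    refine Continuous.const_cpow (by fun_prop) (Or.inl ?_)
    exact_mod_cast (by linarith : (1 + n * q) ≠ 0)
  have hPb : ∀ N y, ‖P N y‖ ≤ 1 + 2 / w := fun N y =>
    (norm_sum_le _ _).trans ((Finset.sum_le_sum fun n _ =>
      norm_progressionSeries_term hq hc (hre y) n).trans (sum_progression_rpow_le hq hw N))
  have hlim : Tendsto (fun N => poissonAverage d (fun y => ‖P N y‖ ^ 2)) atTop
      (𝓝 (poissonAverage d fun y =>
        ‖progressionSeries c q ((1 + w : ℝ) + y * Complex.I)‖ ^ 2)) := by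
    refine Tendsto.const_mul _ (tendsto_integral_of_dominated_convergence
      (fun y => (d ^ 2 + y ^ 2)⁻¹ * (1 + 2 / w) ^ 2) (fun N => ?_)
      ((integrable_univ_inv_sq_add_sq hd0).mul_const _) (fun N => ae_of_all _ fun y => ?_)
      (ae_of_all _ fun y => ?_))
    · exact (integrable_univ_inv_sq_add_sq hd0).aestronglyMeasurable.mul
        (((hPc N).norm.pow 2).aestronglyMeasurable)
    · rw [Real.norm_of_nonneg (by positivity)]
      exact mul_le_mul_of_nonneg_left (pow_le_pow_left₀ (norm_nonneg _) (hPb N y) 2)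
        (by positivity)
    · exact (((hsum y).hasSum.tendsto_sum_nat.norm).pow 2).const_mul _
  exact le_of_tendsto' hlim hpart

/-! ### The harmonic measure of a segment and the channel estimate -/

theorem arg_eq_arctan {z : ℂ} (hz : 0 < z.re) : z.arg = Real.arctan (z.im / z.re) := by
  have h := abs_lt.1 (Complex.abs_arg_lt_pi_div_two_iff.2 (Or.inl hz))
  rw [← Complex.tan_arg, Real.arctan_tan h.1 h.2]

theorem arctan_sub_le_of_nonneg {A B : ℝ} (hB : 0 ≤ B) (hAB : B ≤ A) :
    Real.arctan A - Real.arctan B ≤ (A - B) / (1 + B ^ 2) := by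
  have h := (convex_Ici B).image_sub_le_mul_sub_of_deriv_le (f := Real.arctan)
    Real.continuous_arctan.continuousOn Real.differentiable_arctan.differentiableOn
    (C := 1 / (1 + B ^ 2)) (fun x hx => by
      rw [interior_Ici] at hx
      have : B < x := hx
      rw [Real.deriv_arctan]
      exact one_div_le_one_div_of_le (by positivity) (by nlinarith)) B self_mem_Ici A hAB hAB
  rwa [one_div, inv_mul_eq_div] at h

theorem arctan_sub_le {A B : ℝ} (hAB : B ≤ A) : Real.arctan A - Real.arctan B ≤ A - B := by
  have h := convex_univ.image_sub_le_mul_sub_of_deriv_le (f := Real.arctan)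
    Real.continuous_arctan.continuousOn Real.differentiable_arctan.differentiableOn
    (C := 1) (fun x _ => by
      rw [Real.deriv_arctan]
      exact div_le_one_of_le₀ (by nlinarith) (by positivity)) B (mem_univ _) A (mem_univ _) hAB
  linarith

theorem div_one_add_le_arctan {z : ℝ} (hz : 0 ≤ z) : z / (1 + z) ≤ Real.arctan z := by
  have hd : ∀ x ∈ Ioi (0:ℝ), HasDerivAt (fun x => Real.arctan x - x / (1 + x))
      (1 / (1 + x ^ 2) - 1 / (1 + x) ^ 2) x := by
    intro x hx
    have hx0 : 0 < x := hx
    have h1 : (1 + x) ≠ 0 := by positivity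
    refine ((Real.hasDerivAt_arctan x).sub
      ((hasDerivAt_id x).div ((hasDerivAt_id x).const_add 1) h1)).congr_deriv ?_
    simp
  have hm : MonotoneOn (fun x => Real.arctan x - x / (1 + x)) (Ici 0) := by
    refine monotoneOn_of_deriv_nonneg (convex_Ici 0) ?_ ?_ ?_
    · refine Real.continuous_arctan.continuousOn.sub (continuousOn_id.div (by fun_prop) ?_)
      intro x hx
      have hx0 : 0 ≤ x := hx
      positivity
    · rw [interior_Ici]
      exact fun x hx => (hd x hx).differentiableAt.differentiableWithinAt
    · rw [interior_Ici]
      intro x hx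
      have hx0 : 0 < x := hx
      rw [(hd x hx).deriv, sub_nonneg]
      gcongr
      nlinarith
  have := hm self_mem_Ici hz hz
  simp at this
  linarith

/-- A holomorphic function on `0 < re z` whose real part is the angle, divided by `π`, under which
the segment `[-i h, i h]` is seen from `z`: the harmonic measure of this segment in the
half-plane. -/
noncomputable def segmentPotential (h : ℝ) (z : ℂ) : ℂ :=
  (Real.pi : ℂ)⁻¹ * (-Complex.I * Complex.log (z + h * Complex.I) +
    Complex.I * Complex.log (z - h * Complex.I))

theorem differentiableAt_segmentPotential (h : ℝ) {z : ℂ} (hz : 0 < z.re) :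
    DifferentiableAt ℂ (segmentPotential h) z := by
  have h1 : z + h * Complex.I ∈ Complex.slitPlane := Or.inl (by simpa using hz)
  have h2 : z - h * Complex.I ∈ Complex.slitPlane := Or.inl (by simpa using hz)
  unfold segmentPotential
  exact ((((differentiableAt_id.add_const _).clog h1).const_mul _).add
    (((differentiableAt_id.sub_const _).clog h2).const_mul _)).const_mul _

theorem re_segmentPotential (h : ℝ) {z : ℂ} (hz : 0 < z.re) :
    (segmentPotential h z).re = Real.pi⁻¹ *
      (Real.arctan ((z.im + h) / z.re) - Real.arctan ((z.im - h) / z.re)) := by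
  have h1 : (z + h * Complex.I).arg = Real.arctan ((z.im + h) / z.re) := by
    rw [arg_eq_arctan (by simpa using hz)]; simp
  have h2 : (z - h * Complex.I).arg = Real.arctan ((z.im - h) / z.re) := by
    rw [arg_eq_arctan (by simpa using hz)]; simp
  rw [segmentPotential, ← Complex.ofReal_inv, Complex.re_ofReal_mul]
  congr 1
  rw [Complex.add_re, Complex.mul_re, Complex.mul_re, Complex.log_im, Complex.log_im, h1, h2]
  simp [sub_eq_add_neg]

theorem re_segmentPotential_le_one (h : ℝ) {z : ℂ} (hz : 0 < z.re) :
    (segmentPotential h z).re ≤ 1 := by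
  rw [re_segmentPotential h hz, inv_mul_le_iff₀ Real.pi_pos]
  have := Real.arctan_lt_pi_div_two ((z.im + h) / z.re)
  have := Real.neg_pi_div_two_lt_arctan ((z.im - h) / z.re)
  linarith

theorem re_segmentPotential_le_div {h : ℝ} (hh : 0 ≤ h) {z : ℂ} (hz : 0 < z.re) :
    (segmentPotential h z).re ≤ 2 * h / (Real.pi * z.re) := by
  rw [re_segmentPotential h hz, inv_mul_le_iff₀ Real.pi_pos]
  have := arctan_sub_le (A := (z.im + h) / z.re) (B := (z.im - h) / z.re) (by gcongr; linarith)
  have hp := Real.pi_pos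
  calc _ ≤ _ := this
    _ = _ := by field_simp; ring

theorem re_segmentPotential_le {h : ℝ} (hh : 0 ≤ h) {z : ℂ} (hz : 0 < z.re) (hi : h ≤ |z.im|) :
    (segmentPotential h z).re ≤
      2 * h * z.re / (Real.pi * (z.re ^ 2 + (|z.im| - h) ^ 2)) := by
  rw [re_segmentPotential h hz, inv_mul_le_iff₀ Real.pi_pos]
  have e : Real.arctan ((z.im + h) / z.re) - Real.arctan ((z.im - h) / z.re) =
      Real.arctan ((|z.im| + h) / z.re) - Real.arctan ((|z.im| - h) / z.re) := by
    rcases le_total 0 z.im with h0 | h0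
    · rw [abs_of_nonneg h0]
    · rw [abs_of_nonpos h0, show (-z.im + h) / z.re = -((z.im - h) / z.re) by ring,
        show (-z.im - h) / z.re = -((z.im + h) / z.re) by ring, Real.arctan_neg, Real.arctan_neg]
      ring
  rw [e]
  have := arctan_sub_le_of_nonneg (A := (|z.im| + h) / z.re) (B := (|z.im| - h) / z.re)
    (div_nonneg (by linarith) hz.le) (by gcongr; linarith)
  have hp := Real.pi_pos
  calc _ ≤ _ := this
    _ = _ := by field_simp; ring

theorem le_re_segmentPotential {h : ℝ} (hh : 0 ≤ h) {x : ℝ} (hx : 0 < x) :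
    2 / Real.pi * (h / (x + h)) ≤ (segmentPotential h x).re := by
  rw [re_segmentPotential h (by simpa using hx)]
  simp only [Complex.ofReal_im, Complex.ofReal_re, zero_add, zero_sub]
  rw [neg_div, Real.arctan_neg]
  have := div_one_add_le_arctan (div_nonneg hh hx.le)
  have e : h / x / (1 + h / x) = h / (x + h) := by field_simp
  rw [e] at this
  have hp := Real.pi_pos
  calc _ = Real.pi⁻¹ * (h / (x + h) + h / (x + h)) := by ring
    _ ≤ _ := by gcongr; linarith

theorem re_cos (z : ℂ) : (Complex.cos z).re = Real.cos z.re * Real.cosh z.im := by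
  rw [Complex.cos_eq]
  simp [← Complex.ofReal_cos, ← Complex.ofReal_cosh, ← Complex.ofReal_sin, ← Complex.ofReal_sinh]

theorem norm_le_of_frontier_rect {f : ℂ → ℂ} {l r Y B : ℝ} (hlr : l < r) (hY : 0 < Y)
    (hf : DiffContOnCl ℂ f (Ioo l r ×ℂ Ioo (-Y) Y))
    (hl : ∀ z : ℂ, z.re = l → |z.im| ≤ Y → ‖f z‖ ≤ B)
    (hr : ∀ z : ℂ, z.re = r → |z.im| ≤ Y → ‖f z‖ ≤ B)
    (hh : ∀ z : ℂ, l ≤ z.re → z.re ≤ r → |z.im| = Y → ‖f z‖ ≤ B)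
    {z : ℂ} (hz1 : l ≤ z.re) (hz2 : z.re ≤ r) (hz3 : |z.im| ≤ Y) : ‖f z‖ ≤ B := by
  have hYY : -Y < Y := by linarith
  refine Complex.norm_le_of_forall_mem_frontier_norm_le
    ((Metric.isBounded_Ioo _ _).reProdIm (Metric.isBounded_Ioo _ _)) hf (fun w hw => ?_) ?_
  · rw [Complex.frontier_reProdIm, closure_Ioo hlr.ne, frontier_Ioo hYY, closure_Ioo hYY.ne,
      frontier_Ioo hlr] at hw
    rcases hw with ⟨h1, h2⟩ | ⟨h1, h2⟩
    · refine hh w h1.1 h1.2 ?_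
      rcases h2 with h2 | h2
      · rw [h2, abs_neg, abs_of_pos hY]
      · rw [show w.im = Y from h2, abs_of_pos hY]
    · have h3 : |w.im| ≤ Y := abs_le.2 h2
      rcases h1 with h1 | h1
      · exact hl w h1 h3
      · exact hr w h1 h3
  · rw [Complex.closure_reProdIm, closure_Ioo hlr.ne, closure_Ioo hYY.ne]
    exact ⟨⟨hz1, hz2⟩, abs_le.1 hz3⟩

/-- A function of at most doubly exponential size on the ends of a long rectangle is bounded in the
middle of it by its size on the long sides: multiply by `exp (-A' cos (θ (z - m)))`, where `m` is
the middle of the cross-section. -/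
theorem norm_le_of_long_rect {κ : ℝ} (hκ0 : 0 < κ) (hκ1 : κ < 1) {f : ℂ → ℂ}
    {l r X X₁ A L B : ℝ} (hlr : l < r) (hX : 0 < X) (hX₁ : 0 ≤ X₁) (hXX : X₁ ≤ X) (hA : 0 ≤ A)
    (hB : 1 ≤ B)
    (hL : L ≤ (1 - κ) * Real.pi / (r - l) * (X - X₁))
    (hf : DiffContOnCl ℂ f (Ioo l r ×ℂ Ioo (-X) X))
    (hl : ∀ z : ℂ, z.re = l → |z.im| ≤ X → ‖f z‖ ≤ B)
    (hr : ∀ z : ℂ, z.re = r → |z.im| ≤ X → ‖f z‖ ≤ B)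
    (hh : ∀ z : ℂ, l ≤ z.re → z.re ≤ r → |z.im| = X → ‖f z‖ ≤ Real.exp (A * Real.exp L))
    {z : ℂ} (hz1 : l ≤ z.re) (hz2 : z.re ≤ r) (hz3 : |z.im| ≤ X₁) :
    ‖f z‖ ≤ B * Real.exp (2 * A / Real.cos ((1 - κ) * Real.pi / 2)) := by
  have hp := Real.pi_pos
  set θ : ℝ := (1 - κ) * Real.pi / (r - l) with hθ
  have hθ0 : 0 < θ := div_pos (mul_pos (by linarith) hp) (by linarith)
  set k : ℝ := Real.cos ((1 - κ) * Real.pi / 2) with hk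
  have hk0 : 0 < k := Real.cos_pos_of_mem_Ioo ⟨by nlinarith, by nlinarith⟩
  set A' : ℝ := 2 * A / k * Real.exp (-(θ * X₁)) with hA'
  have hA'0 : 0 ≤ A' := by positivity
  set m : ℂ := (((l + r) / 2 : ℝ) : ℂ) with hm
  have hre : ∀ w : ℂ, (Complex.cos (θ * (w - m))).re =
      Real.cos (θ * (w.re - (l + r) / 2)) * Real.cosh (θ * w.im) := by
    intro w
    rw [re_cos]
    simp [hm]
  have hcos : ∀ w : ℂ, l ≤ w.re → w.re ≤ r → k ≤ Real.cos (θ * (w.re - (l + r) / 2)) := by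
    intro w h1 h2
    rw [← Real.cos_abs (θ * _)]
    refine Real.cos_le_cos_of_nonneg_of_le_pi (abs_nonneg _) (by nlinarith) ?_
    rw [abs_mul, abs_of_pos hθ0]
    have : |w.re - (l + r) / 2| ≤ (r - l) / 2 := abs_le.2 ⟨by linarith, by linarith⟩
    calc θ * |w.re - (l + r) / 2| ≤ θ * ((r - l) / 2) := by gcongr
      _ = _ := by rw [hθ]; have : r - l ≠ 0 := by linarith
                  field_simp
  set F : ℂ → ℂ := fun w => f w * Complex.exp (-(A' * Complex.cos (θ * (w - m)))) with hF
  have hFn : ∀ w, ‖F w‖ = ‖f w‖ * Real.exp (-(A' *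
      (Real.cos (θ * (w.re - (l + r) / 2)) * Real.cosh (θ * w.im)))) := by
    intro w
    simp only [hF]
    rw [norm_mul, Complex.norm_exp, Complex.neg_re, Complex.re_ofReal_mul, hre]
  have hmul : ∀ w : ℂ, l ≤ w.re → w.re ≤ r → ‖F w‖ ≤ ‖f w‖ := by
    intro w h1 h2
    rw [hFn]
    refine mul_le_of_le_one_right (norm_nonneg _) (Real.exp_le_one_iff.2 ?_)
    have := hk0.trans_le (hcos w h1 h2)
    have := Real.cosh_pos (θ * w.im)
    have : 0 ≤ A' * (Real.cos (θ * (w.re - (l + r) / 2)) * Real.cosh (θ * w.im)) := by positivity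
    linarith
  have hFd : DiffContOnCl ℂ F (Ioo l r ×ℂ Ioo (-X) X) := by
    refine hf.smul (Differentiable.diffContOnCl ?_)
    fun_prop
  have hFB : ‖F z‖ ≤ B := by
    refine norm_le_of_frontier_rect hlr hX hFd (fun w h1 h2 => ?_) (fun w h1 h2 => ?_)
      (fun w h1 h2 h3 => ?_) hz1 hz2 (hz3.trans hXX)
    · exact (hmul w h1.ge (by linarith)).trans (hl w h1 h2)
    · exact (hmul w (by linarith) h1.le).trans (hr w h1 h2)
    · rw [hFn]
      calc _ ≤ Real.exp (A * Real.exp L) * Real.exp (-(A * Real.exp L)) := by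
            refine mul_le_mul (hh w h1 h2 h3) (Real.exp_le_exp.2 (neg_le_neg ?_))
              (Real.exp_pos _).le (Real.exp_pos _).le
            have hcosh : Real.exp (θ * X) / 2 ≤ Real.cosh (θ * w.im) := by
              rw [← Real.cosh_abs, abs_mul, abs_of_pos hθ0, h3, Real.cosh_eq]
              have := Real.exp_pos (-(θ * X))
              linarith
            calc A * Real.exp L ≤ A * Real.exp (θ * (X - X₁)) := by gcongr
              _ = A' * (k * (Real.exp (θ * X) / 2)) := by
                  rw [hA', mul_sub, Real.exp_sub, Real.exp_neg]
                  field_simp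
              _ ≤ _ := by
                  have := (hk0.trans_le (hcos w h1 h2)).le
                  gcongr
                  exact hcos w h1 h2
        _ = 1 := by rw [← Real.exp_add]; simp
        _ ≤ B := hB
  rw [hFn] at hFB
  have h2 : A' * (Real.cos (θ * (z.re - (l + r) / 2)) * Real.cosh (θ * z.im)) ≤ 2 * A / k := by
    have hcosh : Real.cosh (θ * z.im) ≤ Real.exp (θ * X₁) := by
      have h3 : |θ * z.im| ≤ |θ * X₁| := by
        rw [abs_mul, abs_mul, abs_of_nonneg hX₁]
        gcongr
      refine (Real.cosh_le_cosh.2 h3).trans ?_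
      rw [Real.cosh_eq]
      have : Real.exp (-(θ * X₁)) ≤ Real.exp (θ * X₁) :=
        Real.exp_le_exp.2 (by have : 0 ≤ θ * X₁ := by positivity
                              linarith)
      linarith
    have := Real.cosh_pos (θ * z.im)
    calc _ ≤ A' * (1 * Real.exp (θ * X₁)) := by
          gcongr
          exact Real.cos_le_one _
      _ = _ := by
          rw [hA', one_mul, mul_assoc, ← Real.exp_add]
          simp
  calc ‖f z‖ = ‖f z‖ * Real.exp (-(A' * (Real.cos (θ * (z.re - (l + r) / 2)) *
        Real.cosh (θ * z.im)))) * Real.exp (A' * (Real.cos (θ * (z.re - (l + r) / 2)) *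
        Real.cosh (θ * z.im))) := by
        rw [mul_assoc, ← Real.exp_add]; simp
    _ ≤ _ := by gcongr

/-! ### The maximum principle in a half-plane with a rectangular pocket -/

/-- The maximum principle in the union of the half-plane `m < re z` and the rectangle
`l < re z`, `|im z| < Y`, for bounded functions: divide by `1 + ε (z - l)` to reduce to a bounded
region. -/
theorem norm_le_of_pocket {f : ℂ → ℂ} {l m Y K B : ℝ} (hlm : l < m)
    (hf : ∀ z : ℂ, l ≤ z.re → (m ≤ z.re ∨ |z.im| ≤ Y) → DifferentiableAt ℂ f z)
    (hB : ∀ z : ℂ, l ≤ z.re → (m ≤ z.re ∨ |z.im| ≤ Y) → ‖f z‖ ≤ B) (hK : 0 < K)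
    (hl : ∀ z : ℂ, z.re = l → |z.im| ≤ Y → ‖f z‖ ≤ K)
    (hh : ∀ z : ℂ, l ≤ z.re → z.re ≤ m → |z.im| = Y → ‖f z‖ ≤ K)
    (hm : ∀ z : ℂ, z.re = m → Y ≤ |z.im| → ‖f z‖ ≤ K)
    {z : ℂ} (hz1 : l < z.re) (hz2 : m < z.re ∨ |z.im| < Y) : ‖f z‖ ≤ K := by
  have hden : ∀ ε : ℝ, 0 < ε → ∀ w : ℂ, l ≤ w.re →
      1 ≤ ‖1 + ε * (w - l)‖ ∧ ε * ‖w - l‖ ≤ ‖1 + ε * (w - l)‖ := by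
    intro ε hε w hw
    have h1 : (1 + ε * (w - l) : ℂ).re = 1 + ε * (w.re - l) := by simp
    have h2 : (1 + ε * (w - l) : ℂ).im = ε * w.im := by simp
    have h3 : 0 ≤ ε * (w.re - l) := mul_nonneg hε.le (by linarith)
    constructor
    · refine le_trans ?_ (Complex.re_le_norm _)
      rw [h1]; linarith
    · have : ε * ‖w - l‖ = ‖(ε * (w - l) : ℂ)‖ := by
        rw [norm_mul, Complex.norm_real, Real.norm_of_nonneg hε.le]
      rw [this, ← sq_le_sq₀ (norm_nonneg _) (norm_nonneg _), Complex.sq_norm, Complex.sq_norm,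
        Complex.normSq_apply, Complex.normSq_apply, h1, h2]
      have h4 : (ε * (w - l) : ℂ).re = ε * (w.re - l) := by simp
      have h5 : (ε * (w - l) : ℂ).im = ε * w.im := by simp
      rw [h4, h5]
      nlinarith
  have hne : ∀ ε : ℝ, 0 < ε → ∀ w : ℂ, l ≤ w.re → (1 + ε * (w - l) : ℂ) ≠ 0 := by
    intro ε hε w hw h
    have := (hden ε hε w hw).1
    rw [h, norm_zero] at this
    linarith
  have hB0 : 0 ≤ B := (norm_nonneg _).trans (hB m (by simpa using hlm.le) (Or.inl (by simp)))
  have key : ∀ ε : ℝ, 0 < ε → ‖f z‖ ≤ K * ‖1 + ε * (z - l)‖ := by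
    intro ε hε
    obtain ⟨R, hR⟩ : ∃ R : ℝ, B / (ε * K) ≤ R ∧ z.re < l + R ∧ |z.im| < R ∧ 0 < R :=
      ⟨B / (ε * K) + |z.re - l| + |z.im| + 1, by
        have h1 := abs_nonneg (z.re - l)
        have h2 := abs_nonneg z.im
        have h3 := le_abs_self (z.re - l)
        have h4 : 0 ≤ B / (ε * K) := by positivity
        refine ⟨by linarith, by linarith, by linarith, by linarith⟩⟩
    obtain ⟨hR1, hR2, hR3, hR0⟩ := hR
    set U : Set ℂ := {w | l < w.re ∧ w.re < l + R ∧ |w.im| < R ∧ (m < w.re ∨ |w.im| < Y)} with hU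
    have hre := Complex.continuous_re
    have him := Complex.continuous_im.abs
    have hUo : IsOpen U := (isOpen_lt continuous_const hre).inter
      ((isOpen_lt hre continuous_const).inter ((isOpen_lt him continuous_const).inter
        ((isOpen_lt continuous_const hre).union (isOpen_lt him continuous_const))))
    have hcl : closure U ⊆ {w | l ≤ w.re ∧ w.re ≤ l + R ∧ |w.im| ≤ R ∧
        (m ≤ w.re ∨ |w.im| ≤ Y)} := by
      refine closure_minimal (fun w hw => ?_) ?_
      · exact ⟨hw.1.le, hw.2.1.le, hw.2.2.1.le, hw.2.2.2.imp le_of_lt le_of_lt⟩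
      · exact (isClosed_le continuous_const hre).inter
          ((isClosed_le hre continuous_const).inter ((isClosed_le him continuous_const).inter
            ((isClosed_le continuous_const hre).union (isClosed_le him continuous_const))))
    have hUb : Bornology.IsBounded U := by
      refine ((Metric.isBounded_Ioo l (l + R)).reProdIm (Metric.isBounded_Ioo (-R) R)).subset ?_
      intro w hw
      exact ⟨⟨hw.1, hw.2.1⟩, abs_lt.1 hw.2.2.1⟩
    have hd : DiffContOnCl ℂ (fun w => f w / (1 + ε * (w - l))) U := by
      refine DifferentiableOn.diffContOnCl fun w hw => ?_
      have hw' := hcl hw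
      refine DifferentiableAt.differentiableWithinAt ?_
      exact (hf w hw'.1 hw'.2.2.2).div (by fun_prop) (hne ε hε w hw'.1)
    have hres := Complex.norm_le_of_forall_mem_frontier_norm_le hUb hd (C := K) (fun w hw => ?_)
      (subset_closure (show z ∈ U from ⟨hz1, hR2, hR3, hz2⟩))
    · rw [norm_div, div_le_iff₀ (by have := (hden ε hε z hz1.le).1; linarith)] at hres
      exact hres
    · rw [hUo.frontier_eq] at hw
      obtain ⟨h1, h2, h3, h4⟩ := hcl hw.1
      have h5 : ¬ (l < w.re ∧ w.re < l + R ∧ |w.im| < R ∧ (m < w.re ∨ |w.im| < Y)) := hw.2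
      obtain ⟨h6, h7⟩ := hden ε hε w h1
      rw [norm_div, div_le_iff₀ (by linarith)]
      have hfar : R ≤ ‖w - l‖ → ‖f w‖ ≤ K * ‖1 + ε * (w - l)‖ := by
        intro hw
        refine (hB w h1 h4).trans ?_
        calc B = K * (ε * (B / (ε * K))) := by field_simp
          _ ≤ K * (ε * ‖w - l‖) := by gcongr; linarith
          _ ≤ _ := by gcongr
      have hnear : ‖f w‖ ≤ K → ‖f w‖ ≤ K * ‖1 + ε * (w - l)‖ := fun h =>
        h.trans (le_mul_of_one_le_right hK.le h6)
      by_cases ha : w.re = l + R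
      · refine hfar (le_trans ?_ (Complex.re_le_norm _))
        simp [ha]
      by_cases hb : |w.im| = R
      · refine hfar (le_trans ?_ (Complex.abs_im_le_norm _))
        simp [hb]
      by_cases hc : w.re = l
      · refine hnear (hl w hc ?_)
        rcases h4 with h4 | h4
        · linarith
        · exact h4
      have ha' := lt_of_le_of_ne h2 ha
      have hb' := lt_of_le_of_ne h3 hb
      have hc' := lt_of_le_of_ne h1 (Ne.symm hc)
      have h8 : ¬ (m < w.re ∨ |w.im| < Y) := fun h => h5 ⟨hc', ha', hb', h⟩
      push Not at h8
      rcases h4 with h4 | h4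
      · exact hnear (hm w (le_antisymm h8.1 h4) h8.2)
      · exact hnear (hh w h1 h8.1 (le_antisymm h4 h8.2))
  have hlim : Tendsto (fun ε : ℝ => K * ‖1 + ε * (z - l)‖) (𝓝[>] 0) (𝓝 K) := by
    have : Continuous fun ε : ℝ => K * ‖1 + ε * (z - l)‖ := by fun_prop
    have h := this.tendsto 0
    simp only [Complex.ofReal_zero, zero_mul, add_zero, norm_one, mul_one] at h
    exact h.mono_left nhdsWithin_le_nhds
  refine ge_of_tendsto hlim ?_
  filter_upwards [self_mem_nhdsWithin] with ε hε using key ε hε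

/-- The harmonic measure of a segment of half-length slightly less than `X`, corrected by a
multiple of `X / (z + X)` in order to be negative on the part of a thin strip outside
`|im z| < X`. -/
noncomputable def correctedPotential (κ X : ℝ) (z : ℂ) : ℂ :=
  segmentPotential ((1 - κ) * X) z - κ * (X / (z + X))

theorem re_div_add_ofReal (X : ℝ) (z : ℂ) :
    ((X : ℂ) / (z + X)).re = X * (z.re + X) / ((z.re + X) ^ 2 + z.im ^ 2) := by
  rw [Complex.div_re, Complex.normSq_apply]
  simp
  ring

theorem re_correctedPotential (κ X : ℝ) (z : ℂ) : (correctedPotential κ X z).re =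
    (segmentPotential ((1 - κ) * X) z).re -
      κ * (X * (z.re + X) / ((z.re + X) ^ 2 + z.im ^ 2)) := by
  rw [correctedPotential, Complex.sub_re, Complex.re_ofReal_mul, re_div_add_ofReal]

theorem differentiableAt_correctedPotential (κ : ℝ) {X : ℝ} (hX : 0 < X) {z : ℂ}
    (hz : 0 < z.re) : DifferentiableAt ℂ (correctedPotential κ X) z := by
  have hne : z + X ≠ 0 := fun h => by
    have := congrArg Complex.re h
    simp at this; linarith
  have h2 : DifferentiableAt ℂ (fun z : ℂ => (κ : ℂ) * (X / (z + X))) z := by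
    refine DifferentiableAt.const_mul ?_ _
    exact DifferentiableAt.fun_div (by fun_prop) (by fun_prop) hne
  exact (differentiableAt_segmentPotential _ hz).sub h2

theorem re_correctedPotential_le_one {κ X : ℝ} (hκ : 0 ≤ κ) (hX : 0 < X) {z : ℂ}
    (hz : 0 < z.re) : (correctedPotential κ X z).re ≤ 1 := by
  rw [re_correctedPotential]
  have := re_segmentPotential_le_one ((1 - κ) * X) hz
  have : 0 ≤ κ * (X * (z.re + X) / ((z.re + X) ^ 2 + z.im ^ 2)) := by positivity
  linarith

theorem re_correctedPotential_nonpos {κ X : ℝ} (hκ : 0 < κ) (hκ1 : κ ≤ 1 / 10) (hX : 0 < X) {z : ℂ}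
    (hz : 0 < z.re) (hz' : z.re ≤ κ ^ 3 * X / 4) (hi : X ≤ |z.im|) :
    (correctedPotential κ X z).re ≤ 0 := by
  rw [re_correctedPotential, sub_nonpos]
  have hp := Real.pi_gt_three
  set y : ℝ := |z.im| with hy
  have hy0 : 0 < y := by linarith
  have hh : 0 ≤ (1 - κ) * X := mul_nonneg (by linarith) hX.le
  have h1 := re_segmentPotential_le hh hz (by nlinarith)
  have hsub : κ * y ≤ y - (1 - κ) * X := by nlinarith
  have hκ3 : κ ^ 3 ≤ 1 := pow_le_one₀ hκ.le (by linarith)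
  rw [← sq_abs z.im, ← hy]
  rw [← hy] at h1
  calc _ ≤ _ := h1
    _ ≤ 2 * X * (κ ^ 3 * X / 4) / (3 * (κ * y) ^ 2) := by
        have h2 : (κ * y) ^ 2 ≤ (y - (1 - κ) * X) ^ 2 := by gcongr
        gcongr
        · nlinarith
        · nlinarith [sq_nonneg z.re]
    _ = κ * (X * X / (6 * y ^ 2)) := by field_simp; norm_num
    _ ≤ _ := by
        gcongr
        · linarith
        · have : z.re ≤ X / 4 := by nlinarith
          nlinarith

theorem le_re_correctedPotential {κ X : ℝ} (hκ : 0 ≤ κ) (hκ1 : κ ≤ 1 / 10) (hX : 0 < X) {x : ℝ}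
    (hx : 0 < x) :
    2 / Real.pi * (1 - 3 * κ) * (X / (x + X)) ≤ (correctedPotential κ X x).re := by
  rw [re_correctedPotential]
  have hp := Real.pi_pos
  have hp4 := Real.pi_le_four
  have hh : 0 ≤ (1 - κ) * X := mul_nonneg (by linarith) hX.le
  have h1 := le_re_segmentPotential hh hx
  have h2 : (1 - κ) * (X / (x + X)) ≤ (1 - κ) * X / (x + (1 - κ) * X) := by
    rw [← mul_div_assoc]
    gcongr
    · linarith [mul_nonneg hκ hX.le]
  simp only [Complex.ofReal_re, Complex.ofReal_im]
  have h3 : X * (x + X) / ((x + X) ^ 2 + 0 ^ 2) = X / (x + X) := by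
    field_simp; ring
  rw [h3]
  set r : ℝ := X / (x + X) with hr
  have hr0 : 0 ≤ r := by positivity
  have h4 : 2 / Real.pi * ((1 - κ) * r) ≤
      2 / Real.pi * ((1 - κ) * X / (x + (1 - κ) * X)) := by gcongr
  have h5 : κ * r ≤ 2 / Real.pi * (2 * κ * r) := by
    rw [div_mul_eq_mul_div, le_div_iff₀ hp]
    nlinarith [mul_nonneg hκ hr0]
  have h6 : 2 / Real.pi * (1 - 3 * κ) * r = 2 / Real.pi * ((1 - κ) * r) -
    2 / Real.pi * (2 * κ * r) := by ring
  linarith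

/-! ### The lower bound on a short segment to the left of the line `re s = 1` -/

/-- The factor `(s - z) / (s - z + H)`, small near `z` and of size at most one to the right of it.
Near the corner `z` of the pocket it compensates the bound `1 / b` that holds there for the function
to be estimated. -/
noncomputable def dampingFactor (H : ℝ) (z s : ℂ) : ℂ := (s - z) / (s - z + H)

theorem norm_add_ofReal_ge {H : ℝ} (hH : 0 ≤ H) {u : ℂ} (hu : 0 ≤ u.re) :
    ‖u‖ ≤ ‖u + H‖ ∧ H ≤ ‖u + H‖ := by
  constructor
  · rw [← sq_le_sq₀ (norm_nonneg _) (norm_nonneg _), Complex.sq_norm, Complex.sq_norm,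
      Complex.normSq_apply, Complex.normSq_apply]
    simp
    nlinarith
  · refine le_trans ?_ (Complex.re_le_norm _)
    simp; linarith

theorem differentiableAt_dampingFactor {H : ℝ} (hH : 0 < H) {z s : ℂ} (h : z.re ≤ s.re) :
    DifferentiableAt ℂ (dampingFactor H z) s := by
  have hne : s - z + H ≠ 0 := fun h0 => by
    have := congrArg Complex.re h0
    simp at this; linarith
  exact DifferentiableAt.fun_div (by fun_prop) (by fun_prop) hne

theorem norm_dampingFactor_le {H : ℝ} (hH : 0 < H) {z s : ℂ} (h : z.re ≤ s.re) :
    ‖dampingFactor H z s‖ ≤ 1 ∧ ‖dampingFactor H z s‖ ≤ ‖s - z‖ / H := by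
  obtain ⟨h1, h2⟩ := norm_add_ofReal_ge hH.le (u := s - z) (by simpa using h)
  rw [dampingFactor, norm_div]
  exact ⟨div_le_one_of_le₀ h1 (norm_nonneg _), by gcongr⟩

theorem le_norm_dampingFactor {H X : ℝ} (hH : 0 < H) (hX : H / 5 ≤ X) {z s : ℂ}
    (hzs : z.re ≤ s.re) (h : X ≤ ‖s - z‖) : 1 / 6 ≤ ‖dampingFactor H z s‖ := by
  rw [dampingFactor, norm_div]
  have h1 : ‖s - z + H‖ ≤ ‖s - z‖ + H := (norm_add_le _ _).trans_eq (by simp [abs_of_pos hH])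
  have h2 : 0 < ‖s - z + H‖ :=
    hH.trans_le (norm_add_ofReal_ge hH.le (u := s - z) (by simpa using hzs)).2
  rw [le_div_iff₀ h2]
  linarith

set_option maxHeartbeats 1000000 in
/-- The maximum principle part: on the line `re s = 1 + w` the function
`g(s) (damping) exp (M G(s))`, where `G` is the corrected potential of the segment, is at most
`E (1 + 80 / (κ ^ 3 H))` if `|im s| < X₁`, and at most `‖g s‖` otherwise because `re G ≤ 0` there. -/
theorem norm_mul_exp_potential_le {κ H X₁ X a b L E w δ : ℝ} {g : ℂ → ℂ} {c : ℕ → ℂ} {q Y : ℝ}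
    (hκ : 0 < κ) (hκ1 : κ ≤ 1 / 10) (hH : 0 < H) (hX₁ : H / 5 ≤ X₁) (hXX : X₁ < X)
    (hXY : X < Y) (ha : 0 ≤ a) (haL : a * L ≤ H) (hb : b * L = κ * H) (hL : 80 / κ ^ 3 ≤ L)
    (hw : w = κ ^ 3 * X₁ / 8) (hE : 1 ≤ E) (hδ : 0 < δ) (hδ1 : δ ≤ 1)
    (hq : 1 / 2 ≤ q) (hc : ∀ n, ‖c n‖ ≤ 1)
    (hg : DifferentiableOn ℂ g {s | 1 < s.re ∨ |s.im| < Y})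
    (hgs : ∀ s : ℂ, 1 < s.re → g s = progressionSeries c q s)
    (hleft : ∀ s : ℂ, s.re = 1 - a → |s.im| ≤ X → ‖g s‖ ≤ δ)
    (hin : ∀ s : ℂ, 1 - a ≤ s.re → s.re ≤ 1 + b → |s.im| ≤ X₁ → ‖g s‖ ≤ (1 + 2 / b) * E)
    (s : ℂ) (hs : s.re = 1 + w) :
    ‖g s * (dampingFactor H ⟨1 - a, X₁⟩ s * dampingFactor H ⟨1 - a, -X₁⟩ s) *
      Complex.exp ((-Real.log δ : ℝ) * correctedPotential κ X₁ (s - (1 - w : ℝ)))‖ ≤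
      if |s.im| < X₁ then E * (1 + 80 / κ ^ 3 / H) else ‖g s‖ := by
  have hκ3 : 0 < κ ^ 3 := by positivity
  have hX₁0 : 0 < X₁ := by linarith
  have hw0 : 0 < w := by rw [hw]; positivity
  have hL0 : 0 < L := lt_of_lt_of_le (by positivity) hL
  have hb0 : 0 < b := by
    have : 0 < b * L := by rw [hb]; positivity
    exact pos_of_mul_pos_left this hL0.le
  have hLκ : 80 ≤ L * κ ^ 3 := by rwa [div_le_iff₀ hκ3] at hL
  have hκ31 : κ ^ 3 ≤ 1 / 1000 := by
    calc κ ^ 3 ≤ (1 / 10) ^ 3 := by gcongr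
      _ = _ := by norm_num
  have haw : a ≤ w / 2 := by
    have h1 : a * 80 ≤ a * (L * κ ^ 3) := by gcongr
    have h2 : a * L * κ ^ 3 ≤ H * κ ^ 3 := by gcongr
    rw [hw]; nlinarith
  set M : ℝ := -Real.log δ with hM
  have hM0 : 0 ≤ M := by rw [hM]; linarith [Real.log_nonpos hδ.le hδ1]
  set D : ℂ → ℂ := fun s => dampingFactor H ⟨1 - a, X₁⟩ s * dampingFactor H ⟨1 - a, -X₁⟩ s with hD
  set p : ℂ → ℂ := fun s => correctedPotential κ X₁ (s - (1 - w : ℝ)) with hp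
  set F : ℂ → ℂ := fun s => g s * D s * Complex.exp (M * p s) with hF
  have hFn : ∀ s, ‖F s‖ = ‖g s‖ * ‖D s‖ * Real.exp (M * (p s).re) := by
    intro s
    simp only [hF]
    rw [norm_mul, norm_mul, Complex.norm_exp, Complex.re_ofReal_mul]
  have hD1 : ∀ s : ℂ, 1 - a ≤ s.re → ‖D s‖ ≤ 1 := by
    intro s hs
    simp only [hD]
    rw [norm_mul]
    exact mul_le_one₀ (norm_dampingFactor_le hH hs).1 (norm_nonneg _)
      (norm_dampingFactor_le hH hs).1
  have hDx : ∀ s : ℂ, 1 - a ≤ s.re → |s.im| = X₁ → ‖D s‖ ≤ (s.re - (1 - a)) / H := by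
    intro s hs hi
    simp only [hD]
    rw [norm_mul]
    have h1 := norm_dampingFactor_le hH (z := ⟨1 - a, X₁⟩) (s := s) hs
    have h2 := norm_dampingFactor_le hH (z := ⟨1 - a, -X₁⟩) (s := s) hs
    rcases abs_eq hX₁0.le |>.1 hi with h | h
    · have e : s - ⟨1 - a, X₁⟩ = ((s.re - (1 - a) : ℝ) : ℂ) := by
        apply Complex.ext <;> simp [h]
      rw [e, Complex.norm_real, Real.norm_of_nonneg (by linarith)] at h1
      exact (mul_le_of_le_one_right (norm_nonneg _) h2.1).trans h1.2
    · have e : s - ⟨1 - a, -X₁⟩ = ((s.re - (1 - a) : ℝ) : ℂ) := by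
        apply Complex.ext <;> simp [h]
      rw [e, Complex.norm_real, Real.norm_of_nonneg (by linarith)] at h2
      exact (mul_le_of_le_one_left (norm_nonneg _) h1.1).trans h2.2
  have hpre : ∀ s : ℂ, 1 - a ≤ s.re → 0 < (s - (1 - w : ℝ) : ℂ).re := by
    intro s hs
    simp; linarith
  have hp1 : ∀ s : ℂ, 1 - a ≤ s.re → (p s).re ≤ 1 := fun s hs =>
    re_correctedPotential_le_one hκ.le hX₁0 (hpre s hs)
  have hp0 : ∀ s : ℂ, 1 - a ≤ s.re → s.re ≤ 1 + w → X₁ ≤ |s.im| → (p s).re ≤ 0 := by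
    intro s hs hs' hi
    refine re_correctedPotential_nonpos hκ hκ1 hX₁0 (hpre s hs) ?_ (by simpa using hi)
    simp; rw [hw] at hs' ⊢; linarith
  have hFg : ∀ s : ℂ, 1 - a ≤ s.re → s.re ≤ 1 + w → X₁ ≤ |s.im| → ‖F s‖ ≤ ‖g s‖ * ‖D s‖ := by
    intro s hs hs' hi
    rw [hFn]
    refine mul_le_of_le_one_right (by positivity) (Real.exp_le_one_iff.2 ?_)
    exact mul_nonpos_of_nonneg_of_nonpos hM0 (hp0 s hs hs' hi)
  have hgw : ∀ (s : ℂ) (x : ℝ), 0 < x → 1 + x ≤ s.re → ‖g s‖ ≤ 1 + 2 / x := by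
    intro s x hx hs
    rw [hgs s (by linarith)]
    exact norm_progressionSeries_le hq hc hx hs
  have hgo : IsOpen {s : ℂ | 1 < s.re ∨ |s.im| < Y} :=
    (isOpen_lt continuous_const Complex.continuous_re).union
      (isOpen_lt Complex.continuous_im.abs continuous_const)
  have hFd : ∀ z : ℂ, 1 - a ≤ z.re → (1 + w ≤ z.re ∨ |z.im| ≤ X₁) → DifferentiableAt ℂ F z := by
    intro z hz hz'
    have h1 : DifferentiableAt ℂ g z := hg.differentiableAt (hgo.mem_nhds (hz'.imp
      (fun h => by linarith) (fun h => by linarith)))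
    have h2 : DifferentiableAt ℂ D z := (differentiableAt_dampingFactor hH hz).mul
      (differentiableAt_dampingFactor hH hz)
    have h3 : DifferentiableAt ℂ p z :=
      DifferentiableAt.comp (g := correctedPotential κ X₁) (f := fun s : ℂ => s - (1 - w : ℝ)) z
        (differentiableAt_correctedPotential κ hX₁0 (hpre z hz)) (by fun_prop)
    exact (h1.mul h2).mul (h3.const_mul _).cexp
  have hN : 0 < 80 / κ ^ 3 := by positivity
  set K : ℝ := E * (1 + 80 / κ ^ 3 / H) with hK
  have hK1 : E ≤ K := by
    rw [hK]; exact le_mul_of_one_le_right (by linarith) (by have : 0 ≤ 80 / κ ^ 3 / H := by positivity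
                                                            linarith)
  have hKx : ∀ x : ℝ, x ≤ 80 / κ ^ 3 → 1 + x / H ≤ K := by
    intro x hx
    rw [hK]
    have h1 : 1 + x / H ≤ 1 + 80 / κ ^ 3 / H := by gcongr
    have h2 : 0 ≤ 80 / κ ^ 3 / H := by positivity
    nlinarith
  -- some bound, however large, is needed for the maximum principle
  obtain ⟨B, hB⟩ : ∃ B, ∀ z : ℂ, 1 - a ≤ z.re → (1 + w ≤ z.re ∨ |z.im| ≤ X₁) → ‖F z‖ ≤ B := by
    have hcomp : IsCompact (Icc (1 - a) (1 + w) ×ℂ Icc (-X₁) X₁) :=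
      isCompact_Icc.reProdIm isCompact_Icc
    obtain ⟨B₁, hB₁⟩ := hcomp.exists_bound_of_continuousOn (f := F) (fun z hz =>
      (hFd z hz.1.1 (Or.inr (abs_le.2 hz.2))).continuousAt.continuousWithinAt)
    refine ⟨max B₁ ((1 + 2 / w) * 1 * Real.exp (M * 1)), fun z hz hz' => ?_⟩
    by_cases h : 1 + w ≤ z.re
    · refine le_max_of_le_right ?_
      rw [hFn]
      gcongr
      · exact hgw z w hw0 h
      · exact hD1 z hz
      · exact hp1 z hz
    · refine le_max_of_le_left (hB₁ z ⟨⟨hz, by linarith⟩, abs_le.1 ?_⟩)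
      exact hz'.resolve_left h
  change ‖F s‖ ≤ _
  split_ifs with hi
  · refine norm_le_of_pocket (f := F) (l := 1 - a) (m := 1 + w) (Y := X₁) (by linarith) hFd hB
      (by linarith) ?_ ?_ ?_ (by linarith) (Or.inr hi)
    · intro z hz hzi
      rw [hFn]
      have h1 := hleft z hz (hzi.trans hXX.le)
      calc _ ≤ δ * 1 * Real.exp (M * 1) := by
            gcongr
            · exact hD1 z hz.ge
            · exact hp1 z hz.ge
        _ = 1 := by rw [hM, mul_one, mul_one, Real.exp_neg, Real.exp_log hδ, mul_inv_cancel₀ hδ.ne']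
        _ ≤ K := by linarith
    · intro z hz1 hz2 hzi
      refine (hFg z hz1 hz2 hzi.ge).trans ?_
      have hx := hDx z hz1 hzi
      have hx1 := hD1 z hz1
      by_cases hzb : z.re ≤ 1 + b
      · have h1 := hin z hz1 hzb hzi.le
        have h2 : ‖D z‖ ≤ 2 / L := by
          refine hx.trans ?_
          rw [div_le_div_iff₀ hH hL0]
          nlinarith
        calc _ ≤ (1 + 2 / b) * E * ‖D z‖ := by gcongr
          _ = E * (‖D z‖ + 2 / b * ‖D z‖) := by ring
          _ ≤ E * (1 + 2 / b * (2 / L)) := by gcongr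
          _ = E * (1 + 4 / κ / H) := by
              rw [div_mul_div_comm, hb]; field_simp; norm_num
          _ ≤ E * (1 + 80 / κ ^ 3 / H) := by
              gcongr
              · norm_num
              · nlinarith [sq_nonneg κ]
      · push Not at hzb
        set x : ℝ := z.re - 1 with hx'
        have hx0 : 0 < x := by linarith
        have h1 := hgw z x hx0 (by linarith)
        have hax : a ≤ 1 / κ * x := by
          rw [div_mul_eq_mul_div, le_div_iff₀ hκ]
          have : a * κ * L ≤ b * L := by rw [hb]; nlinarith
          have := le_of_mul_le_mul_right this hL0
          linarith
        have h2 : ‖D z‖ ≤ (1 + 1 / κ) * x / H := by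
          refine hx.trans ?_
          gcongr
          linarith
        calc _ ≤ (1 + 2 / x) * ‖D z‖ := by gcongr
          _ = ‖D z‖ + 2 / x * ‖D z‖ := by ring
          _ ≤ 1 + 2 / x * ((1 + 1 / κ) * x / H) := by gcongr
          _ = 1 + 2 * (1 + 1 / κ) / H := by field_simp
          _ ≤ K := by
              refine hKx _ ?_
              rw [le_div_iff₀ hκ3]
              have : 2 * (1 + 1 / κ) * κ ^ 3 = 2 * κ ^ 3 + 2 * κ ^ 2 := by field_simp
              nlinarith
    · intro z hz hzi
      refine (hFg z (by linarith) hz.le hzi).trans ?_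
      have h1 := hgw z w hw0 hz.ge
      calc _ ≤ (1 + 2 / w) * 1 := by
            gcongr
            exact hD1 z (by linarith)
        _ = 1 + 2 / w := by ring
        _ ≤ 1 + 80 / κ ^ 3 / H := by
            rw [hw, div_div_eq_mul_div, div_div, add_le_add_iff_left,
              div_le_div_iff₀ (by positivity) (by positivity)]
            nlinarith
        _ ≤ K := hKx _ le_rfl
  · push Not at hi
    refine (hFg s (by linarith) hs.le hi).trans ?_
    exact mul_le_of_le_one_right (norm_nonneg _) (hD1 s (by linarith))

theorem poissonAverage_indicator_le {d X : ℝ} (hd : 1 / 2 ≤ d) (hX : 0 < X) :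
    poissonAverage d (fun y => if |y| < X then 1 else 0) ≤ min 1 (2 * X) := by
  have hd0 : 0 < d := by linarith
  have hp := Real.pi_gt_three
  have hmeas : MeasurableSet {y : ℝ | |y| < X} :=
    measurableSet_lt continuous_abs.measurable measurable_const
  have e : (fun y : ℝ => (d ^ 2 + y ^ 2)⁻¹ * (if |y| < X then (1:ℝ) else 0)) =
      indicator {y : ℝ | |y| < X} fun y => (d ^ 2 + y ^ 2)⁻¹ := by
    ext y
    simp only [indicator, mem_ofPred_eq]
    split_ifs <;> simp
  rw [poissonAverage, e, integral_indicator hmeas]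
  have hset : {y : ℝ | |y| < X} = Ioo (-X) X := by
    ext y; simp [abs_lt]
  refine le_min ?_ ?_
  · calc _ ≤ d / Real.pi * ∫ y : ℝ, (d ^ 2 + y ^ 2)⁻¹ := by
          refine mul_le_mul_of_nonneg_left (setIntegral_le_integral
            (integrable_univ_inv_sq_add_sq hd0) (ae_of_all _ fun y => ?_)) (by positivity)
          change 0 ≤ (d ^ 2 + y ^ 2)⁻¹
          positivity
      _ = 1 := by
          rw [integral_univ_inv_sq_add_sq hd0]
          field_simp
  · calc _ ≤ d / Real.pi * ∫ y in {y : ℝ | |y| < X}, (d ^ 2)⁻¹ := by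
          gcongr ?_ * ?_
          refine setIntegral_mono (integrable_univ_inv_sq_add_sq hd0).integrableOn ?_ fun y => ?_
          · rw [hset]; exact integrableOn_const (by simp)
          · exact inv_anti₀ (by positivity) (by nlinarith [sq_nonneg y])
      _ = 2 * X * (Real.pi * d)⁻¹ := by
          rw [hset, setIntegral_const]
          simp only [measureReal_def, Real.volume_Ioo, smul_eq_mul]
          rw [ENNReal.toReal_ofReal (by linarith)]
          field_simp; ring
      _ ≤ 2 * X * 1 := by
          gcongr
          exact inv_le_one_of_one_le₀ (by nlinarith)
      _ = _ := by ring

theorem boundary_constant_le {H X E N K w : ℝ} (hH : 0 < H) (hXH : X ≤ H) (hX : 0 < X)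
    (hE : 1 ≤ E) (hN : 0 ≤ N) (hK : K = E * (1 + N * (1 / H))) (hw : 2 / w ≤ N / H) :
    K ^ 2 * min 1 (2 * X) + 10 * (1 + 2 / w) ≤ 14 * E ^ 2 * (1 + N) ^ 2 * (1 + 1 / H) := by
  set z : ℝ := 1 / H with hz
  have hz0 : 0 < z := by positivity
  have h1 : 1 + N * z ≤ (1 + N) * (1 + z) := by nlinarith
  have h2 : K ^ 2 ≤ E ^ 2 * ((1 + N) ^ 2 * (1 + z) ^ 2) := by
    rw [hK, mul_pow, ← mul_pow (1 + N)]
    gcongr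
  have h3 : (1 + z) * min 1 (2 * X) ≤ 4 := by
    have a1 : min 1 (2 * X) ≤ 1 := min_le_left _ _
    have a2 : min 1 (2 * X) ≤ 2 * H := (min_le_right _ _).trans (by linarith)
    have a3 : z * H = 1 := by rw [hz]; field_simp
    have a4 : z * min 1 (2 * X) ≤ z * (2 * H) := by gcongr
    linarith
  have h4 : 2 / w ≤ N * z := by rw [hz, mul_one_div]; exact hw
  have h0 : 0 ≤ min 1 (2 * X) := le_min (by norm_num) (by linarith)
  have h5 : 1 ≤ E ^ 2 := one_le_pow₀ hE
  have h6 : 1 + N ≤ (1 + N) ^ 2 := le_self_pow₀ (by linarith) (by norm_num)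
  calc _ ≤ E ^ 2 * ((1 + N) ^ 2 * (1 + z) ^ 2) * min 1 (2 * X) + 10 * ((1 + N) * (1 + z)) := by
        gcongr
        linarith
    _ = E ^ 2 * (1 + N) ^ 2 * (1 + z) * ((1 + z) * min 1 (2 * X)) +
        10 * (1 * (1 + N) * (1 + z)) := by ring
    _ ≤ E ^ 2 * (1 + N) ^ 2 * (1 + z) * 4 + 10 * (E ^ 2 * (1 + N) ^ 2 * (1 + z)) := by gcongr
    _ = _ := by ring

set_option maxHeartbeats 1000000 in
/-- The lower bound for the size `δ` of `g` on the segment `re s = 1 - a`, `|im s| ≤ X`: the two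
constant principle in a half-plane with a pocket, where the size on the line `re s = 1 + w` is
measured in mean square. -/
theorem exp_neg_le_of_norm_le {κ A c₁ : ℝ} (hκ : 0 < κ) (hκ1 : κ ≤ 1 / 10) (hA : 0 ≤ A)
    (hc₁ : 0 < c₁) : ∃ C : ℝ, 1 ≤ C ∧ ∀ {H X₁ X a b L d δ q Y : ℝ} {g : ℂ → ℂ} {c : ℕ → ℂ},
    0 < H → H / 5 ≤ X₁ → X₁ ≤ H → X₁ < X → X < Y → 0 ≤ a → a * L ≤ H → b * L = κ * H →
    80 / κ ^ 3 ≤ L → (a + b) * L ≤ (1 - κ) * Real.pi * (X - X₁) → 1 / 2 ≤ d →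
    0 < δ → δ ≤ 1 → 1 / 2 ≤ q → (∀ n, ‖c n‖ ≤ 1) →
    DifferentiableOn ℂ g {s | 1 < s.re ∨ |s.im| < Y} →
    (∀ s : ℂ, 1 < s.re → g s = progressionSeries c q s) →
    (∀ x : ℝ, 1 + d ≤ x → c₁ ≤ ‖g x‖) →
    (∀ s : ℂ, s.re = 1 - a → |s.im| ≤ X → ‖g s‖ ≤ δ) →
    (∀ s : ℂ, 1 - a ≤ s.re → s.re ≤ 1 + b → |s.im| = X → ‖g s‖ ≤ Real.exp (A * Real.exp L)) →
    Real.exp (-(Real.pi / (4 * (1 - 3 * κ)) * (d / X₁ + 2) * Real.log (C * (1 + 1 / H)))) ≤ δ := by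
  have hpi := Real.pi_pos
  have hκ3 : 0 < κ ^ 3 := by positivity
  set E : ℝ := Real.exp (2 * A / Real.cos ((1 - κ) * Real.pi / 2)) with hE
  have hk0 : 0 < Real.cos ((1 - κ) * Real.pi / 2) :=
    Real.cos_pos_of_mem_Ioo ⟨by nlinarith, by nlinarith⟩
  have hE1 : 1 ≤ E := Real.one_le_exp (by positivity)
  set N : ℝ := 80 / κ ^ 3 with hN
  have hN0 : 0 < N := by positivity
  set C : ℝ := 1 + 1296 / c₁ ^ 2 * (14 * E ^ 2 * (1 + N) ^ 2) with hC
  refine ⟨C, by rw [hC]; have : 0 ≤ 1296 / c₁ ^ 2 * (14 * E ^ 2 * (1 + N) ^ 2) := by positivity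
                linarith, ?_⟩
  intro H X₁ X a b L d δ q Y g c hH hX₁ hX₁H hXX hXY ha haL hb hL hchan hd hδ hδ1 hq hc hg hgs hlow
    hleft hup
  have hX₁0 : 0 < X₁ := by linarith
  have hL0 : 0 < L := lt_of_lt_of_le (by positivity) hL
  have hb0 : 0 < b := by
    have : 0 < b * L := by rw [hb]; positivity
    exact pos_of_mul_pos_left this hL0.le
  have hgo : IsOpen {s : ℂ | 1 < s.re ∨ |s.im| < Y} :=
    (isOpen_lt continuous_const Complex.continuous_re).union
      (isOpen_lt Complex.continuous_im.abs continuous_const)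
  have hin : ∀ s : ℂ, 1 - a ≤ s.re → s.re ≤ 1 + b → |s.im| ≤ X₁ → ‖g s‖ ≤ (1 + 2 / b) * E := by
    intro s h1 h2 h3
    have h2b : 0 ≤ 2 / b := by positivity
    refine norm_le_of_long_rect hκ (by linarith) (l := 1 - a) (r := 1 + b) (X := X) (X₁ := X₁)
      (L := L) (by linarith) (by linarith) hX₁0.le hXX.le hA (by linarith) ?_ ?_ ?_ ?_ ?_ h1 h2 h3
    · rw [div_mul_eq_mul_div, le_div_iff₀ (by linarith)]
      linarith
    · refine (hg.mono fun s hs => Or.inr ?_).diffContOnCl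
      rw [Complex.closure_reProdIm, closure_Ioo (by linarith), closure_Ioo (by linarith)] at hs
      exact (abs_le.2 hs.2).trans_lt hXY
    · intro z hz hzi
      have := hleft z hz hzi
      linarith
    · intro z hz hzi
      rw [hgs z (by linarith)]
      exact norm_progressionSeries_le hq hc hb0 hz.ge
    · exact fun z hz1 hz2 hzi => hup z hz1 hz2 hzi
  set w : ℝ := κ ^ 3 * X₁ / 8 with hw
  have hw0 : 0 < w := by positivity
  have key := norm_mul_exp_potential_le hκ hκ1 hH hX₁ hXX hXY ha haL hb hL hw hE1 hδ hδ1 hq hc hg hgs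
    hleft hin
  set M : ℝ := -Real.log δ with hM
  have hM0 : 0 ≤ M := by rw [hM]; linarith [Real.log_nonpos hδ.le hδ1]
  set F : ℂ → ℂ := fun s => g s * (dampingFactor H ⟨1 - a, X₁⟩ s * dampingFactor H ⟨1 - a, -X₁⟩ s) *
      Complex.exp (M * correctedPotential κ X₁ (s - (1 - w : ℝ))) with hF
  have hpre : ∀ s : ℂ, 1 < s.re → 0 < (s - (1 - w : ℝ) : ℂ).re := by
    intro s hs
    simp; linarith
  have hFd : ∀ z : ℂ, 1 < z.re → DifferentiableAt ℂ F z := by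
    intro z hz
    have hz' : 1 - a ≤ z.re := by linarith
    have h1 : DifferentiableAt ℂ g z := hg.differentiableAt (hgo.mem_nhds (Or.inl hz))
    have h2 := (differentiableAt_dampingFactor hH (z := ⟨1 - a, X₁⟩) (s := z) hz').mul
      (differentiableAt_dampingFactor hH (z := ⟨1 - a, -X₁⟩) (s := z) hz')
    have h3 : DifferentiableAt ℂ (fun s : ℂ => correctedPotential κ X₁ (s - (1 - w : ℝ))) z :=
      DifferentiableAt.comp (g := correctedPotential κ X₁) (f := fun s : ℂ => s - (1 - w : ℝ)) z
        (differentiableAt_correctedPotential κ hX₁0 (hpre z hz)) (by fun_prop)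
    exact (h1.mul h2).mul (h3.const_mul _).cexp
  have hgw : ∀ s : ℂ, 1 + w ≤ s.re → ‖g s‖ ≤ 1 + 2 / w := by
    intro s hs
    rw [hgs s (by linarith)]
    exact norm_progressionSeries_le hq hc hw0 hs
  have hFB : ∀ z : ℂ, 1 + w ≤ z.re → ‖F z‖ ≤ (1 + 2 / w) * (1 * 1) * Real.exp (M * 1) := by
    intro z hz
    have hz' : 1 - a ≤ z.re := by linarith
    simp only [hF]
    rw [norm_mul, norm_mul, norm_mul, Complex.norm_exp, Complex.re_ofReal_mul]
    gcongr
    · exact hgw z hz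
    · exact (norm_dampingFactor_le hH hz').1
    · exact (norm_dampingFactor_le hH hz').1
    · exact re_correctedPotential_le_one hκ.le hX₁0 (hpre z (by linarith))
  have hd0 : 0 < d := by linarith
  -- the Poisson formula is applied to the square of `F`, so that the mean square of `g` enters; this
  -- is why twice the harmonic measure appears below
  have hpoi := norm_le_poissonAverage (f := fun z => F z ^ 2) (a := 1 + w) hd0
    (B := ((1 + 2 / w) * (1 * 1) * Real.exp (M * 1)) ^ 2)
    (fun z hz => ((hFd z (by have : 1 + w ≤ z.re := hz
                             linarith)).continuousAt.pow 2).continuousWithinAt)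
    (fun z hz => ((hFd z (by have : 1 + w < z.re := hz
                             linarith)).pow 2).differentiableWithinAt)
    (fun z hz => by
      rw [norm_pow]
      exact pow_le_pow_left₀ (norm_nonneg _) (hFB z hz) 2)
  set K : ℝ := E * (1 + 80 / κ ^ 3 / H) with hK
  set v : ℝ → ℂ := fun y => ((1 + w : ℝ) : ℂ) + y * Complex.I with hv
  have hvre : ∀ y, (v y).re = 1 + w := fun y => by simp [hv]
  have hvim : ∀ y, (v y).im = y := fun y => by simp [hv]
  have hvc : Continuous v := by simp only [hv]; fun_prop
  have hFc : Continuous fun y => ‖F (v y) ^ 2‖ := by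
    refine Continuous.norm (Continuous.pow (continuous_iff_continuousAt.2 fun y => ?_) 2)
    exact ContinuousAt.comp (f := v) (hFd (v y) (by rw [hvre]; linarith)).continuousAt
      hvc.continuousAt
  have hgc : Continuous fun y => ‖g (v y)‖ ^ 2 := by
    refine Continuous.pow (Continuous.norm (continuous_iff_continuousAt.2 fun y => ?_)) 2
    exact ContinuousAt.comp (f := v) (hg.differentiableAt (hgo.mem_nhds
      (Or.inl (by rw [hvre]; linarith)))).continuousAt hvc.continuousAt
  have hmeas : MeasurableSet {y : ℝ | |y| < X₁} :=
    measurableSet_lt continuous_abs.measurable measurable_const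
  have hi1 : Integrable fun y : ℝ => (d ^ 2 + y ^ 2)⁻¹ * ‖F (v y) ^ 2‖ :=
    integrable_poisson_mul hd0 hFc.aestronglyMeasurable
      (B := ((1 + 2 / w) * (1 * 1) * Real.exp (M * 1)) ^ 2) fun y => by
        rw [abs_of_nonneg (norm_nonneg _), norm_pow]
        exact pow_le_pow_left₀ (norm_nonneg _) (hFB _ (hvre y).ge) 2
  have hi2 : Integrable fun y : ℝ => (d ^ 2 + y ^ 2)⁻¹ * ‖g (v y)‖ ^ 2 :=
    integrable_poisson_mul hd0 hgc.aestronglyMeasurable (B := (1 + 2 / w) ^ 2) fun y => by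
        rw [abs_of_nonneg (by positivity)]
        exact pow_le_pow_left₀ (norm_nonneg _) (hgw _ (hvre y).ge) 2
  have hi3 : Integrable fun y : ℝ => (d ^ 2 + y ^ 2)⁻¹ * (if |y| < X₁ then (1:ℝ) else 0) :=
    integrable_poisson_mul hd0 (Measurable.ite hmeas measurable_const
      measurable_const).aestronglyMeasurable (B := 1) fun y => by split_ifs <;> simp
  have hsum : poissonAverage d (fun y => ‖F (v y) ^ 2‖) ≤
      K ^ 2 * min 1 (2 * X₁) + 10 * (1 + 2 / w) := by
    have h1 := poissonAverage_indicator_le hd hX₁0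
    have h2 := poissonAverage_sq_progressionSeries_le hq hc hw0 hd
    have h3 : (fun y : ℝ => ‖progressionSeries c q ((1 + w : ℝ) + y * Complex.I)‖ ^ 2) =
        fun y => ‖g (v y)‖ ^ 2 := by
      ext y
      rw [hgs (v y) (by rw [hvre]; linarith)]
    rw [h3] at h2
    refine le_trans ?_ (add_le_add (mul_le_mul_of_nonneg_left h1 (sq_nonneg K)) h2)
    rw [poissonAverage, poissonAverage, poissonAverage, mul_left_comm, ← mul_add,
      ← integral_const_mul (K ^ 2), ← integral_add (hi3.const_mul _) hi2]
    refine mul_le_mul_of_nonneg_left (integral_mono hi1 ((hi3.const_mul _).add hi2) fun y => ?_)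
      (by positivity)
    have h4 := key (v y) (hvre y)
    rw [hvim] at h4
    change ‖F (v y)‖ ≤ _ at h4
    have h5 : 0 ≤ (d ^ 2 + y ^ 2)⁻¹ := by positivity
    change (d ^ 2 + y ^ 2)⁻¹ * ‖F (v y) ^ 2‖ ≤
      K ^ 2 * ((d ^ 2 + y ^ 2)⁻¹ * (if |y| < X₁ then (1:ℝ) else 0)) +
        (d ^ 2 + y ^ 2)⁻¹ * ‖g (v y)‖ ^ 2
    rw [norm_pow]
    have h6 : ‖F (v y)‖ ^ 2 ≤ K ^ 2 * (if |y| < X₁ then (1:ℝ) else 0) + ‖g (v y)‖ ^ 2 := by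
      split_ifs at h4 ⊢
      · have := pow_le_pow_left₀ (norm_nonneg _) h4 2
        have := sq_nonneg ‖g (v y)‖
        linarith
      · have := pow_le_pow_left₀ (norm_nonneg _) h4 2
        linarith
    calc _ ≤ (d ^ 2 + y ^ 2)⁻¹ *
          (K ^ 2 * (if |y| < X₁ then (1:ℝ) else 0) + ‖g (v y)‖ ^ 2) := by gcongr
      _ = _ := by ring
  have hupper : ‖F (1 + w + d : ℝ)‖ ^ 2 ≤ 14 * E ^ 2 * (1 + N) ^ 2 * (1 + 1 / H) := by
    rw [← norm_pow]
    refine hpoi.trans (hsum.trans ?_)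
    exact boundary_constant_le hH hX₁H hX₁0 hE1 hN0.le (by rw [hK, hN]; ring) (by
      rw [hw, hN, div_div_eq_mul_div, div_div, div_le_div_iff₀ (by positivity) (by positivity)]
      nlinarith)
  have hs0 : (1 + w + d - (1 - w) : ℝ) = d + 2 * w := by ring
  have hpot : 2 / Real.pi * (1 - 3 * κ) * (X₁ / (d + 2 * X₁)) ≤
      (correctedPotential κ X₁ (d + 2 * w : ℝ)).re := by
    refine le_trans ?_ (le_re_correctedPotential hκ.le hκ1 hX₁0 (by linarith))
    have h1 : 0 ≤ 1 - 3 * κ := by linarith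
    have h2 : 2 * w ≤ X₁ := by
      have : κ ^ 3 ≤ 1 := pow_le_one₀ hκ.le (by linarith)
      rw [hw]; nlinarith
    gcongr ?_ * (_ / ?_)
    linarith
  have hlower : c₁ * (1 / 6 * (1 / 6)) * Real.exp (M *
      (2 / Real.pi * (1 - 3 * κ) * (X₁ / (d + 2 * X₁)))) ≤ ‖F (1 + w + d : ℝ)‖ := by
    simp only [hF]
    rw [← Complex.ofReal_sub, hs0, norm_mul, norm_mul, norm_mul, Complex.norm_exp,
      Complex.re_ofReal_mul]
    gcongr
    · exact hlow _ (by linarith)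
    · refine le_norm_dampingFactor hH hX₁ ?_ (le_trans ?_ (Complex.abs_im_le_norm _))
      · simp only [Complex.ofReal_re]; linarith
      · simp [abs_of_pos hX₁0]
    · refine le_norm_dampingFactor hH hX₁ ?_ (le_trans ?_ (Complex.abs_im_le_norm _))
      · simp only [Complex.ofReal_re]; linarith
      · simp [abs_of_pos hX₁0]
  set p₁ : ℝ := 2 / Real.pi * (1 - 3 * κ) * (X₁ / (d + 2 * X₁)) with hp₁
  have hκ' : 0 < 1 - 3 * κ := by linarith
  have hp₁0 : 0 < p₁ := by positivity
  have hfin : Real.exp (2 * M * p₁) ≤ C * (1 + 1 / H) := by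
    have h1 : (c₁ * (1 / 6 * (1 / 6)) * Real.exp (M * p₁)) ^ 2 ≤
        14 * E ^ 2 * (1 + N) ^ 2 * (1 + 1 / H) :=
      (pow_le_pow_left₀ (by positivity) hlower 2).trans hupper
    have h2 : Real.exp (2 * M * p₁) = Real.exp (M * p₁) ^ 2 := by
      rw [← Real.exp_nat_mul]; congr 1; push_cast; ring
    have h3 : Real.exp (M * p₁) ^ 2 = 1296 / c₁ ^ 2 *
        (c₁ * (1 / 6 * (1 / 6)) * Real.exp (M * p₁)) ^ 2 := by field_simp; norm_num
    have hH1 : 0 < 1 + 1 / H := by positivity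
    rw [h2, h3]
    calc _ ≤ 1296 / c₁ ^ 2 * (14 * E ^ 2 * (1 + N) ^ 2 * (1 + 1 / H)) := by gcongr
      _ ≤ _ := by rw [hC]; linarith
  have hCH : 0 < C * (1 + 1 / H) := (Real.exp_pos _).trans_le hfin
  have h1 : 2 * M * p₁ ≤ Real.log (C * (1 + 1 / H)) := (Real.le_log_iff_exp_le hCH).2 hfin
  rw [← Real.le_log_iff_exp_le hδ]
  have h2 : M ≤ Real.pi / (4 * (1 - 3 * κ)) * (d / X₁ + 2) * Real.log (C * (1 + 1 / H)) := by
    have h3 : M = Real.pi / (4 * (1 - 3 * κ)) * (d / X₁ + 2) * (2 * M * p₁) := by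
      rw [hp₁]; field_simp; ring
    rw [h3]
    gcongr
  rw [hM] at h2
  linarith

/-- The two constant theorem in a rectangle: a function bounded by `B` in a fixed rectangle and by
`δ` on a segment of half-length `X` of its left side cannot be large inside if `δ` is much smaller
than `exp (- 1 / X)`. -/
theorem exp_neg_le_of_norm_le_rect {X l d δ B c₁ : ℝ} {g : ℂ → ℂ} (hX : 0 < X) (hX1 : X ≤ 1 / 2)
    (hd0 : l < d) (hd : d ≤ l + 4) (hδ : 0 < δ) (hδ1 : δ ≤ 1) (hB : 1 ≤ B) (hc₁ : 0 < c₁)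
    (hg : ∀ s : ℂ, l ≤ s.re → |s.im| ≤ 4 → DifferentiableAt ℂ g s)
    (hbd : ∀ s : ℂ, l ≤ s.re → |s.im| ≤ 4 → ‖g s‖ ≤ B)
    (hleft : ∀ s : ℂ, s.re = l → |s.im| ≤ X → ‖g s‖ ≤ δ) (hlow : c₁ ≤ ‖g d‖) :
    Real.exp (-(50 / X * Real.log (B / c₁))) ≤ δ := by
  have hpi := Real.pi_gt_three
  have hpi' := Real.pi_lt_d2
  set M : ℝ := -Real.log δ with hM
  have hM0 : 0 ≤ M := by rw [hM]; linarith [Real.log_nonpos hδ.le hδ1]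
  set z₀ : ℂ := ((l - X ^ 2 / 100 : ℝ) : ℂ) with hz₀
  set p : ℂ → ℂ := fun s => segmentPotential (X / 2) (s - z₀) - ((X / 20 : ℝ) : ℂ) with hp
  set F : ℂ → ℂ := fun s => g s * Complex.exp (M * p s) with hF
  have hX2 : 0 < X ^ 2 / 100 := by positivity
  have hre : ∀ s : ℂ, (s - z₀).re = s.re - l + X ^ 2 / 100 := fun s => by
    rw [Complex.sub_re, hz₀, Complex.ofReal_re]; ring
  have him : ∀ s : ℂ, (s - z₀).im = s.im := fun s => by
    rw [Complex.sub_im, hz₀, Complex.ofReal_im, sub_zero]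
  have hpre : ∀ s : ℂ, l ≤ s.re → 0 < (s - z₀).re := fun s hs => by rw [hre]; linarith
  have hpr : ∀ s : ℂ, (p s).re = (segmentPotential (X / 2) (s - z₀)).re - X / 20 := fun s => by
    simp only [hp]; rw [Complex.sub_re, Complex.ofReal_re]
  have hFn : ∀ s, ‖F s‖ = ‖g s‖ * Real.exp (M * (p s).re) := by
    intro s
    simp only [hF]
    rw [norm_mul, Complex.norm_exp, Complex.re_ofReal_mul]
  have hFg : ∀ s : ℂ, l ≤ s.re → |s.im| ≤ 4 → (p s).re ≤ 0 → ‖F s‖ ≤ B := by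
    intro s hs hi hps
    rw [hFn]
    refine (mul_le_of_le_one_right (norm_nonneg _) (Real.exp_le_one_iff.2 ?_)).trans (hbd s hs hi)
    exact mul_nonpos_of_nonneg_of_nonpos hM0 hps
  have hd' : DiffContOnCl ℂ F (Ioo l (l + 10) ×ℂ Ioo (-4) 4) := by
    refine DifferentiableOn.diffContOnCl fun s hs => DifferentiableAt.differentiableWithinAt ?_
    rw [Complex.closure_reProdIm, closure_Ioo (by linarith), closure_Ioo (by norm_num)] at hs
    have h1 := hg s hs.1.1 (abs_le.2 hs.2)
    have h2 : DifferentiableAt ℂ p s :=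
      (DifferentiableAt.comp (g := segmentPotential (X / 2)) (f := fun s : ℂ => s - z₀) s
        (differentiableAt_segmentPotential _ (hpre s hs.1.1)) (by fun_prop)).sub_const _
    exact h1.mul (h2.const_mul _).cexp
  have hFB : ‖F d‖ ≤ B := by
    refine norm_le_of_frontier_rect (l := l) (r := l + 10) (Y := 4) (by linarith) (by norm_num) hd'
      (fun s hs hi => ?_) (fun s hs hi => ?_) (fun s hs hs' hi => ?_) (by simpa using hd0.le)
      (by simp; linarith) (by simp)
    · by_cases h : |s.im| ≤ X
      · rw [hFn]
        have h1 := re_segmentPotential_le_one (X / 2) (hpre s hs.ge)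
        calc _ ≤ δ * Real.exp (M * 1) := by
              gcongr
              · exact hleft s hs h
              · rw [hpr]; linarith
          _ = 1 := by rw [hM, mul_one, Real.exp_neg, Real.exp_log hδ, mul_inv_cancel₀ hδ.ne']
          _ ≤ B := hB
      · push Not at h
        refine hFg s hs.ge hi ?_
        have h1 := re_segmentPotential_le (h := X / 2) (by linarith) (hpre s hs.ge)
          (by rw [him]; linarith)
        rw [him, hre, hs, sub_self, zero_add] at h1
        rw [hpr]
        have h2 : 2 * (X / 2) * (X ^ 2 / 100) /
            (Real.pi * ((X ^ 2 / 100) ^ 2 + (|s.im| - X / 2) ^ 2)) ≤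
            2 * (X / 2) * (X ^ 2 / 100) / (3 * (X / 2) ^ 2) := by
          gcongr
          have : (X / 2) ^ 2 ≤ (|s.im| - X / 2) ^ 2 := by gcongr; linarith
          nlinarith [sq_nonneg (X ^ 2 / 100)]
        have h3 : 2 * (X / 2) * (X ^ 2 / 100) / (3 * (X / 2) ^ 2) = X / 75 := by
          field_simp; norm_num
        linarith
    · refine hFg s (by linarith) hi ?_
      have h1 := re_segmentPotential_le_div (h := X / 2) (by linarith) (hpre s (by linarith))
      rw [hre, hs] at h1
      rw [hpr]
      have h2 : 2 * (X / 2) / (Real.pi * (l + 10 - l + X ^ 2 / 100)) ≤ 2 * (X / 2) / (3 * 10) := by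
        gcongr
        linarith
      linarith
    · refine hFg s hs hi.le ?_
      have h1 := re_segmentPotential_le (h := X / 2) (by linarith) (hpre s hs)
        (by rw [him, hi]; linarith)
      rw [him, hi] at h1
      rw [hpr]
      set x : ℝ := (s - z₀).re with hx
      have hx0 : 0 < x := hpre s hs
      have h2 : 2 * (X / 2) * x / (Real.pi * (x ^ 2 + (4 - X / 2) ^ 2)) ≤ X / 20 := by
        rw [div_le_div_iff₀ (by positivity) (by norm_num)]
        have h3 : 2 * x * 3.75 ≤ x ^ 2 + (4 - X / 2) ^ 2 := by
          nlinarith [sq_nonneg (x - (4 - X / 2))]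
        have h4 : 3 * (2 * x * 3.75) ≤ Real.pi * (x ^ 2 + (4 - X / 2) ^ 2) := by gcongr
        nlinarith
      linarith
  have hlow2 : X / 50 ≤ (p d).re := by
    rw [hpr]
    have e : (d : ℂ) - z₀ = ((d - l + X ^ 2 / 100 : ℝ) : ℂ) := by rw [hz₀]; push_cast; ring
    rw [e]
    have h1 := le_re_segmentPotential (h := X / 2) (by linarith)
      (show 0 < d - l + X ^ 2 / 100 by linarith)
    have h2 : X / 2 / 4.3 ≤ X / 2 / (d - l + X ^ 2 / 100 + X / 2) := by
      gcongr
      nlinarith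
    have h3 : 2 / 3.15 * (X / 2 / 4.3) ≤ 2 / Real.pi * (X / 2 / (d - l + X ^ 2 / 100 + X / 2)) := by
      gcongr
    have h4 : X / 50 + X / 20 ≤ 2 / 3.15 * (X / 2 / 4.3) := by
      have : 2 / 3.15 * (X / 2 / 4.3) = X * (1 / (3.15 * 4.3)) := by ring
      rw [this]
      have : (7 : ℝ) / 100 ≤ 1 / (3.15 * 4.3) := by norm_num
      nlinarith
    linarith
  rw [hFn] at hFB
  have h1 : c₁ * Real.exp (M * (X / 50)) ≤ B := by
    refine le_trans ?_ hFB
    gcongr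
  have h2 : M * (X / 50) ≤ Real.log (B / c₁) := by
    rw [Real.le_log_iff_exp_le (by positivity), le_div_iff₀ hc₁]
    linarith
  rw [← Real.le_log_iff_exp_le hδ]
  have h3 : M ≤ 50 / X * Real.log (B / c₁) := by
    rw [div_mul_eq_mul_div, le_div_iff₀ hX]
    linarith
  rw [hM] at h3
  linarith

/-! ### Averages over vertical segments -/

/-- The average of `u` over the vertical segment of half-length `r` centred at `s + z₀`. -/
noncomputable def verticalAverage (u : ℂ → ℂ) (z₀ : ℂ) (r : ℝ) (s : ℂ) : ℂ :=
  ∫ v in (0:ℝ)..1, u (s + z₀ + ((2 * v - 1) * r : ℝ) * Complex.I)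

theorem differentiableOn_verticalAverage {u : ℂ → ℂ} (hu : DifferentiableOn ℂ u {1}ᶜ) {z₀ : ℂ}
    {r Y : ℝ} (hr : 0 ≤ r) (hz : 0 ≤ z₀.re) (hY : Y + r ≤ z₀.im) :
    DifferentiableOn ℂ (verticalAverage u z₀ r) {s | 1 < s.re ∨ |s.im| < Y} := by
  have hU : IsOpen {s : ℂ | 1 < s.re ∨ |s.im| < Y} :=
    (isOpen_lt continuous_const Complex.continuous_re).union
      (isOpen_lt Complex.continuous_im.abs continuous_const)
  have hne : ∀ (v : ℝ) (s : ℂ), (1 < s.re ∨ |s.im| < Y) →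
      s + z₀ + ((2 * max 0 (min v 1) - 1) * r : ℝ) * Complex.I ∈ ({1}ᶜ : Set ℂ) := by
    intro v s hs h
    have h1 : s + z₀ + ((2 * max 0 (min v 1) - 1) * r : ℝ) * Complex.I = 1 := h
    have hre := congrArg Complex.re h1
    have him := congrArg Complex.im h1
    simp only [Complex.add_re, Complex.add_im, Complex.re_ofReal_mul, Complex.im_ofReal_mul,
      Complex.I_re, Complex.I_im, Complex.one_re, Complex.one_im, mul_zero, mul_one, add_zero]
      at hre him
    rcases hs with hs | hs
    · linarith
    · have h2 : 0 ≤ max 0 (min v 1) := le_max_left _ _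
      have h3 := (abs_lt.1 hs).1
      nlinarith
  have hd := differentiableOn_integral_zero_one hU
    (g := fun v s => u (s + z₀ + ((2 * max 0 (min v 1) - 1) * r : ℝ) * Complex.I))
    (hu.continuousOn.comp (f := fun p : ℝ × ℂ =>
      p.2 + z₀ + ((2 * max 0 (min p.1 1) - 1) * r : ℝ) * Complex.I) (by fun_prop)
      fun p hp => hne p.1 p.2 hp.2)
    (fun v => hu.comp (f := fun s : ℂ =>
      s + z₀ + ((2 * max 0 (min v 1) - 1) * r : ℝ) * Complex.I) (by fun_prop)
      fun s hs => hne v s hs)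
  refine hd.congr fun s _ => intervalIntegral.integral_congr fun v hv => ?_
  rw [uIcc_of_le zero_le_one] at hv
  simp only [min_eq_left hv.2, max_eq_right hv.1]

/-- Averaging multiplies each coefficient by a factor of modulus at most one; the first one, whose
base is `1`, keeps its modulus. -/
theorem verticalAverage_eq_progressionSeries {u : ℂ → ℂ} {c : ℕ → ℂ} {q : ℝ} (hq : 1 / 2 ≤ q)
    (hc : ∀ n, ‖c n‖ ≤ 1) (hu : ∀ s : ℂ, 1 < s.re → u s = progressionSeries c q s) {z₀ : ℂ}
    (r : ℝ) (hz : 0 ≤ z₀.re) : ∃ c' : ℕ → ℂ, (∀ n, ‖c' n‖ ≤ 1) ∧ c' 0 = c 0 ∧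
      ∀ s : ℂ, 1 < s.re → verticalAverage u z₀ r s = progressionSeries c' q s := by
  have hpos : ∀ n : ℕ, 0 < 1 + n * q := fun n => by have := one_le_progression hq n; linarith
  have hne : ∀ n : ℕ, ((1 + n * q : ℝ) : ℂ) ≠ 0 := fun n => by exact_mod_cast (hpos n).ne'
  set e : ℝ → ℂ := fun v => z₀ + ((2 * v - 1) * r : ℝ) * Complex.I with he
  have here : ∀ v, (e v).re = z₀.re := fun v => by simp [he]
  have hec : Continuous e := by simp only [he]; fun_prop
  refine ⟨fun n => c n * ∫ v in (0:ℝ)..1, ((1 + n * q : ℝ) : ℂ) ^ (-(e v)), fun n => ?_, ?_, ?_⟩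
  · have : ‖∫ v in (0:ℝ)..1, ((1 + n * q : ℝ) : ℂ) ^ (-(e v))‖ ≤ 1 * |(1:ℝ) - 0| := by
      refine intervalIntegral.norm_integral_le_of_norm_le_const fun v _ => ?_
      rw [Complex.norm_cpow_eq_rpow_re_of_pos (hpos n), Complex.neg_re, here]
      exact Real.rpow_le_one_of_one_le_of_nonpos (one_le_progression hq n) (by linarith)
    rw [sub_zero, abs_one, mul_one] at this
    rw [norm_mul]
    exact mul_le_one₀ (hc n) (norm_nonneg _) this
  · simp
  · intro s hs
    have hcont : ∀ n : ℕ, Continuous fun v : ℝ =>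
        c n * ((1 + n * q : ℝ) : ℂ) ^ (-(s + e v)) := fun n =>
      continuous_const.mul (Continuous.const_cpow (by fun_prop) (Or.inl (hne n)))
    let f : ℕ → C(ℝ, ℂ) := fun n => ⟨_, hcont n⟩
    have hsum : Summable fun n : ℕ =>
        ‖(f n).restrict (⟨uIcc (0:ℝ) 1, isCompact_uIcc⟩ : TopologicalSpace.Compacts ℝ)‖ := by
      refine Summable.of_nonneg_of_le (fun n => norm_nonneg _) (fun n => ?_)
        (summable_progression_rpow hq (sub_pos.2 hs))
      have h0 := hpos n
      rw [ContinuousMap.norm_le _ (by positivity)]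
      rintro ⟨v, hv⟩
      exact norm_progressionSeries_term hq hc (s := s + e v) (w := s.re - 1)
        (by rw [Complex.add_re, here]; linarith) n
    have key := intervalIntegral.tsum_intervalIntegral_eq_of_summable_norm hsum
    simp only [f, ContinuousMap.coe_mk] at key
    have h1 : verticalAverage u z₀ r s =
        ∫ v in (0:ℝ)..1, ∑' n : ℕ, c n * ((1 + n * q : ℝ) : ℂ) ^ (-(s + e v)) := by
      refine intervalIntegral.integral_congr fun v _ => ?_
      change u (s + z₀ + ((2 * v - 1) * r : ℝ) * Complex.I) = progressionSeries c q (s + e v)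
      rw [add_assoc, hu _ (by
        change 1 < (s + e v).re
        rw [Complex.add_re, here]; linarith)]
    rw [h1, ← key]
    refine tsum_congr fun n => ?_
    have h2 : ∫ v in (0:ℝ)..1, ((1 + n * q : ℝ) : ℂ) ^ (-(s + e v)) =
        ((1 + n * q : ℝ) : ℂ) ^ (-s) * ∫ v in (0:ℝ)..1, ((1 + n * q : ℝ) : ℂ) ^ (-(e v)) := by
      rw [← intervalIntegral.integral_const_mul]
      refine intervalIntegral.integral_congr fun v _ => ?_
      change _ = ((1 + n * q : ℝ) : ℂ) ^ (-s) * ((1 + n * q : ℝ) : ℂ) ^ (-(e v))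
      rw [← Complex.cpow_add _ _ (hne n), neg_add]
    rw [intervalIntegral.integral_const_mul, h2]
    ring

theorem norm_verticalAverage_le {u : ℂ → ℂ} {z₀ : ℂ} {r B : ℝ} (hr : 0 ≤ r) {s : ℂ}
    (h : ∀ w : ℂ, w.re = s.re + z₀.re → |w.im - (s.im + z₀.im)| ≤ r → ‖u w‖ ≤ B) :
    ‖verticalAverage u z₀ r s‖ ≤ B := by
  have := intervalIntegral.norm_integral_le_of_norm_le_const (a := (0:ℝ)) (b := 1) (C := B)
    (f := fun v : ℝ => u (s + z₀ + ((2 * v - 1) * r : ℝ) * Complex.I)) fun v hv => by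
      rw [uIoc_of_le zero_le_one] at hv
      refine h _ (by simp) ?_
      have : (s + z₀ + ((2 * v - 1) * r : ℝ) * Complex.I).im - (s.im + z₀.im) = (2 * v - 1) * r := by
        simp
      rw [this, abs_mul, abs_of_nonneg hr]
      exact mul_le_of_le_one_left hr (abs_le.2 ⟨by linarith [hv.1], by linarith [hv.2]⟩)
  rw [sub_zero, abs_one, mul_one] at this
  exact this

/-- The average of `‖u‖` over a vertical segment, as an integral over the segment. -/
theorem integral_vertical_eq {f : ℝ → ℝ} {r : ℝ} (hr : 0 < r) (y : ℝ) :
    ∫ v in (0:ℝ)..1, f (y + (2 * v - 1) * r) = (2 * r)⁻¹ * ∫ t in (y - r)..(y + r), f t := by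
  have h := intervalIntegral.integral_comp_mul_add (a := 0) (b := 1) f
    (show 2 * r ≠ 0 by positivity) (y - r)
  rw [show 2 * r * 0 + (y - r) = y - r by ring, show 2 * r * 1 + (y - r) = y + r by ring,
    smul_eq_mul] at h
  rw [← h]
  refine intervalIntegral.integral_congr fun v _ => ?_
  congr 1; ring

/-- The first term of the series dominates if `d` is such that the other terms have sum less
than one. -/
theorem le_norm_progressionSeries {c : ℕ → ℂ} {q x c₁ : ℝ} (hq : 1 / 2 ≤ q) (hc : ∀ n, ‖c n‖ ≤ 1)
    (hc0 : ‖c 0‖ = 1) (hx : 1 < x) (hs : ∀ N : ℕ, ∑ n ∈ Finset.range N, (1 + (n + 1 : ℕ) * q) ^ (-x)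
      ≤ 1 - c₁) : c₁ ≤ ‖progressionSeries c q x‖ := by
  have hsum : Summable fun n : ℕ => c n * ((1 + n * q : ℝ) : ℂ) ^ (-(x : ℂ)) :=
    Summable.of_norm_bounded (summable_progression_rpow hq (sub_pos.2 hx))
      (norm_progressionSeries_term hq hc (s := x) (by simp))
  have hb : ∀ n : ℕ, ‖c (n + 1) * ((1 + (n + 1 : ℕ) * q : ℝ) : ℂ) ^ (-(x : ℂ))‖ ≤
      (1 + (n + 1 : ℕ) * q) ^ (-x) := fun n => by
    have := norm_progressionSeries_term hq hc (s := x) (w := x - 1) (by simp) (n + 1)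
    rwa [show -1 - (x - 1) = -x by ring] at this
  have hs1 : Summable fun n : ℕ => (1 + (n + 1 : ℕ) * q) ^ (-x) :=
    summable_of_sum_range_le (fun n => by have := one_le_progression hq (n + 1); positivity) hs
  have h2 : ‖∑' n : ℕ, c (n + 1) * ((1 + (n + 1 : ℕ) * q : ℝ) : ℂ) ^ (-(x : ℂ))‖ ≤ 1 - c₁ :=
    (tsum_of_norm_bounded hs1.hasSum hb).trans
      (Real.tsum_le_of_sum_range_le (fun n => by
        have := one_le_progression hq (n + 1); positivity) hs)
  rw [progressionSeries, hsum.tsum_eq_zero_add]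
  have h3 : c 0 * ((1 + (0 : ℕ) * q : ℝ) : ℂ) ^ (-(x : ℂ)) = c 0 := by simp
  rw [h3]
  have h4 := norm_sub_le_norm_add (c 0)
    (∑' n : ℕ, c (n + 1) * ((1 + (n + 1 : ℕ) * q : ℝ) : ℂ) ^ (-(x : ℂ)))
  rw [hc0] at h4
  linarith

/-! ### Explicit bounds for the tails -/

theorem one_sub_mul_le_rpow_neg {y e : ℝ} (hy : 0 < y) (he : 0 ≤ e) :
    1 - e * (y - 1) ≤ y ^ (-e) := by
  rw [Real.rpow_def_of_pos hy]
  have h1 := Real.add_one_le_exp (Real.log y * -e)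
  have h2 := Real.log_le_sub_one_of_pos hy
  nlinarith

/-- The midpoint rule underestimates the integral of the convex function `x ^ (-1 - d)`. -/
theorem mul_rpow_le_midpoint {x d : ℝ} (hx : 1 / 2 < x) (hd : 0 ≤ d) :
    d * x ^ (-1 - d) ≤ (x - 1 / 2) ^ (-d) - (x + 1 / 2) ^ (-d) := by
  have hx0 : 0 < x := by linarith
  have hder : ∀ h ∈ Ioo (0:ℝ) (1 / 2), HasDerivAt
      (fun h => (x - h) ^ (-d) - (x + h) ^ (-d) - 2 * h * (d * x ^ (-1 - d)))
      (d * ((x - h) ^ (-1 - d) + (x + h) ^ (-1 - d) - 2 * x ^ (-1 - d))) h := by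
    intro h hh
    have h1 : HasDerivAt (fun h => (x - h) ^ (-d)) (-1 * -d * (x - h) ^ (-d - 1)) h :=
      ((hasDerivAt_id h).const_sub x).rpow_const (Or.inl (by
        have : 0 < x - h := by linarith [hh.2]
        exact this.ne'))
    have h2 : HasDerivAt (fun h => (x + h) ^ (-d)) (1 * -d * (x + h) ^ (-d - 1)) h :=
      ((hasDerivAt_id h).const_add x).rpow_const (Or.inl (by
        have : 0 < x + h := by linarith [hh.1]
        exact this.ne'))
    have h3 : HasDerivAt (fun h => 2 * h * (d * x ^ (-1 - d))) (2 * 1 * (d * x ^ (-1 - d))) h :=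
      ((hasDerivAt_id h).const_mul 2).mul_const _
    refine ((h1.sub h2).sub h3).congr_deriv ?_
    rw [show -d - 1 = -1 - d by ring]
    ring
  have hm : MonotoneOn (fun h => (x - h) ^ (-d) - (x + h) ^ (-d) - 2 * h * (d * x ^ (-1 - d)))
      (Icc 0 (1 / 2)) := by
    refine monotoneOn_of_deriv_nonneg (convex_Icc _ _) ?_ ?_ ?_
    · refine ContinuousOn.sub (ContinuousOn.sub ?_ ?_) (by fun_prop)
      · exact ContinuousOn.rpow_const (by fun_prop) fun h hh => Or.inl (by
          have : 0 < x - h := by linarith [hh.2]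
          exact this.ne')
      · exact ContinuousOn.rpow_const (by fun_prop) fun h hh => Or.inl (by
          have : 0 < x + h := by linarith [hh.1]
          exact this.ne')
    · rw [interior_Icc]
      exact fun h hh => (hder h hh).differentiableAt.differentiableWithinAt
    · rw [interior_Icc]
      intro h hh
      rw [(hder h hh).deriv]
      refine mul_nonneg hd ?_
      have e1 : ∀ y, 0 < y → (x * y) ^ (-1 - d) = x ^ (-1 - d) * y ^ (-(1 + d)) := fun y hy => by
        rw [Real.mul_rpow hx0.le hy.le, show -(1 + d) = -1 - d by ring]
      have hhx : h / x < 1 := (div_lt_one hx0).2 (by linarith [hh.2])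
      have hh0 : 0 < h / x := div_pos hh.1 hx0
      have e2 : x - h = x * (1 - h / x) := by field_simp
      have e3 : x + h = x * (1 + h / x) := by field_simp
      rw [e2, e3, e1 _ (by linarith), e1 _ (by linarith)]
      have a1 := one_sub_mul_le_rpow_neg (y := 1 - h / x) (e := 1 + d) (by linarith) (by linarith)
      have a2 := one_sub_mul_le_rpow_neg (y := 1 + h / x) (e := 1 + d) (by linarith) (by linarith)
      have a3 : 0 < x ^ (-1 - d) := by positivity
      have a4 : 0 ≤ (1 - h / x) ^ (-(1 + d)) + (1 + h / x) ^ (-(1 + d)) - 2 := by linarith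
      nlinarith
  have := hm (left_mem_Icc.2 (by norm_num)) (right_mem_Icc.2 (by norm_num))
    (show (0:ℝ) ≤ 1 / 2 by norm_num)
  simp only [sub_zero, add_zero, sub_self, mul_zero, zero_mul] at this
  linarith

theorem sum_rpow_le_midpoint {x d : ℝ} (hx : 1 / 2 < x) (hd : 0 < d) (N : ℕ) :
    ∑ n ∈ Finset.range N, (x + n) ^ (-1 - d) ≤ 1 / d * (x - 1 / 2) ^ (-d) := by
  have key : ∑ n ∈ Finset.range N, (x + n) ^ (-1 - d) ≤
      1 / d * ((x - 1 / 2) ^ (-d) - (x + N - 1 / 2) ^ (-d)) := by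
    induction N with
    | zero => simp
    | succ N ih =>
      rw [Finset.sum_range_succ]
      have hN : (0:ℝ) ≤ N := Nat.cast_nonneg N
      have h := mul_rpow_le_midpoint (x := x + N) (by linarith) hd.le
      have h2 : (x + N) ^ (-1 - d) ≤
          1 / d * ((x + N - 1 / 2) ^ (-d) - (x + N + 1 / 2) ^ (-d)) := by
        rw [one_div, inv_mul_eq_div, le_div_iff₀ hd]
        linarith
      rw [show x + ((N + 1 : ℕ) : ℝ) - 1 / 2 = x + N + 1 / 2 by push_cast; ring]
      linarith
  refine key.trans ?_
  gcongr
  have : (0:ℝ) ≤ N := Nat.cast_nonneg N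
  have : 0 ≤ (x + N - 1 / 2) ^ (-d) := Real.rpow_nonneg (by linarith) _
  linarith

theorem rpow_neg_div_le {y v : ℝ} {m n : ℕ} (hy : 0 < y) (hv : 0 ≤ v) (hn : n ≠ 0)
    (h : 1 ≤ v ^ n * y ^ m) : y ^ (-(m / n : ℝ)) ≤ v := by
  have hn' : (n : ℝ) ≠ 0 := by exact_mod_cast hn
  refine le_of_pow_le_pow_left₀ hn hv ?_
  rw [← Real.rpow_natCast, ← Real.rpow_mul hy.le, neg_mul, div_mul_cancel₀ _ hn', Real.rpow_neg hy.le,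
    Real.rpow_natCast, inv_le_iff_one_le_mul₀ (by positivity)]
  exact h

/-- `ζ(26/15) - 1 < 0.998`. -/
theorem sum_natCast_add_two_rpow_le {x : ℝ} (hx : 26 / 15 ≤ x) (N : ℕ) :
    ∑ n ∈ Finset.range N, ((n:ℝ) + 2) ^ (-x) ≤ 998 / 1000 := by
  have h1 : ∀ n : ℕ, ((n:ℝ) + 2) ^ (-x) ≤ ((n:ℝ) + 2) ^ (-(26 / 15) : ℝ) := fun n =>
    Real.rpow_le_rpow_of_exponent_le (by linarith [(Nat.cast_nonneg n : (0:ℝ) ≤ n)]) (by linarith)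
  refine (Finset.sum_le_sum fun n _ => h1 n).trans ?_
  have h2 : ∑ n ∈ Finset.range N, ((n:ℝ) + 2) ^ (-(26 / 15) : ℝ) ≤
      ∑ n ∈ Finset.range (N + 1), ((n:ℝ) + 2) ^ (-(26 / 15) : ℝ) := by
    rw [Finset.sum_range_succ]
    have : (0:ℝ) ≤ ((N:ℝ) + 2) ^ (-(26 / 15) : ℝ) := by positivity
    linarith
  refine h2.trans ?_
  rw [Finset.sum_range_succ']
  have h3 := sum_rpow_le_midpoint (x := 3) (d := 11 / 15) (by norm_num) (by norm_num) N
  have h4 : ∑ n ∈ Finset.range N, (((n + 1 : ℕ) : ℝ) + 2) ^ (-(26 / 15) : ℝ) =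
      ∑ n ∈ Finset.range N, ((3:ℝ) + n) ^ (-1 - 11 / 15 : ℝ) := by
    refine Finset.sum_congr rfl fun n _ => ?_
    push_cast
    rw [show (n:ℝ) + 1 + 2 = 3 + n by ring]
    norm_num
  rw [h4]
  have h5 : ((3:ℝ) - 1 / 2) ^ (-(11 / 15) : ℝ) ≤ 511 / 1000 := by
    have := rpow_neg_div_le (y := 3 - 1 / 2) (v := 511 / 1000) (m := 11) (n := 15) (by norm_num)
      (by norm_num) (by norm_num) (by norm_num)
    simpa using this
  have h6 : (((0:ℕ):ℝ) + 2) ^ (-(26 / 15) : ℝ) ≤ 301 / 1000 := by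
    have := rpow_neg_div_le (y := 2) (v := 301 / 1000) (m := 26) (n := 15) (by norm_num)
      (by norm_num) (by norm_num) (by norm_num)
    simpa using this
  have h7 : (1 : ℝ) / (11 / 15) * (3 - 1 / 2) ^ (-(11 / 15) : ℝ) ≤ 1 / (11 / 15) * (511 / 1000) := by
    gcongr
  have h8 : (1 : ℝ) / (11 / 15) * (511 / 1000) ≤ 697 / 1000 := by norm_num
  linarith

theorem sum_progression_rpow_le_of_one_le {q x : ℝ} (hq : 1 ≤ q) (hx : 26 / 15 ≤ x) (N : ℕ) :
    ∑ n ∈ Finset.range N, (1 + (n + 1 : ℕ) * q) ^ (-x) ≤ 1 - 2 / 1000 := by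
  refine (Finset.sum_le_sum fun n _ => ?_).trans
    ((sum_natCast_add_two_rpow_le hx N).trans (by norm_num))
  have hn : (0:ℝ) ≤ n := Nat.cast_nonneg n
  refine Real.rpow_le_rpow_of_nonpos (by linarith) ?_ (by linarith)
  push_cast
  nlinarith

theorem sum_progression_rpow_le_of_three_le {q x : ℝ} (hq : 1 / 2 ≤ q) (hx : 3 ≤ x) (N : ℕ) :
    ∑ n ∈ Finset.range N, (1 + (n + 1 : ℕ) * q) ^ (-x) ≤ 1 - 2 / 1000 := by
  have h1 : ∀ n : ℕ, (1 + ((n + 1 : ℕ) : ℝ) * q) ^ (-x) ≤ 8 * ((3:ℝ) + n) ^ (-1 - 2 : ℝ) := by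
    intro n
    have hn : (0:ℝ) ≤ n := Nat.cast_nonneg n
    have h0 : (3 + n : ℝ) / 2 ≤ 1 + ((n + 1 : ℕ) : ℝ) * q := by push_cast; nlinarith
    calc _ ≤ (1 + ((n + 1 : ℕ) : ℝ) * q) ^ (-3 : ℝ) :=
          Real.rpow_le_rpow_of_exponent_le (by linarith) (by linarith)
      _ ≤ ((3 + n : ℝ) / 2) ^ (-3 : ℝ) :=
          Real.rpow_le_rpow_of_nonpos (by positivity) h0 (by norm_num)
      _ = _ := by
          rw [Real.div_rpow (by positivity) (by norm_num), Real.rpow_neg (by norm_num : (0:ℝ) ≤ 2),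
            show (-1 - 2 : ℝ) = -3 by norm_num]
          norm_num
          ring
  have h2 := sum_rpow_le_midpoint (x := 3) (d := 2) (by norm_num) (by norm_num) N
  have h3 : ((3:ℝ) - 1 / 2) ^ (-2 : ℝ) = 4 / 25 := by
    rw [Real.rpow_neg (by norm_num)]; norm_num
  rw [h3] at h2
  calc _ ≤ ∑ n ∈ Finset.range N, 8 * ((3:ℝ) + n) ^ (-1 - 2 : ℝ) := Finset.sum_le_sum fun n _ => h1 n
    _ = 8 * ∑ n ∈ Finset.range N, ((3:ℝ) + n) ^ (-1 - 2 : ℝ) := by rw [Finset.mul_sum]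
    _ ≤ 8 * (1 / 2 * (4 / 25)) := by gcongr
    _ ≤ _ := by norm_num

/-! ### Size of the Lerch zeta function near a point where the dual term is small -/

/-- The dual term at `s` is controlled by its value at a point `s₁` further to the left and at most
`D` above `s`: up to polynomial factors its modulus does not increase with `re s`, and it is
multiplied by at most `e ^ (π D)` when the ordinate decreases by `D`. -/
theorem norm_dualTerm_transfer : ∃ K : ℝ, 1 ≤ K ∧ ∃ p : ℕ, ∀ (a : ℝ) (s₁ s : ℂ) (D : ℝ), |a| ≤ 1 / 2 →
    -3 ≤ s₁.re → s₁.re ≤ s.re → s.re ≤ 3 → 1 ≤ s₁.im → 1 ≤ s.im → s₁.im - D ≤ s.im → 0 ≤ D →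
    ‖dualTerm a s‖ ≤ K * (s₁.im * s.im) ^ p * Real.exp (Real.pi * D) * ‖dualTerm a s₁‖ := by
  obtain ⟨K, hK, p, h⟩ := norm_Gamma_one_sub_mul_exp_bounds 3
  have hpi := Real.pi_gt_three
  refine ⟨K ^ 2 * Real.pi ^ 6, ?_, p, fun a s₁ s D ha h1 h2 h3 h4 h5 h6 hD => ?_⟩
  · exact one_le_mul_of_one_le_of_one_le (one_le_pow₀ hK) (one_le_pow₀ (by linarith))
  push_cast at h
  have g1 := (h s₁ h1 (by linarith) h4).1
  have g2 := (h s (by linarith) h3 h5).2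
  set γ₁ : ℝ := ‖Complex.Gamma (1 - s₁)‖ * Real.exp (Real.pi * s₁.im / 2) with hγ₁
  set γ : ℝ := ‖Complex.Gamma (1 - s)‖ * Real.exp (Real.pi * s.im / 2) with hγ
  have hγ₁0 : 0 ≤ γ₁ := by positivity
  have hγ0 : 0 ≤ γ := by positivity
  have hγγ : γ ≤ K ^ 2 * (s₁.im * s.im) ^ p * γ₁ := by
    calc γ ≤ K * s.im ^ p * 1 := by rw [mul_one]; exact g2
      _ ≤ K * s.im ^ p * (K * s₁.im ^ p * γ₁) := by gcongr
      _ = _ := by rw [mul_pow]; ring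
  rcases eq_or_ne a 0 with rfl | ha0
  · rw [dualTerm_zero (by rintro rfl; simp at h5; linarith), norm_zero]
    positivity
  have ha0' : 0 < |a| := abs_pos.2 ha0
  have hx0 : 0 < 2 * Real.pi * |a| := by positivity
  have hxp : (2 * Real.pi * |a|) ^ (s.re - 1) ≤ (2 * Real.pi * |a|) ^ (s₁.re - 1) * Real.pi ^ 6 := by
    rw [show s.re - 1 = (s₁.re - 1) + (s.re - s₁.re) by ring, Real.rpow_add hx0]
    gcongr
    calc (2 * Real.pi * |a|) ^ (s.re - s₁.re) ≤ Real.pi ^ (s.re - s₁.re) :=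
          Real.rpow_le_rpow hx0.le (by nlinarith) (by linarith)
      _ ≤ Real.pi ^ (6 : ℝ) := Real.rpow_le_rpow_of_exponent_le (by linarith) (by linarith)
      _ = _ := by norm_num
  have hexpD : 1 ≤ Real.exp (Real.pi * D) := Real.one_le_exp (by positivity)
  rcases lt_or_gt_of_ne ha0 with hneg | hpos
  · have e : ∀ s : ℂ, ‖dualTerm a s‖ = ‖Complex.Gamma (1 - s)‖ * Real.exp (Real.pi * s.im / 2) *
        Real.exp (-(Real.pi * s.im)) * (2 * Real.pi * |a|) ^ (s.re - 1) := fun s => by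
      rw [norm_dualTerm_of_neg hneg, mul_assoc ‖Complex.Gamma (1 - s)‖ (Real.exp _) (Real.exp _),
        ← Real.exp_add]
      ring_nf
    rw [e s, e s₁, ← hγ, ← hγ₁]
    have hex : Real.exp (-(Real.pi * s.im)) ≤
        Real.exp (Real.pi * D) * Real.exp (-(Real.pi * s₁.im)) := by
      rw [← Real.exp_add]
      exact Real.exp_le_exp.2 (by nlinarith)
    calc _ ≤ K ^ 2 * (s₁.im * s.im) ^ p * γ₁ *
          (Real.exp (Real.pi * D) * Real.exp (-(Real.pi * s₁.im))) *
          ((2 * Real.pi * |a|) ^ (s₁.re - 1) * Real.pi ^ 6) := by gcongr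
      _ = _ := by ring
  · rw [norm_dualTerm_of_pos hpos, norm_dualTerm_of_pos hpos, ← hγ, ← hγ₁]
    rw [abs_of_pos hpos] at hxp
    calc _ ≤ K ^ 2 * (s₁.im * s.im) ^ p * γ₁ * ((2 * Real.pi * a) ^ (s₁.re - 1) * Real.pi ^ 6) := by
          gcongr
      _ ≤ K ^ 2 * (s₁.im * s.im) ^ p * γ₁ * ((2 * Real.pi * a) ^ (s₁.re - 1) * Real.pi ^ 6) *
          Real.exp (Real.pi * D) := le_mul_of_one_le_right (by positivity) hexpD
      _ = _ := by ring

/-- In a strip, `F s` is `b ^ (-s)` plus a term of the size of the dual term plus a term of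
polynomial size, uniformly in `a` and `b`. -/
theorem IsLerchZeta.norm_sub_cpow_le : ∃ K : ℝ, 1 ≤ K ∧ ∃ p : ℕ, ∀ (a b : ℝ) (F : ℂ → ℂ) (s : ℂ),
    |a| ≤ 1 / 2 → 0 < b → b ≤ 1 → IsLerchZeta a b F → -7 / 4 ≤ s.re → s.re ≤ 3 → 1 ≤ s.im →
    ‖F s - (b : ℂ) ^ (-s)‖ ≤ K * s.im ^ p + ‖dualTerm a s‖ ∧
    ‖dualTerm a s‖ ≤ ‖F s‖ + b ^ (-s.re) + K * s.im ^ p := by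
  obtain ⟨K, hK, p, h⟩ := norm_lerchReg_le 3 3
  refine ⟨K, hK, p, fun a b F s ha hb hb1 hF h1 h2 h3 => ?_⟩
  have ha0 := unitExpTail_zero_ne_zero ha
  have hre : 1 - ((3:ℕ):ℝ) < s.re := by push_cast; linarith
  have e1 : F s = (b : ℂ) ^ (-s) + unitExp a * (lerchReg a 3 (b + 1) s +
      unitExp (-(a * (b + 1))) * dualTerm a s) := by
    rw [hF.eq_lerchCont ha0 hb 3 hre (by linarith), lerchCont_eq_add ha0 3 hb hre (by linarith),
      lerchCont]
  have h4 := h a (b + 1) s ha (by linarith) (by norm_num; linarith) (by norm_num; linarith)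
    (by norm_num; linarith) h3
  have hR : ‖unitExp a * lerchReg a 3 (b + 1) s‖ ≤ K * s.im ^ p := by
    rw [norm_mul, norm_unitExp, one_mul]; exact h4
  have hDn : ‖unitExp a * (unitExp (-(a * (b + 1))) * dualTerm a s)‖ = ‖dualTerm a s‖ := by
    rw [norm_mul, norm_mul, norm_unitExp, norm_unitExp, one_mul, one_mul]
  have hbn : ‖(b : ℂ) ^ (-s)‖ = b ^ (-s.re) := by
    rw [Complex.norm_cpow_eq_rpow_re_of_pos hb, Complex.neg_re]
  constructor
  · have : F s - (b : ℂ) ^ (-s) = unitExp a * lerchReg a 3 (b + 1) s +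
        unitExp a * (unitExp (-(a * (b + 1))) * dualTerm a s) := by rw [e1]; ring
    rw [this, ← hDn]
    exact (norm_add_le _ _).trans (by linarith)
  · have : unitExp a * (unitExp (-(a * (b + 1))) * dualTerm a s) =
        F s - (b : ℂ) ^ (-s) - unitExp a * lerchReg a 3 (b + 1) s := by rw [e1]; ring
    rw [← hDn, this]
    have a1 := norm_sub_le (F s - (b : ℂ) ^ (-s)) (unitExp a * lerchReg a 3 (b + 1) s)
    have a2 := norm_sub_le (F s) ((b : ℂ) ^ (-s))
    linarith

/-- Either the dual term dominates on the whole segment, and then the function is large there, or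
the function is of polynomial size to the right of and above some point of the segment. -/
theorem IsLerchZeta.large_or_polynomial : ∃ K : ℝ, 1 ≤ K ∧ ∃ p : ℕ, ∀ (a b : ℝ) (F : ℂ → ℂ)
    (σ T₁ T₂ : ℝ), |a| ≤ 1 / 2 → 0 < b → b ≤ 1 → IsLerchZeta a b F → -1 ≤ σ → σ ≤ 3 → 1 ≤ T₁ →
    (∀ t ∈ Icc T₁ T₂, 1 ≤ ‖F (σ + t * Complex.I)‖) ∨
    ∃ t₁ ∈ Icc T₁ T₂, ∀ (μ B D : ℝ) (w : ℂ), 0 < μ → μ ≤ 2 → 1 ≤ B → μ ^ σ ≤ B →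
      μ ^ σ * b ^ (-σ) ≤ 1 → σ ≤ w.re → w.re ≤ 3 → 1 ≤ w.im → t₁ - D ≤ w.im → 0 ≤ D →
      μ ^ w.re * ‖F w - (b : ℂ) ^ (-w)‖ ≤ B * K * (t₁ * w.im) ^ p * Real.exp (Real.pi * D) := by
  obtain ⟨K₀, hK₀, p₀, h₀⟩ := IsLerchZeta.norm_sub_cpow_le
  obtain ⟨K₁, hK₁, p₁, h₁⟩ := norm_dualTerm_transfer
  refine ⟨16 * K₀ + 64 * K₁ * K₀, by nlinarith, p₀ + p₁, ?_⟩
  intro a b F σ T₁ T₂ ha hb hb1 hF hσ hσ3 hT₁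
  have hre : ∀ t : ℝ, (σ + t * Complex.I : ℂ).re = σ := fun t => by simp
  have him : ∀ t : ℝ, (σ + t * Complex.I : ℂ).im = t := fun t => by simp
  by_cases hdom : ∀ t ∈ Icc T₁ T₂, 2 * (b ^ (-σ) + K₀ * t ^ p₀) ≤ ‖dualTerm a (σ + t * Complex.I)‖
  · left
    intro t ht
    have ht1 : 1 ≤ t := hT₁.trans ht.1
    have h2 := (h₀ a b F (σ + t * Complex.I) ha hb hb1 hF (by rw [hre]; linarith)
      (by rw [hre]; exact hσ3) (by rw [him]; exact ht1)).2
    rw [hre, him] at h2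
    have h3 := hdom t ht
    have h4 : 0 < b ^ (-σ) := by positivity
    have h5 : 1 ≤ K₀ * t ^ p₀ := one_le_mul_of_one_le_of_one_le hK₀ (one_le_pow₀ ht1)
    linarith
  · right
    push Not at hdom
    obtain ⟨t₁, ht₁, hlt⟩ := hdom
    have ht1 : 1 ≤ t₁ := hT₁.trans ht₁.1
    refine ⟨t₁, ht₁, fun μ B D w hμ hμ2 hB hμB hμb hw1 hw2 hw3 hw4 hD => ?_⟩
    have h2 := (h₀ a b F w ha hb hb1 hF (by linarith) hw2 hw3).1
    have h3 := h₁ a (σ + t₁ * Complex.I) w D ha (by rw [hre]; linarith) (by rw [hre]; exact hw1) hw2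
      (by rw [him]; exact ht1) hw3 (by rw [him]; exact hw4) hD
    rw [him] at h3
    have hμσ : 0 < μ ^ σ := by positivity
    have hμw : μ ^ w.re ≤ μ ^ σ * 16 := by
      rw [show w.re = σ + (w.re - σ) by ring, Real.rpow_add hμ]
      gcongr
      calc μ ^ (w.re - σ) ≤ 2 ^ (w.re - σ) := Real.rpow_le_rpow hμ.le hμ2 (by linarith)
        _ ≤ 2 ^ (4:ℝ) := Real.rpow_le_rpow_of_exponent_le (by norm_num) (by linarith)
        _ = 16 := by norm_num
    set P : ℝ := (t₁ * w.im) ^ (p₀ + p₁) with hP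
    have hprod : 1 ≤ t₁ * w.im := one_le_mul_of_one_le_of_one_le ht1 hw3
    have hp1 : w.im ^ p₀ ≤ P := by
      calc w.im ^ p₀ ≤ (t₁ * w.im) ^ p₀ := by gcongr; exact le_mul_of_one_le_left (by linarith) ht1
        _ ≤ P := pow_le_pow_right₀ hprod (by omega)
    have hp2 : (t₁ * w.im) ^ p₁ * t₁ ^ p₀ ≤ P := by
      calc _ ≤ (t₁ * w.im) ^ p₁ * (t₁ * w.im) ^ p₀ := by
            gcongr; exact le_mul_of_one_le_right (by linarith) hw3
        _ = P := by rw [hP, pow_add]; ring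
    have hp3 : 1 ≤ t₁ ^ p₀ := one_le_pow₀ ht1
    have hE : 1 ≤ Real.exp (Real.pi * D) := Real.one_le_exp (by have := Real.pi_pos; positivity)
    have hR : μ ^ σ * ‖dualTerm a (σ + t₁ * Complex.I)‖ ≤ 4 * B * K₀ * t₁ ^ p₀ := by
      calc _ ≤ μ ^ σ * (2 * (b ^ (-σ) + K₀ * t₁ ^ p₀)) := by gcongr
        _ = 2 * (μ ^ σ * b ^ (-σ) + μ ^ σ * (K₀ * t₁ ^ p₀)) := by ring
        _ ≤ 2 * (1 + B * (K₀ * t₁ ^ p₀)) := by gcongr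
        _ ≤ _ := by
            have : 1 ≤ B * K₀ * t₁ ^ p₀ := one_le_mul_of_one_le_of_one_le
              (one_le_mul_of_one_le_of_one_le hB hK₀) hp3
            linarith
    calc _ ≤ μ ^ σ * 16 * (K₀ * w.im ^ p₀ +
          K₁ * (t₁ * w.im) ^ p₁ * Real.exp (Real.pi * D) * ‖dualTerm a (σ + t₁ * Complex.I)‖) := by
          gcongr
          linarith
      _ = 16 * (μ ^ σ * (K₀ * w.im ^ p₀)) + 16 * (K₁ * (t₁ * w.im) ^ p₁ * Real.exp (Real.pi * D) *
          (μ ^ σ * ‖dualTerm a (σ + t₁ * Complex.I)‖)) := by ring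
      _ ≤ 16 * (B * (K₀ * P)) * Real.exp (Real.pi * D) + 16 * (K₁ * (t₁ * w.im) ^ p₁ *
          Real.exp (Real.pi * D) * (4 * B * K₀ * t₁ ^ p₀)) := by
          refine add_le_add ?_ (by gcongr)
          calc _ ≤ 16 * (B * (K₀ * P)) * 1 := by rw [mul_one]; gcongr
            _ ≤ _ := by gcongr
      _ = (16 * B * K₀ * P + 64 * B * K₁ * K₀ * ((t₁ * w.im) ^ p₁ * t₁ ^ p₀)) *
          Real.exp (Real.pi * D) := by ring
      _ ≤ (16 * B * K₀ * P + 64 * B * K₁ * K₀ * P) * Real.exp (Real.pi * D) := by gcongr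
      _ = _ := by ring

/-! ### The averaged function attached to a short interval -/

theorem cpow_mul_lerchSeries (z : ℂ) {μ : ℝ} (hμ : 0 < μ) (e : ℝ) (s : ℂ) :
    (μ : ℂ) ^ s * (z * lerchSeries e μ s) =
      progressionSeries (fun n => z * unitExp e ^ n) (1 / μ) s := by
  rw [lerchSeries, progressionSeries, ← tsum_mul_left, ← tsum_mul_left]
  refine tsum_congr fun n => ?_
  have hpos : 0 < 1 + n * (1 / μ) := by positivity
  have h1 : (n + μ : ℝ) = μ * (1 + n * (1 / μ)) := by field_simp; ring
  have hμ0 : (μ : ℂ) ≠ 0 := by exact_mod_cast hμ.ne'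
  rw [h1, Complex.ofReal_mul, Complex.mul_cpow_ofReal_nonneg hμ.le hpos.le, Complex.cpow_neg (μ : ℂ)]
  have : (μ : ℂ) ^ s ≠ 0 := by simp [Complex.cpow_eq_zero_iff, hμ0]
  field_simp

/-- On vertical lines `x ^ w` has period `2 π / log x`; the segment has length `2 r`, which is `k`
periods. -/
theorem integral_cpow_vertical_eq_zero {x r : ℝ} (hx : 0 < x) {k : ℕ} (hk : k ≠ 0)
    (h : r * Real.log x = Real.pi * k) (w : ℂ) :
    ∫ v in (0:ℝ)..1, (x : ℂ) ^ (w + ((2 * v - 1) * r : ℝ) * Complex.I) = 0 := by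
  have hx0 : (x : ℂ) ≠ 0 := by exact_mod_cast hx.ne'
  have hc : (2 * Real.pi * k * Complex.I : ℂ) ≠ 0 := by
    have : (Real.pi : ℂ) ≠ 0 := by exact_mod_cast Real.pi_ne_zero
    have : (k : ℂ) ≠ 0 := by exact_mod_cast hk
    simp [*]
  have e : ∀ v : ℝ, (x : ℂ) ^ (w + ((2 * v - 1) * r : ℝ) * Complex.I) =
      (x : ℂ) ^ w * Complex.exp (-(Real.pi * k * Complex.I)) *
        Complex.exp ((2 * Real.pi * k * Complex.I) * v) := by
    intro v
    rw [Complex.cpow_add _ _ hx0, mul_assoc, ← Complex.exp_add,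
      Complex.cpow_def_of_ne_zero hx0 (((2 * v - 1) * r : ℝ) * Complex.I), ← Complex.ofReal_log hx.le]
    congr 2
    have h' : (r : ℂ) * (Real.log x : ℂ) = Real.pi * k := by exact_mod_cast h
    push_cast
    linear_combination (2 * v - 1) * Complex.I * h'
  simp_rw [e]
  rw [intervalIntegral.integral_const_mul, integral_exp_mul_complex hc]
  have h2 : Complex.exp (2 * Real.pi * k * Complex.I * (1:ℝ)) = 1 := by
    rw [show (2 * Real.pi * k * Complex.I * (1:ℝ) : ℂ) = k * (2 * Real.pi * Complex.I) by
      push_cast; ring]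
    exact Complex.exp_nat_mul_two_pi_mul_I k
  rw [h2]
  simp

theorem IsLerchZeta.continuousOn_vertical {a b : ℝ} {F : ℂ → ℂ} (hF : IsLerchZeta a b F) (σ : ℝ) :
    ContinuousOn (fun t : ℝ => ‖F (σ + t * Complex.I)‖) (Ioi 0) := by
  refine (hF.differentiableOn.continuousOn.comp (f := fun t : ℝ => (σ + t * Complex.I : ℂ))
    (by fun_prop) fun t ht h => ?_).norm
  have ht0 : 0 < t := ht
  have := congrArg Complex.im (show (σ + t * Complex.I : ℂ) = 1 from h)
  simp at this
  linarith

theorem IsLerchZeta.norm_integral_vertical_le {a b : ℝ} {F : ℂ → ℂ} (hF : IsLerchZeta a b F)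
    {μ B σ r y T T' : ℝ} (hμ : 0 < μ) (hB : μ ^ σ ≤ B) (hr : 0 < r) (hT : 0 < T) (h1 : T ≤ y - r)
    (h2 : y + r ≤ T') :
    ‖∫ v in (0:ℝ)..1, (μ : ℂ) ^ ((σ + y * Complex.I) + ((2 * v - 1) * r : ℝ) * Complex.I) *
      F ((σ + y * Complex.I) + ((2 * v - 1) * r : ℝ) * Complex.I)‖ ≤
      B / (2 * r) * ∫ t in T..T', ‖F (σ + t * Complex.I)‖ := by
  have hc := hF.continuousOn_vertical σ
  have hii : ∀ x z : ℝ, T ≤ x → x ≤ z →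
      IntervalIntegrable (fun t : ℝ => ‖F (σ + t * Complex.I)‖) volume x z := fun x z hx hxz => by
    refine (hc.mono fun t ht => ?_).intervalIntegrable
    rw [uIcc_of_le hxz] at ht
    exact hT.trans_le (hx.trans ht.1)
  have e : ∀ v : ℝ, (σ + y * Complex.I : ℂ) + ((2 * v - 1) * r : ℝ) * Complex.I =
      σ + (y + (2 * v - 1) * r : ℝ) * Complex.I := fun v => by push_cast; ring
  have hn : ∀ v : ℝ, ‖(μ : ℂ) ^ ((σ + y * Complex.I) + ((2 * v - 1) * r : ℝ) * Complex.I) *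
      F ((σ + y * Complex.I) + ((2 * v - 1) * r : ℝ) * Complex.I)‖ =
      μ ^ σ * ‖F (σ + (y + (2 * v - 1) * r : ℝ) * Complex.I)‖ := fun v => by
    rw [norm_mul, Complex.norm_cpow_eq_rpow_re_of_pos hμ, e]
    simp
  refine (intervalIntegral.norm_integral_le_integral_norm zero_le_one).trans ?_
  simp_rw [hn]
  have h3 := integral_vertical_eq (f := fun t : ℝ => ‖F (σ + t * Complex.I)‖) hr y
  rw [intervalIntegral.integral_const_mul, h3]
  have h4 : ∫ t in (y - r)..(y + r), ‖F (σ + t * Complex.I)‖ ≤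
      ∫ t in T..T', ‖F (σ + t * Complex.I)‖ :=
    intervalIntegral.integral_mono_interval h1 (by linarith) h2
      (ae_of_all _ fun t => norm_nonneg _) (hii _ _ le_rfl (by linarith))
  have h5 : 0 ≤ ∫ t in T..T', ‖F (σ + t * Complex.I)‖ :=
    intervalIntegral.integral_nonneg (by linarith) fun t _ => norm_nonneg _
  have h6 : 0 ≤ μ ^ σ := by positivity
  calc _ ≤ B * ((2 * r)⁻¹ * ∫ t in T..T', ‖F (σ + t * Complex.I)‖) :=
          mul_le_mul hB (mul_le_mul_of_nonneg_left h4 (by positivity))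
            (mul_nonneg (by positivity) (intervalIntegral.integral_nonneg (by linarith)
              fun t _ => norm_nonneg _)) (h6.trans hB)
    _ = _ := by ring

set_option maxHeartbeats 2000000 in
/-- For every short interval, either the mean value of `|F|` over it is bounded below, or there is
a normalized series `g` which is small on a segment if this mean value is small. If `re s < 0` and
`b` is tiny the first term `b ^ (-s)` is removed by averaging over a multiple of its period. -/
theorem IsLerchZeta.exists_average {κ : ℝ} (hκ : 0 < κ) (hκ1 : κ ≤ 1 / 10) :
    ∃ B K : ℝ, 1 ≤ B ∧ 1 ≤ K ∧ ∃ p : ℕ, ∀ (a b : ℝ) (F : ℂ → ℂ) (σ T H : ℝ), |a| ≤ 1 / 2 → 0 < b →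
    b ≤ 1 → IsLerchZeta a b F → -1 ≤ σ → σ ≤ 26 / 15 → 16 ≤ T → 0 < H → H ≤ T → (σ < 0 → 1 ≤ H) →
    κ * H ≤ (∫ t in T..(T + H), ‖F (σ + t * Complex.I)‖) ∨
    ∃ (g : ℂ → ℂ) (c : ℕ → ℂ) (q d : ℝ), 1 / 2 ≤ q ∧ (∀ n, ‖c n‖ ≤ 1) ∧
      (d = 11 / 15 ∨ d = 2 ∧ 1 ≤ H) ∧ DifferentiableOn ℂ g {s | 1 < s.re ∨ |s.im| < T} ∧
      (∀ s : ℂ, 1 < s.re → g s = progressionSeries c q s) ∧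
      (∀ x : ℝ, 1 + d ≤ x → 2 / 1000 ≤ ‖g x‖) ∧
      (∀ s : ℂ, s.re = 1 - max (1 - σ) 0 → |s.im| ≤ (1 - 3 * κ) * H / 2 →
        ‖g s‖ ≤ B / (κ * H) * ∫ t in T..(T + H), ‖F (σ + t * Complex.I)‖) ∧
      ∀ (s : ℂ) (D : ℝ), 0 ≤ D → D ≤ 10 → 1 - max (1 - σ) 0 ≤ s.re →
        |s.im| ≤ (1 - 3 * κ) * H / 2 + D → ‖g s‖ ≤ K * T ^ p * Real.exp (Real.pi * D) := by
  obtain ⟨K, hK, p, hdich⟩ := IsLerchZeta.large_or_polynomial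
  have hpi := Real.pi_pos
  set B : ℝ := Real.exp (2 * Real.pi / κ) with hBdef
  have hB : 1 ≤ B := Real.one_le_exp (by positivity)
  refine ⟨B, 1 + 2 + B * K * 6 ^ p, hB, by have : 0 ≤ B * K * 6 ^ p := by positivity
                                           linarith, 2 * p, ?_⟩
  intro a b F σ T H ha hb hb1 hF hσ hσ2 hT hH hHT hσH
  rcases hdich a b F σ T (T + κ * H) ha hb hb1 hF hσ (by linarith) (by linarith) with hbig | hpoly
  · left
    have hκH : κ * H ≤ H := by nlinarith
    have hκH0 : 0 < κ * H := by positivity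
    have hc := hF.continuousOn_vertical σ
    have hii : ∀ z : ℝ, T ≤ z →
        IntervalIntegrable (fun t : ℝ => ‖F (σ + t * Complex.I)‖) volume T z := fun z hz => by
      refine (hc.mono fun t ht => ?_).intervalIntegrable
      rw [uIcc_of_le hz] at ht
      have : 0 < t := by linarith [ht.1]
      exact this
    calc κ * H = ∫ t in T..(T + κ * H), (1:ℝ) := by simp
      _ ≤ ∫ t in T..(T + κ * H), ‖F (σ + t * Complex.I)‖ :=
          intervalIntegral.integral_mono_on (by linarith) intervalIntegrable_const
            (hii _ (by linarith)) hbig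
      _ ≤ _ := intervalIntegral.integral_mono_interval le_rfl (by linarith) (by linarith)
          (ae_of_all _ fun t => norm_nonneg _) (hii _ (by linarith))
  right
  obtain ⟨t₁, ht₁, hgrow⟩ := hpoly
  set e₀ : ℝ := max (σ - 1) 0 with he₀
  have he₀0 : 0 ≤ e₀ := le_max_right _ _
  have heσ : 1 - max (1 - σ) 0 + e₀ = σ := by
    rw [he₀]
    rcases le_total σ 1 with h | h
    · rw [max_eq_left (by linarith), max_eq_right (by linarith)]; ring
    · rw [max_eq_right (by linarith), max_eq_left (by linarith)]; ring
  have he₀1 : e₀ ≤ 11 / 15 := max_le (by linarith) (by norm_num)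
  set t₀ : ℝ := T + (1 + κ) * H / 2 with ht₀
  set z₀ : ℂ := ⟨e₀, t₀⟩ with hz₀
  set X : ℝ := (1 - 3 * κ) * H / 2 with hX
  have hκH : 0 < κ * H := by positivity
  set J : ℝ := ∫ t in T..(T + H), ‖F (σ + t * Complex.I)‖ with hJ
  have hJ0 : 0 ≤ J := intervalIntegral.integral_nonneg (by linarith) fun t _ => norm_nonneg _
  -- `u` is the normalization of `F` that is averaged: `b ^ w * F w`, or, if `b` is tiny and `σ < 0`,
  -- `(1 + b) ^ w * (F w - b ^ (-w))`
  have main : ∀ (μ r : ℝ) (u : ℂ → ℂ) (c : ℕ → ℂ) (q d : ℝ), 0 < μ → μ ≤ 2 → μ ^ σ ≤ B →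
      μ ^ σ * b ^ (-σ) ≤ 1 → κ * H / 2 ≤ r → r ≤ κ * H → DifferentiableOn ℂ u {1}ᶜ → 1 / 2 ≤ q →
      (∀ n, ‖c n‖ ≤ 1) → ‖c 0‖ = 1 → 1 < 1 + d → (∀ x : ℝ, 1 + d ≤ x → ∀ N : ℕ,
        ∑ n ∈ Finset.range N, (1 + (n + 1 : ℕ) * q) ^ (-x) ≤ 1 - 2 / 1000) →
      (d = 11 / 15 ∨ d = 2 ∧ 1 ≤ H) →
      (∀ s : ℂ, 1 < s.re → u s = progressionSeries c q s) →
      (∀ w : ℂ, ‖u w‖ ≤ 1 + μ ^ w.re * ‖F w - (b : ℂ) ^ (-w)‖) →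
      (∀ y : ℝ, 1 ≤ y - r → verticalAverage u 0 r (σ + y * Complex.I) = ∫ v in (0:ℝ)..1,
        (μ : ℂ) ^ ((σ + y * Complex.I) + ((2 * v - 1) * r : ℝ) * Complex.I) *
        F ((σ + y * Complex.I) + ((2 * v - 1) * r : ℝ) * Complex.I)) →
      ∃ (g : ℂ → ℂ) (c : ℕ → ℂ) (q d : ℝ), 1 / 2 ≤ q ∧ (∀ n, ‖c n‖ ≤ 1) ∧
      (d = 11 / 15 ∨ d = 2 ∧ 1 ≤ H) ∧ DifferentiableOn ℂ g {s | 1 < s.re ∨ |s.im| < T} ∧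
      (∀ s : ℂ, 1 < s.re → g s = progressionSeries c q s) ∧
      (∀ x : ℝ, 1 + d ≤ x → 2 / 1000 ≤ ‖g x‖) ∧
      (∀ s : ℂ, s.re = 1 - max (1 - σ) 0 → |s.im| ≤ X → ‖g s‖ ≤ B / (κ * H) * J) ∧
      ∀ (s : ℂ) (D : ℝ), 0 ≤ D → D ≤ 10 → 1 - max (1 - σ) 0 ≤ s.re → |s.im| ≤ X + D →
        ‖g s‖ ≤ (1 + 2 + B * K * 6 ^ p) * T ^ (2 * p) * Real.exp (Real.pi * D) := by
    intro μ r u c q d hμ hμ2 hμB hμb hr1 hr2 hud hq hc hc0 hd1 htail hd hus hun huavg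
    have hr0 : 0 < r := by linarith
    obtain ⟨c', hc', hc'0, hg⟩ := verticalAverage_eq_progressionSeries hq hc hus r
      (z₀ := z₀) he₀0
    refine ⟨verticalAverage u z₀ r, c', q, d, hq, hc', hd,
      differentiableOn_verticalAverage hud hr0.le he₀0 ?_, hg, fun x hx => ?_, fun s hs hi => ?_,
      fun s D hD hD10 hs hi => ?_⟩
    · change T + r ≤ t₀
      rw [ht₀]; nlinarith
    · rw [hg x (by simpa using (show 1 < x by linarith))]
      exact le_norm_progressionSeries hq hc' (by rw [hc'0, hc0]) (by linarith) (htail x hx)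
    · have hi' := abs_le.1 hi
      set y : ℝ := s.im + t₀ with hy
      have hsz : s + z₀ = σ + y * Complex.I := by
        apply Complex.ext
        · simp [hz₀, hs]; linarith
        · simp [hz₀, hy]
      have hy1 : T + κ * H ≤ y - r := by rw [hy, ht₀]; rw [hX] at hi'; nlinarith
      have hy2 : y + r ≤ T + H := by rw [hy, ht₀]; rw [hX] at hi'; nlinarith
      have h1 : verticalAverage u z₀ r s = verticalAverage u 0 r (σ + y * Complex.I) := by
        simp only [verticalAverage, hsz, add_zero]
      rw [h1, huavg y (by linarith)]
      refine (hF.norm_integral_vertical_le hμ hμB hr0 (by linarith : 0 < T) (by linarith) hy2).trans ?_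
      exact mul_le_mul_of_nonneg_right
        (div_le_div_of_nonneg_left (by linarith) hκH (by linarith)) hJ0
    · have hi' := abs_le.1 hi
      have hexp : 1 ≤ Real.exp (Real.pi * D) := Real.one_le_exp (by positivity)
      have hTp : 1 ≤ T ^ (2 * p) := one_le_pow₀ (by linarith)
      have hBK : 0 ≤ B * K * 6 ^ p := by positivity
      by_cases hs2 : 2 ≤ s.re
      · rw [hg s (by linarith)]
        refine (norm_progressionSeries_le hq hc' (w := 1) one_pos (by linarith)).trans ?_
        have h1 : 1 ≤ T ^ (2 * p) * Real.exp (Real.pi * D) :=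
          one_le_mul_of_one_le_of_one_le hTp hexp
        nlinarith
      · push Not at hs2
        refine norm_verticalAverage_le hr0.le fun w hw1 hw2 => ?_
        have hw1' : w.re = s.re + e₀ := hw1
        have hw2' := abs_le.1 (show |w.im - (s.im + t₀)| ≤ r from hw2)
        have hwl : T + κ * H - D ≤ w.im := by rw [ht₀] at hw2'; rw [hX] at hi'; nlinarith
        have hwu : w.im ≤ T + H + D := by rw [ht₀] at hw2'; rw [hX] at hi'; nlinarith
        have h1 := hgrow μ B D w hμ hμ2 hB hμB hμb (by linarith) (by linarith) (by linarith)
          (by linarith [ht₁.2]) hD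
        have ht1 : t₁ ≤ 2 * T := by have := ht₁.2; nlinarith
        have ht0 : 0 < t₁ := by linarith [ht₁.1]
        have hw0 : 0 < w.im := by linarith
        have h2 : (t₁ * w.im) ^ p ≤ 6 ^ p * T ^ (2 * p) := by
          rw [pow_mul, ← mul_pow]
          refine pow_le_pow_left₀ (by positivity) ?_ p
          calc t₁ * w.im ≤ 2 * T * (3 * T) := by gcongr; linarith
            _ = _ := by ring
        calc ‖u w‖ ≤ 1 + B * K * (t₁ * w.im) ^ p * Real.exp (Real.pi * D) := by
              linarith [hun w]
          _ ≤ 1 * 1 + B * K * (6 ^ p * T ^ (2 * p)) * Real.exp (Real.pi * D) := by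
              rw [one_mul]; gcongr
          _ ≤ (1 + 2) * (T ^ (2 * p) * Real.exp (Real.pi * D)) +
              B * K * (6 ^ p * T ^ (2 * p)) * Real.exp (Real.pi * D) := by
              gcongr
              · norm_num
              · exact one_le_mul_of_one_le_of_one_le hTp hexp
          _ = _ := by ring
  have hcpow : ∀ μ : ℝ, 0 < μ → Differentiable ℂ fun w : ℂ => (μ : ℂ) ^ w := fun μ hμ w =>
    DifferentiableAt.const_cpow differentiableAt_id (Or.inl (by exact_mod_cast hμ.ne'))
  have hcn : ∀ n : ℕ, ‖unitExp a ^ n‖ = 1 := fun n => by rw [norm_pow, norm_unitExp, one_pow]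
  have hFs : ∀ s : ℂ, 1 < s.re → F s = lerchSeries a b s := fun s hs => by
    rw [hF.eq_tsum s hs, lerchSeries_eq_tsum_div]
  have hbne : ∀ w : ℂ, ‖(b : ℂ) ^ w * (b : ℂ) ^ (-w)‖ = 1 := fun w => by
    rw [← Complex.cpow_add _ _ (by exact_mod_cast hb.ne'), add_neg_cancel, Complex.cpow_zero, norm_one]
  by_cases hcase : 0 ≤ σ ∨ Real.exp (-(2 * Real.pi / κ)) ≤ b
  · refine main b (κ * H / 2) (fun w => (b : ℂ) ^ w * F w) (fun n => 1 * unitExp a ^ n) (1 / b) (11 / 15) hb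
      (by linarith) ?_ ?_ le_rfl (by linarith) ((hcpow b hb).differentiableOn.mul hF.differentiableOn)
      ?_ (fun n => by rw [one_mul, hcn]) (by simp) (by norm_num) ?_ (Or.inl rfl) ?_ ?_ ?_
    · rcases hcase with h | h
      · exact (Real.rpow_le_one hb.le hb1 h).trans hB
      · by_cases h0 : 0 ≤ σ
        · exact (Real.rpow_le_one hb.le hb1 h0).trans hB
        · push Not at h0
          calc b ^ σ ≤ b ^ (-1 : ℝ) :=
                Real.rpow_le_rpow_of_exponent_ge hb hb1 hσ
            _ = b⁻¹ := by rw [Real.rpow_neg_one]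
            _ ≤ (Real.exp (-(2 * Real.pi / κ)))⁻¹ := by gcongr
            _ = B := by rw [Real.exp_neg, inv_inv]
    · rw [← Real.rpow_add hb]; simp
    · have := one_le_one_div hb hb1; linarith
    · intro x hx N
      exact sum_progression_rpow_le_of_one_le (one_le_one_div hb hb1) (by linarith) N
    · intro s hs
      have := cpow_mul_lerchSeries 1 hb a s
      rw [← this, hFs s hs, one_mul]
    · intro w
      have e : (b : ℂ) ^ w * F w = (b : ℂ) ^ w * (b : ℂ) ^ (-w) +
          (b : ℂ) ^ w * (F w - (b : ℂ) ^ (-w)) := by ring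
      rw [e]
      refine (norm_add_le _ _).trans ?_
      rw [hbne, norm_mul, Complex.norm_cpow_eq_rpow_re_of_pos hb]
    · intro y _
      simp only [verticalAverage, add_zero]
  · push Not at hcase
    obtain ⟨hσ0, hbs⟩ := hcase
    have hH1 := hσH hσ0
    set x : ℝ := (1 + b) / b with hx
    have hx1 : 1 / b ≤ x := by rw [hx]; gcongr; linarith
    have hlog : 2 * Real.pi / κ ≤ Real.log x := by
      rw [Real.le_log_iff_exp_le (by positivity)]
      refine le_trans ?_ hx1
      rw [one_div, ← inv_inv (Real.exp _), ← Real.exp_neg]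
      gcongr
    have hlog0 : 0 < Real.log x := lt_of_lt_of_le (by positivity) hlog
    set k : ℕ := ⌊κ * H * Real.log x / Real.pi⌋₊ with hk
    have hkle : (k : ℝ) ≤ κ * H * Real.log x / Real.pi := Nat.floor_le (by positivity)
    have hklt : κ * H * Real.log x / Real.pi < k + 1 := Nat.lt_floor_add_one _
    rw [le_div_iff₀ hpi] at hkle
    rw [div_lt_iff₀ hpi] at hklt
    have hlog2 : 2 * Real.pi ≤ κ * H * Real.log x := by
      have : 2 * Real.pi ≤ κ * Real.log x := by
        rw [div_le_iff₀ hκ] at hlog; linarith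
      nlinarith [mul_pos hκ hlog0]
    have hk0 : k ≠ 0 := by
      intro h0
      rw [h0] at hklt
      push_cast at hklt
      linarith
    set r : ℝ := Real.pi * k / Real.log x with hr
    have hrx : r * Real.log x = Real.pi * k := by rw [hr]; field_simp
    have hb2 : 0 < 1 + b := by linarith
    refine main (1 + b) r (fun w => ((1 + b : ℝ) : ℂ) ^ w * (F w - (b : ℂ) ^ (-w)))
      (fun n => unitExp a * unitExp a ^ n) (1 / (1 + b)) 2 hb2 (by linarith) ?_ ?_ ?_ ?_ ?_ ?_
      (fun n => by rw [norm_mul, norm_unitExp, hcn, mul_one]) (by simp [norm_unitExp]) (by norm_num) ?_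
      (Or.inr ⟨rfl, hH1⟩) ?_ ?_ ?_
    · exact (Real.rpow_le_one_of_one_le_of_nonpos (by linarith) hσ0.le).trans hB
    · exact mul_le_one₀ (Real.rpow_le_one_of_one_le_of_nonpos (by linarith) hσ0.le) (by positivity)
        (Real.rpow_le_one hb.le hb1 (by linarith))
    · rw [hr, le_div_iff₀ hlog0]
      nlinarith
    · rw [hr, div_le_iff₀ hlog0]
      linarith
    · exact (hcpow _ hb2).differentiableOn.mul
        (hF.differentiableOn.sub (differentiable_ofReal_cpow_neg hb).differentiableOn)
    · rw [div_le_div_iff₀ (by norm_num) hb2]; linarith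
    · intro y hy N
      exact sum_progression_rpow_le_of_three_le (by
        rw [div_le_div_iff₀ (by norm_num) hb2]; linarith) (by linarith) N
    · intro s hs
      rw [← cpow_mul_lerchSeries (unitExp a) hb2 a s, hFs s hs, lerchSeries_eq_add hb hs,
        add_sub_cancel_left, add_comm b 1]
    · intro w
      rw [norm_mul, Complex.norm_cpow_eq_rpow_re_of_pos hb2]
      linarith
    · intro y hy
      have hr0 : 0 < r := by
        have : (0:ℝ) < k := by exact_mod_cast Nat.pos_of_ne_zero hk0
        positivity
      set w : ℝ → ℂ := fun v => (σ + y * Complex.I) + ((2 * v - 1) * r : ℝ) * Complex.I with hw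
      have hwc : Continuous w := by simp only [hw]; fun_prop
      have hsplit : ∀ v, ((1 + b : ℝ) : ℂ) ^ w v * (F (w v) - (b : ℂ) ^ (-(w v))) =
          ((1 + b : ℝ) : ℂ) ^ w v * F (w v) - (x : ℂ) ^ w v := by
        intro v
        rw [mul_sub, hx, Complex.ofReal_div, Complex.div_cpow_ofReal_nonneg hb2.le hb.le,
          Complex.cpow_neg, div_eq_mul_inv]
      have hz := integral_cpow_vertical_eq_zero (x := x) (by positivity) hk0 hrx (σ + y * Complex.I)
      have hwim : ∀ v : ℝ, (w v).im = y + (2 * v - 1) * r := fun v => by simp [hw]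
      have hi1 : IntervalIntegrable (fun v => ((1 + b : ℝ) : ℂ) ^ w v * F (w v)) volume 0 1 := by
        refine ContinuousOn.intervalIntegrable (ContinuousOn.mul ?_ ?_)
        · exact ((hcpow _ hb2).continuous.comp hwc).continuousOn
        · refine hF.differentiableOn.continuousOn.comp hwc.continuousOn fun v hv h => ?_
          rw [uIcc_of_le zero_le_one] at hv
          have h1 := congrArg Complex.im (show w v = 1 from h)
          rw [hwim, Complex.one_im] at h1
          nlinarith [hv.1]
      have hi2 : IntervalIntegrable (fun v => (x : ℂ) ^ w v) volume 0 1 :=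
        ((hcpow x (by positivity)).continuous.comp hwc).intervalIntegrable _ _
      have h1 : verticalAverage (fun w => ((1 + b : ℝ) : ℂ) ^ w * (F w - (b : ℂ) ^ (-w))) 0 r
          (σ + y * Complex.I) = ∫ v in (0:ℝ)..1,
            (((1 + b : ℝ) : ℂ) ^ w v * F (w v) - (x : ℂ) ^ w v) := by
        refine intervalIntegral.integral_congr fun v _ => ?_
        rw [← hsplit]
        simp only [hw, add_zero]
      rw [h1, intervalIntegral.integral_sub hi1 hi2, hz, sub_zero]

/-! ### Comparison of the exponents -/

/-- A lower bound for the mean value, as a function of the length `H` of the interval and of `ε`.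
For `H ≥ 1` it is `H` itself, however small the second member of the minimum is. -/
noncomputable def lowerBound (H ε : ℝ) : ℝ :=
  if 1 ≤ H then H else min H ((H / 200) ^ (7 / (6 * H * ε)))

theorem lowerBound_of_one_le {H : ℝ} (hH : 1 ≤ H) (ε : ℝ) : lowerBound H ε = H := if_pos hH

theorem lowerBound_of_lt_one {H : ℝ} (hH : H < 1) (ε : ℝ) :
    lowerBound H ε = min H ((H / 200) ^ (7 / (6 * H * ε))) := if_neg hH.not_ge

theorem lowerBound_le_left (H ε : ℝ) : lowerBound H ε ≤ H := by
  rw [lowerBound]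
  split_ifs
  exacts [le_rfl, min_le_left _ _]

theorem min_le_lowerBound (H ε : ℝ) :
    min H ((H / 200) ^ (7 / (6 * H * ε))) ≤ lowerBound H ε := by
  rw [lowerBound]
  split_ifs
  exacts [min_le_left _ _, le_rfl]

theorem lowerBound_nonneg {H : ℝ} (hH : 0 < H) (ε : ℝ) : 0 ≤ lowerBound H ε :=
  (le_min hH.le (by positivity)).trans (min_le_lowerBound H ε)

theorem lowerBound_le_mul_exp_neg {H ε Q : ℝ} (hH : 0 < H) (hH1 : H < 1)
    (hQ : Q ≤ 7 / (6 * H * ε) * Real.log (200 / H) + Real.log H) :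
    lowerBound H ε ≤ H * Real.exp (-Q) := by
  rw [lowerBound_of_lt_one hH1]
  refine (min_le_right _ _).trans ?_
  rw [Real.rpow_def_of_pos (by positivity)]
  nth_rewrite 3 [← Real.exp_log hH]
  rw [← Real.exp_add]
  refine Real.exp_le_exp.2 ?_
  rw [Real.log_div hH.ne' (by norm_num)]
  rw [Real.log_div (by norm_num) hH.ne'] at hQ
  linarith

/-- The comparison theorems need `δ > 0`, whereas the bound `δ₀` they are applied to is an integral
that is not yet known to be positive. -/
theorem le_of_forall_between {E δ₀ : ℝ} (hE : 0 < E) (hE1 : E ≤ 1)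
    (h : ∀ δ, 0 < δ → δ ≤ 1 → δ₀ ≤ δ → E ≤ δ) : E ≤ δ₀ := by
  by_contra hc
  push Not at hc
  have h1 := h (max δ₀ (E / 2)) (lt_max_of_lt_right (by linarith)) (max_le (by linarith) (by linarith))
    (le_max_left _ _)
  have h2 : max δ₀ (E / 2) < E := max_lt hc (by linarith)
  linarith

/-- The slack between `7 / 6` and `11 π / 30` absorbs all constants when `H` is small. -/
theorem exponent_le_of_small {M H ε y P : ℝ} (hM : 1 ≤ M) (hH : 0 < H) (hε : 0 < ε) (hε1 : ε ≤ 1)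
    (hM2 : 300 * Real.log M ≤ y) (hHy : y = -Real.log H) (hH2 : H ≤ 1 / 1600)
    (hP : P ≤ 1158 / 1000 / (H * ε) + 8 / 5) :
    P * (Real.log M + y) ≤ 7 / (6 * H * ε) * Real.log (200 / H) + Real.log H := by
  have hHε : 0 < H * ε := by positivity
  have hlM : 0 ≤ Real.log M := Real.log_nonneg hM
  have hy : 0 ≤ y := by linarith
  have h1 : 1 ≤ 1 / 1600 / (H * ε) := by
    rw [le_div_iff₀ hHε, one_mul]
    calc H * ε ≤ H * 1 := by gcongr
      _ ≤ _ := by linarith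
  set w : ℝ := 1 / (H * ε) with hw
  have hw0 : 0 < w := by positivity
  have e1 : (1158 / 1000 / (H * ε)) = 1158 / 1000 * w := by rw [hw]; ring
  have e2 : 1 / 1600 / (H * ε) = 1 / 1600 * w := by rw [hw]; ring
  have e3 : 7 / (6 * H * ε) = 7 / 6 * w := by rw [hw]; field_simp
  rw [e1] at hP
  rw [e2] at h1
  have hP2 : P ≤ 1159 / 1000 * w := by linarith
  have h200 : 0 ≤ Real.log 200 := Real.log_nonneg (by norm_num)
  have hlH : Real.log H = -y := by linarith
  rw [e3, Real.log_div (by norm_num) hH.ne', hlH]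
  calc P * (Real.log M + y) ≤ 1159 / 1000 * w * (y / 300 + y) :=
        mul_le_mul hP2 (by linarith) (by linarith) (by positivity)
    _ ≤ 7 / 6 * w * (0 - -y) - 1 / 1600 * w * y := by nlinarith [mul_nonneg hw0.le hy]
    _ ≤ 7 / 6 * w * (Real.log 200 - -y) + -y := by
        nlinarith [mul_nonneg hw0.le h200, mul_nonneg (sub_nonneg.2 h1) hy]

theorem one_le_log_log {T : ℝ} (hT : 16 ≤ T) : 1 ≤ Real.log (Real.log T) := by
  have h1 : Real.exp 1 ≤ Real.log T := by
    refine le_trans ?_ (Real.log_le_log (by norm_num) hT)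
    rw [show (16:ℝ) = 2 ^ 4 by norm_num, Real.log_pow]
    have := Real.log_two_gt_d9
    have := Real.exp_one_lt_d9
    push_cast
    linarith
  rw [Real.le_log_iff_exp_le (lt_of_lt_of_le (Real.exp_pos 1) h1)]
  exact h1

theorem strip_width_mul_le {σ H ε L : ℝ} (hL : 0 < L) (hH : 0 < H) (hε1 : ε ≤ 1)
    (h : 1 - Real.pi * H * (1 - ε) / (4 * L) ≤ σ) :
    max (1 - σ) 0 * L ≤ Real.pi * H * (1 - ε) / 4 := by
  have h0 : 0 ≤ Real.pi * H * (1 - ε) / 4 := by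
    have := Real.pi_pos
    have : 0 ≤ 1 - ε := by linarith
    positivity
  rcases le_total (1 - σ) 0 with h1 | h1
  · rw [max_eq_right h1, zero_mul]; exact h0
  · rw [max_eq_left h1]
    have h2 : 1 - σ ≤ Real.pi * H * (1 - ε) / 4 / L := by rw [div_div]; linarith
    rwa [le_div_iff₀ hL] at h2

theorem one_le_of_strip {σ H ε L : ℝ} (hL : 1 ≤ L) (hH : 0 < H) (hε : 0 < ε) (hε1 : ε ≤ 1)
    (h : 1 - Real.pi * H * (1 - ε) / (4 * L) ≤ σ) (hσ : σ < 0) : 1 ≤ H := by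
  have h1 := strip_width_mul_le (by linarith) hH hε1 h
  have h2 : 1 ≤ max (1 - σ) 0 * L :=
    one_le_mul_of_one_le_of_one_le (le_max_of_le_left (by linarith)) hL
  have h3 := Real.pi_lt_four
  have h4 := Real.pi_pos
  have h5 : Real.pi * H * (1 - ε) ≤ Real.pi * H * 1 :=
    mul_le_mul_of_nonneg_left (by linarith) (by positivity)
  have h6 : Real.pi * H ≤ 4 * H := by gcongr
  linarith

/-! ### Lower bounds in the strip `-1 ≤ re s ≤ 26 / 15` -/

set_option maxHeartbeats 2000000 in
/-- The case of large `T`, from the comparison in the half-plane with a pocket. The parameter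
`κ = 1 / 2000` is small enough for `11 π / 30` to stay below `7 / 6` after all losses. -/
theorem IsLerchZeta.lowerBound_le_integral_of_large : ∃ T₁ c : ℝ, 0 < c ∧
    ∀ (a b : ℝ) (F : ℂ → ℂ) (σ T H ε : ℝ), |a| ≤ 1 / 2 → 0 < b → b ≤ 1 → IsLerchZeta a b F →
    -1 ≤ σ → σ ≤ 26 / 15 → 16 ≤ T → T₁ ≤ T → 0 < H → H ≤ T → 0 < ε → ε ≤ 1 →
    1 - Real.pi * H * (1 - ε) / (4 * Real.log (Real.log T)) ≤ σ →
    c * lowerBound H ε ≤ ∫ t in T..(T + H), ‖F (σ + t * Complex.I)‖ := by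
  obtain ⟨B, K, hB, hK, p, havg⟩ := IsLerchZeta.exists_average (κ := 1 / 2000) (by norm_num)
    (by norm_num)
  have hlK : 0 ≤ Real.log K := Real.log_nonneg hK
  obtain ⟨C, hC, hpot⟩ := exp_neg_le_of_norm_le (κ := 1 / 2000) (A := Real.log K + p)
    (c₁ := 2 / 1000) (by norm_num) (by norm_num) (by positivity) (by norm_num)
  have hpi3 := Real.pi_gt_three
  have hpi4 := Real.pi_lt_d4
  set M : ℝ := 2 * C with hM
  have hM2 : 2 ≤ M := by linarith
  have hlM : 0 ≤ Real.log M := Real.log_nonneg (by linarith)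
  set H₀ : ℝ := min (1 / 1600) (Real.exp (-(300 * Real.log M))) with hH₀
  have hH₀0 : 0 < H₀ := lt_min (by norm_num) (Real.exp_pos _)
  have hH₀1 : H₀ ≤ 1 / 1600 := min_le_left _ _
  set E₀ : ℝ := Real.exp (-(4 / 5 * (10 / H₀ + 2) * Real.log (C * (1 + 1 / H₀)))) with hE₀
  refine ⟨Real.exp (Real.exp (80 / (1 / 2000) ^ 3)), min (1 / 2000) (1 / 2000 / B * min E₀ 1),
    by positivity, ?_⟩
  intro a b F σ T H ε ha hb hb1 hF hσ hσ2 hT hT1 hH hHT hε hε1 hσε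
  set L := Real.log (Real.log T) with hL
  set J := ∫ t in T..(T + H), ‖F (σ + t * Complex.I)‖ with hJ
  have hlb0 := lowerBound_nonneg hH ε
  have hlb1 := lowerBound_le_left H ε
  have hL1 : 1 ≤ L := one_le_log_log hT
  have hlogT : 0 < Real.log T := Real.log_pos (by linarith)
  have hexpL : Real.exp L = Real.log T := Real.exp_log hlogT
  have hlogT1 : 1 ≤ Real.log T := by rw [← hexpL]; exact Real.one_le_exp (by linarith)
  have hL2 : 80 / (1 / 2000) ^ 3 ≤ L := by
    rw [hL, Real.le_log_iff_exp_le hlogT, Real.le_log_iff_exp_le (by linarith)]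
    exact hT1
  have hwid := strip_width_mul_le (by linarith) hH hε1 hσε
  rcases havg a b F σ T H ha hb hb1 hF hσ hσ2 hT hH hHT
    (one_le_of_strip hL1 hH hε hε1 hσε) with hbig | ⟨g, c, q, d, hq, hc, hd, hg, hgs, hlow, hleft, hup⟩
  · refine le_trans ?_ hbig
    exact mul_le_mul (min_le_left _ _) hlb1 hlb0 (by norm_num)
  -- the channel has to be longer than `L / π` times its width, which is about `π H (1 - ε) / (4 L)`;
  -- what remains of the segment has half-length close to `H / 2 - H (1 - ε) / 4`
  set X₁ : ℝ := H / 2 * ((1 + ε) / 2 - 5 / 2000) with hX₁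
  have hX₁H : H / 5 ≤ X₁ := by rw [hX₁]; nlinarith
  have hX₁H2 : X₁ ≤ H := by rw [hX₁]; nlinarith
  have hX₁0 : 0 < X₁ := by linarith
  have hX₁ε : (1 - 5 / 2000) * (H * ε) / 2 ≤ X₁ := by
    have : 0 ≤ H * (1 - ε) := mul_nonneg hH.le (by linarith)
    rw [hX₁]; nlinarith
  have hd2 : 1 / 2 ≤ d ∧ d ≤ 2 := by
    rcases hd with h | h
    · rw [h]; norm_num
    · rw [h.1]; norm_num
  set P : ℝ := Real.pi / (4 * (1 - 3 * (1 / 2000))) * (d / X₁ + 2) with hP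
  have hP0 : 0 ≤ P := by
    have : 0 < d := by linarith [hd2.1]
    rw [hP]; positivity
  have hCH : 1 ≤ C * (1 + 1 / H) := one_le_mul_of_one_le_of_one_le hC (by
    have : 0 < 1 / H := by positivity
    linarith)
  have hκH : 0 < 1 / 2000 * H := by positivity
  set E : ℝ := Real.exp (-(P * Real.log (C * (1 + 1 / H)))) with hE
  have hE1 : E ≤ 1 := Real.exp_le_one_iff.2 (by
    have := Real.log_nonneg hCH
    have : 0 ≤ P * Real.log (C * (1 + 1 / H)) := by positivity
    linarith)
  have hkey : E ≤ B / (1 / 2000 * H) * J := by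
    refine le_of_forall_between (Real.exp_pos _) hE1 fun δ hδ hδ1 hδJ => ?_
    refine hpot (H := H) (X₁ := X₁) (X := (1 - 3 * (1 / 2000)) * H / 2) (a := max (1 - σ) 0)
      (b := 1 / 2000 * H / L) (L := L) (d := d) (δ := δ) (q := q) (Y := T) (g := g) (c := c)
      hH hX₁H hX₁H2 ?_ (by linarith) (le_max_right _ _) ?_ (by field_simp) hL2 ?_ hd2.1 hδ hδ1 hq hc
      hg hgs hlow (fun s hs hi => (hleft s hs hi).trans hδJ) fun s hs _ hi => ?_
    · rw [hX₁]; nlinarith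
    · have : Real.pi * H * (1 - ε) ≤ 4 * H * 1 :=
        mul_le_mul (by gcongr; linarith) (by linarith) (by linarith) (by positivity)
      linarith
    · have e1 : (max (1 - σ) 0 + 1 / 2000 * H / L) * L = max (1 - σ) 0 * L + 1 / 2000 * H := by
        field_simp
      rw [e1, hX₁]
      have h1 : Real.pi * (H * ε) ≤ Real.pi * (H * 1) := by gcongr
      have h2 : 0 < Real.pi * (H * ε) := by positivity
      have h3 : 3 * H ≤ Real.pi * H := by gcongr
      linarith
    · have h1 := hup s 0 le_rfl (by norm_num) hs (by rw [add_zero]; exact hi.le)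
      rw [mul_zero, Real.exp_zero, mul_one] at h1
      refine h1.trans ?_
      rw [hexpL]
      have e1 : K * T ^ p = Real.exp (Real.log K + p * Real.log T) := by
        rw [Real.exp_add, Real.exp_log (by linarith), Real.exp_nat_mul, Real.exp_log (by linarith)]
      rw [e1]
      refine Real.exp_le_exp.2 ?_
      nlinarith
  have hJE : 1 / 2000 / B * (H * E) ≤ J := by
    have h1 : E * (1 / 2000 * H) ≤ B * J := by
      rw [div_mul_eq_mul_div, le_div_iff₀ hκH] at hkey
      exact hkey
    have h2 : 1 / 2000 / B * (H * E) = E * (1 / 2000 * H) / B := by field_simp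
    rw [h2, div_le_iff₀ (by linarith), mul_comm J]
    exact h1
  refine le_trans ?_ hJE
  have hBinv : 0 < 1 / 2000 / B := by positivity
  have hcoef : Real.pi / (4 * (1 - 3 * (1 / 2000))) ≤ 4 / 5 := by
    rw [div_le_iff₀ (by norm_num)]; linarith
  rcases le_or_gt H₀ H with hHH | hHH
  · -- `H` bounded below: the exponent is bounded
    have hE2 : E₀ ≤ E := by
      refine Real.exp_le_exp.2 (neg_le_neg ?_)
      have h1 : d / X₁ ≤ 10 / H₀ := by
        rw [div_le_div_iff₀ hX₁0 hH₀0]; nlinarith [hd2.1, hd2.2]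
      refine mul_le_mul (mul_le_mul hcoef (by linarith) ?_ (by norm_num))
        (Real.log_le_log (by linarith) ?_) (Real.log_nonneg hCH) (by positivity)
      · have : 0 < d := by linarith [hd2.1]
        positivity
      · gcongr
    calc min (1 / 2000) (1 / 2000 / B * min E₀ 1) * lowerBound H ε
        ≤ (1 / 2000 / B * E) * H := mul_le_mul ((min_le_right _ _).trans
          (mul_le_mul_of_nonneg_left ((min_le_left _ _).trans hE2) hBinv.le)) hlb1 hlb0
          (mul_nonneg hBinv.le (Real.exp_pos _).le)
      _ = _ := by ring
  · have hH1 : H ≤ 1 / 1600 := by linarith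
    have hd3 : d = 11 / 15 := by
      rcases hd with h | h
      · exact h
      · linarith [h.2]
    set y : ℝ := -Real.log H with hy
    have hMy : 300 * Real.log M ≤ y := by
      have h1 := Real.log_le_log hH (hHH.le.trans (min_le_right _ _))
      rw [Real.log_exp] at h1
      linarith
    have hPle : P ≤ 1158 / 1000 / (H * ε) + 8 / 5 := by
      have hHε : 0 < H * ε := by positivity
      have h1 : d / X₁ ≤ (11 / 15 * 2 / (1 - 5 / 2000)) / (H * ε) := by
        rw [div_le_div_iff₀ hX₁0 hHε, hd3]
        nlinarith
      have h2 : P ≤ Real.pi / (4 * (1 - 3 * (1 / 2000))) *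
          ((11 / 15 * 2 / (1 - 5 / 2000)) / (H * ε) + 2) := by
        rw [hP]; gcongr
      have h3 : Real.pi / (4 * (1 - 3 * (1 / 2000))) * (11 / 15 * 2 / (1 - 5 / 2000)) ≤ 1158 / 1000 := by
        rw [div_mul_eq_mul_div, div_le_iff₀ (by norm_num)]
        linarith
      calc P ≤ _ := h2
        _ = (Real.pi / (4 * (1 - 3 * (1 / 2000))) * (11 / 15 * 2 / (1 - 5 / 2000))) / (H * ε) +
            Real.pi / (4 * (1 - 3 * (1 / 2000))) * 2 := by ring
        _ ≤ _ := add_le_add (div_le_div_of_nonneg_right h3 hHε.le) (by linarith)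
    have hlog : Real.log (C * (1 + 1 / H)) ≤ Real.log M + y := by
      rw [hy, ← Real.log_inv, ← Real.log_mul (by linarith) (by positivity)]
      refine Real.log_le_log (by linarith) ?_
      rw [hM, mul_comm 2 C, mul_assoc]
      have : 1 ≤ H⁻¹ := one_le_inv_iff₀.2 ⟨hH, by linarith⟩
      refine mul_le_mul_of_nonneg_left ?_ (by linarith)
      rw [one_div]; linarith
    have h1 := lowerBound_le_mul_exp_neg hH (by linarith) ((mul_le_mul_of_nonneg_left hlog hP0).trans
      (exponent_le_of_small (by linarith : 1 ≤ M) hH hε hε1 hMy hy hH1 hPle))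
    exact mul_le_mul ((min_le_right _ _).trans (mul_le_of_le_one_right hBinv.le (min_le_right _ _)))
      h1 hlb0 hBinv.le

theorem mul_log_le_of_small {R H ε y : ℝ} (hR : 0 ≤ R) (hH : 0 < H) (hε : 0 < ε) (hε1 : ε ≤ 1)
    (hy : y = -Real.log H) (hRy : 150 * R ≤ y / 10) (hH1 : H ≤ 1 / 10) :
    150 / H * R ≤ 7 / (6 * H * ε) * Real.log (200 / H) + Real.log H := by
  have hy0 : 0 ≤ y := by linarith
  have h200 : 0 ≤ Real.log 200 := Real.log_nonneg (by norm_num)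
  have hlH : Real.log H = -y := by linarith
  rw [Real.log_div (by norm_num) hH.ne', hlH]
  have h1 : 7 / 6 * (1 / H) ≤ 7 / (6 * H * ε) := by
    rw [show 7 / 6 * (1 / H) = 7 / (6 * H * 1) by field_simp]
    gcongr
  have hw : 10 ≤ 1 / H := by rw [le_div_iff₀ hH]; linarith
  set w := 1 / H with hwdef
  have h2 : 150 / H * R = w * (150 * R) := by rw [hwdef]; ring
  rw [h2]
  calc w * (150 * R) ≤ w * (y / 10) := by gcongr
    _ ≤ 7 / 6 * w * (0 + y) - y := by nlinarith
    _ ≤ 7 / 6 * w * (Real.log 200 - -y) + -y := by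
        have : 0 ≤ w * Real.log 200 := by positivity
        nlinarith
    _ ≤ _ := by
        have : 0 ≤ Real.log 200 - -y := by linarith
        gcongr

set_option maxHeartbeats 1000000 in
/-- The case of bounded `T`: here a shorter interval of length at most `1` suffices. -/
theorem IsLerchZeta.lowerBound_le_integral_of_bounded (T₁ : ℝ) : ∃ c : ℝ, 0 < c ∧
    ∀ (a b : ℝ) (F : ℂ → ℂ) (σ T H ε : ℝ), |a| ≤ 1 / 2 → 0 < b → b ≤ 1 → IsLerchZeta a b F →
    -1 ≤ σ → σ ≤ 26 / 15 → 16 ≤ T → T ≤ T₁ → 0 < H → H ≤ T → 0 < ε → ε ≤ 1 →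
    1 - Real.pi * H * (1 - ε) / (4 * Real.log (Real.log T)) ≤ σ →
    c * lowerBound H ε ≤ ∫ t in T..(T + H), ‖F (σ + t * Complex.I)‖ := by
  obtain ⟨B, K, hB, hK, p, havg⟩ := IsLerchZeta.exists_average (κ := 1 / 10) (by norm_num)
    (by norm_num)
  set Q : ℝ := K * (max T₁ 1) ^ p * Real.exp (Real.pi * 4) with hQ
  have hQ1 : 1 ≤ Q := by
    have h1 : 1 ≤ (max T₁ 1) ^ p := one_le_pow₀ (le_max_right _ _)
    have h2 : 1 ≤ Real.exp (Real.pi * 4) := Real.one_le_exp (by have := Real.pi_pos; positivity)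
    exact one_le_mul_of_one_le_of_one_le (one_le_mul_of_one_le_of_one_le hK h1) h2
  set R : ℝ := Real.log (Q / (2 / 1000)) with hR
  have hR0 : 0 ≤ R := Real.log_nonneg (by rw [le_div_iff₀ (by norm_num)]; linarith)
  set H₀ : ℝ := min (1 / 10) (Real.exp (-(1500 * R))) with hH₀
  have hH₀0 : 0 < H₀ := lt_min (by norm_num) (Real.exp_pos _)
  set c₀ : ℝ := 1 / 10 / B with hc₀
  have hc₀0 : 0 < c₀ := by rw [hc₀]; positivity
  set E₀ : ℝ := Real.exp (-(150 / H₀ * R)) with hE₀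
  have hE₀0 : 0 < E₀ := Real.exp_pos _
  have hE₀1 : E₀ ≤ 1 := Real.exp_le_one_iff.2 (by
    have : 0 ≤ 150 / H₀ * R := by positivity
    linarith)
  set S : ℝ := max T₁ 1 with hS
  have hS1 : 1 ≤ S := le_max_right _ _
  refine ⟨c₀ * E₀ / S, by positivity, ?_⟩
  intro a b F σ T H ε ha hb hb1 hF hσ hσ2 hT hT1 hH hHT hε hε1 hσε
  have hTS : T ≤ S := hT1.trans (le_max_left _ _)
  set H' : ℝ := min H 1 with hH'
  have hH'0 : 0 < H' := lt_min hH one_pos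
  have hH'1 : H' ≤ 1 := min_le_right _ _
  have hH'S : H ≤ S * H' := by
    rcases le_total H 1 with h | h
    · rw [hH', min_eq_left h]; nlinarith
    · rw [hH', min_eq_right h]; linarith
  have hlb0 := lowerBound_nonneg hH ε
  have hlb1 := lowerBound_le_left H ε
  have hc := hF.continuousOn_vertical σ
  have hii : ∀ z : ℝ, T ≤ z →
      IntervalIntegrable (fun t : ℝ => ‖F (σ + t * Complex.I)‖) volume T z := fun z hz => by
    refine (hc.mono fun t ht => ?_).intervalIntegrable
    rw [uIcc_of_le hz] at ht
    have : 0 < t := by linarith [ht.1]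
    exact this
  have hshort : ∫ t in T..(T + H'), ‖F (σ + t * Complex.I)‖ ≤
      ∫ t in T..(T + H), ‖F (σ + t * Complex.I)‖ :=
    intervalIntegral.integral_mono_interval le_rfl (by linarith)
      (by linarith [min_le_left H 1]) (ae_of_all _ fun t => norm_nonneg _) (hii _ (by linarith))
  refine le_trans ?_ hshort
  set J := ∫ t in T..(T + H'), ‖F (σ + t * Complex.I)‖ with hJ
  -- a lower bound `c₀ * E * H'` with `E ≥ E₀` is sufficient
  have hfin : ∀ E : ℝ, E₀ ≤ E → c₀ * (H' * E) ≤ J → c₀ * E₀ / S * lowerBound H ε ≤ J := by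
    intro E hE hEJ
    refine le_trans ?_ hEJ
    rw [div_mul_eq_mul_div, div_le_iff₀ (by linarith)]
    calc c₀ * E₀ * lowerBound H ε ≤ c₀ * E * (S * H') :=
          mul_le_mul (by gcongr) (hlb1.trans hH'S) hlb0 (mul_nonneg hc₀0.le (hE₀0.le.trans hE))
      _ = _ := by ring
  rcases havg a b F σ T H' ha hb hb1 hF hσ hσ2 hT hH'0 (by linarith) (fun hσ0 =>
    le_min (one_le_of_strip (one_le_log_log hT) hH hε hε1 hσε hσ0) le_rfl) with
    hbig | ⟨g, c, q, d, hq, hcn, hd, hg, hgs, hlow, hleft, hup⟩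
  · refine hfin 1 hE₀1 (le_trans ?_ hbig)
    rw [mul_one, hc₀]
    have : 1 / 10 / B ≤ 1 / 10 := div_le_self (by norm_num) hB
    gcongr
  set X : ℝ := (1 - 3 * (1 / 10)) * H' / 2 with hX
  have hX0 : 0 < X := by rw [hX]; linarith
  have hd2 : 1 / 2 ≤ d ∧ d ≤ 2 := by
    rcases hd with h | h
    · rw [h]; norm_num
    · rw [h.1]; norm_num
  have hm0 : 0 ≤ max (1 - σ) 0 := le_max_right _ _
  have hm2 : max (1 - σ) 0 ≤ 2 := max_le (by linarith) (by norm_num)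
  have hopen : IsOpen {s : ℂ | 1 < s.re ∨ |s.im| < T} :=
    (isOpen_lt continuous_const Complex.continuous_re).union
      (isOpen_lt (Complex.continuous_im.abs) continuous_const)
  have hκH : 0 < 1 / 10 * H' := by positivity
  set E : ℝ := Real.exp (-(50 / X * R)) with hE
  have hE1 : E ≤ 1 := Real.exp_le_one_iff.2 (by
    have : 0 ≤ 50 / X * R := by positivity
    linarith)
  have hkey : E ≤ B / (1 / 10 * H') * J := by
    refine le_of_forall_between (Real.exp_pos _) hE1 fun δ hδ hδ1 hδJ => ?_
    refine exp_neg_le_of_norm_le_rect (l := 1 - max (1 - σ) 0) (d := 1 + d) (g := g) hX0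
      (by rw [hX]; linarith) (by linarith) (by linarith) hδ hδ1 hQ1 (by norm_num) (fun s _ hs =>
        (hg.differentiableAt (hopen.mem_nhds (Or.inr (by linarith))))) (fun s hs hi => ?_)
      (fun s hs hi => (hleft s hs hi).trans hδJ) (hlow _ le_rfl)
    refine (hup s 4 (by norm_num) (by norm_num) hs (by linarith)).trans ?_
    rw [hQ]
    gcongr
  have hJE : c₀ * (H' * E) ≤ J := by
    have h1 : E * (1 / 10 * H') ≤ B * J := by
      rw [div_mul_eq_mul_div, le_div_iff₀ hκH] at hkey
      exact hkey
    have h2 : c₀ * (H' * E) = E * (1 / 10 * H') / B := by rw [hc₀]; field_simp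
    rw [h2, div_le_iff₀ (by linarith), mul_comm J]
    exact h1
  have hE3 : Real.exp (-(150 / H' * R)) ≤ E := by
    refine Real.exp_le_exp.2 (neg_le_neg (mul_le_mul_of_nonneg_right ?_ hR0))
    rw [div_le_div_iff₀ hX0 hH'0, hX]
    linarith
  rcases le_or_gt H₀ H' with hHH | hHH
  · refine hfin E (le_trans ?_ hE3) hJE
    refine Real.exp_le_exp.2 (neg_le_neg (mul_le_mul_of_nonneg_right ?_ hR0))
    gcongr
  · have hH₀1 : H₀ ≤ 1 / 10 := min_le_left _ _
    have hHH' : H' = H := by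
      rcases le_total H 1 with h | h
      · rw [hH', min_eq_left h]
      · rw [hH', min_eq_right h] at hHH; linarith
    have h2 : Real.log H < -(1500 * R) := by
      have h1 := Real.log_lt_log hH'0 (hHH.trans_le (min_le_right _ _))
      rwa [Real.log_exp, hHH'] at h1
    have h1 := lowerBound_le_mul_exp_neg hH (by linarith) (mul_log_le_of_small hR0 hH hε hε1 rfl (by linarith)
      (by linarith))
    rw [← hHH'] at h1 hlb0
    refine le_trans ?_ hJE
    rw [← hHH']
    refine mul_le_mul ?_ (h1.trans (mul_le_mul_of_nonneg_left hE3 hH'0.le)) hlb0 hc₀0.le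
    calc c₀ * E₀ / S ≤ c₀ * E₀ := div_le_self (by positivity) hS1
      _ ≤ c₀ * 1 := by gcongr
      _ = c₀ := mul_one _

/-- In the strip `-1 ≤ re s ≤ 26 / 15`. If `H > T` the interval is replaced by its part
`[(T + H) / 2, T + H]`, where the hypothesis on `σ` holds with room to spare. -/
theorem IsLerchZeta.lowerBound_le_integral_of_mem_strip : ∃ c : ℝ, 0 < c ∧
    ∀ (a b : ℝ) (F : ℂ → ℂ) (σ T H ε : ℝ), |a| ≤ 1 / 2 → 0 < b → b ≤ 1 → IsLerchZeta a b F →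
    -1 ≤ σ → σ ≤ 26 / 15 → 16 ≤ T → 0 < H → 0 < ε → ε ≤ 1 →
    1 - Real.pi * H * (1 - ε) / (4 * Real.log (Real.log T)) ≤ σ →
    c * lowerBound H ε ≤ ∫ t in T..(T + H), ‖F (σ + t * Complex.I)‖ := by
  obtain ⟨T₁, c₁, hc₁, h₁⟩ := IsLerchZeta.lowerBound_le_integral_of_large
  obtain ⟨c₂, hc₂, h₂⟩ := IsLerchZeta.lowerBound_le_integral_of_bounded T₁
  have hle : ∀ (a b : ℝ) (F : ℂ → ℂ) (σ T H ε : ℝ), |a| ≤ 1 / 2 → 0 < b → b ≤ 1 →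
      IsLerchZeta a b F → -1 ≤ σ → σ ≤ 26 / 15 → 16 ≤ T → 0 < H → H ≤ T → 0 < ε → ε ≤ 1 →
      1 - Real.pi * H * (1 - ε) / (4 * Real.log (Real.log T)) ≤ σ →
      min c₁ c₂ * lowerBound H ε ≤ ∫ t in T..(T + H), ‖F (σ + t * Complex.I)‖ := by
    intro a b F σ T H ε ha hb hb1 hF hσ hσ2 hT hH hHT hε hε1 hσε
    have hlb0 := lowerBound_nonneg hH ε
    rcases le_total T₁ T with h | h
    · exact (mul_le_mul_of_nonneg_right (min_le_left _ _) hlb0).trans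
        (h₁ a b F σ T H ε ha hb hb1 hF hσ hσ2 hT h hH hHT hε hε1 hσε)
    · exact (mul_le_mul_of_nonneg_right (min_le_right _ _) hlb0).trans
        (h₂ a b F σ T H ε ha hb hb1 hF hσ hσ2 hT h hH hHT hε hε1 hσε)
  have hc : 0 < min c₁ c₂ := lt_min hc₁ hc₂
  refine ⟨min c₁ c₂ / 2, by positivity, ?_⟩
  intro a b F σ T H ε ha hb hb1 hF hσ hσ2 hT hH hε hε1 hσε
  have hlb0 := lowerBound_nonneg hH ε
  have hlb1 := lowerBound_le_left H ε
  rcases le_or_gt H T with hHT | hHT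
  · refine (mul_le_mul_of_nonneg_right ?_ hlb0).trans
      (hle a b F σ T H ε ha hb hb1 hF hσ hσ2 hT hH hHT hε hε1 hσε)
    exact div_le_self hc.le (by norm_num)
  set V : ℝ := (T + H) / 2 with hV
  have hV16 : 16 ≤ V := by linarith
  have hpi := Real.pi_gt_three
  have hlogV : 0 < Real.log V := Real.log_pos (by linarith)
  have hLV : Real.log (Real.log V) ≤ V / 8 := by
    -- `log V ≤ V / 16 + log 16 - 1`
    have h1 : Real.log V ≤ V / 16 + 2 := by
      have h2 := Real.log_le_sub_one_of_pos (show 0 < V / 16 by linarith)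
      rw [Real.log_div (by linarith) (by norm_num)] at h2
      have h3 : Real.log 16 ≤ 3 := by
        rw [show (16:ℝ) = 2 ^ 4 by norm_num, Real.log_pow]
        have := Real.log_two_lt_d9
        push_cast
        linarith
      linarith
    have h4 := Real.log_le_sub_one_of_pos hlogV
    linarith
  have hV1 := one_le_log_log hV16
  have hσV : 1 - Real.pi * V * (1 - 1 / 2) / (4 * Real.log (Real.log V)) ≤ σ := by
    have : 2 ≤ Real.pi * V * (1 - 1 / 2) / (4 * Real.log (Real.log V)) := by
      rw [le_div_iff₀ (by linarith)]
      nlinarith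
    linarith
  have h1 := hle a b F σ V V (1 / 2) ha hb hb1 hF hσ hσ2 hV16 (by linarith) le_rfl (by norm_num)
    (by norm_num) hσV
  have hVV : V + V = T + H := by rw [hV]; ring
  rw [hVV, lowerBound_of_one_le (by linarith)] at h1
  have hii : IntervalIntegrable (fun t : ℝ => ‖F (σ + t * Complex.I)‖) volume T (T + H) := by
    refine ((hF.continuousOn_vertical σ).mono fun t ht => ?_).intervalIntegrable
    rw [uIcc_of_le (by linarith)] at ht
    have : 0 < t := by linarith [ht.1]
    exact this
  refine le_trans ?_ (h1.trans (intervalIntegral.integral_mono_interval (by linarith) (by linarith)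
    le_rfl (ae_of_all _ fun t => norm_nonneg _) hii))
  calc min c₁ c₂ / 2 * lowerBound H ε ≤ min c₁ c₂ / 2 * H := by gcongr
    _ ≤ min c₁ c₂ * V := by rw [hV]; nlinarith

/-! ### The functional equation -/

theorem IsLerchZeta.sub_one {a b : ℝ} {F : ℂ → ℂ} (hF : IsLerchZeta a b F) :
    IsLerchZeta (a - 1) b F := by
  refine ⟨hF.differentiableOn, fun s hs => (hF.eq_tsum s hs).trans (tsum_congr fun n => ?_)⟩
  congr 1
  have : (2 * Real.pi * Complex.I * (a - 1 : ℝ) * n : ℂ) =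
      2 * Real.pi * Complex.I * a * n - n * (2 * Real.pi * Complex.I) := by push_cast; ring
  rw [this, Complex.exp_periodic.sub_nat_mul_eq]

theorem integral_unitExp_mul_cpow (ν : ℝ) {s : ℂ} (hs : s.re < 1) (hs' : 0 < s.im) :
    ∫ x in (0:ℝ)..1, unitExp (ν * x) * (x : ℂ) ^ (-s) = lowerIntegral ν 1 s := by
  have h := (integral_exp_mul_cpow_zero_left (-(2 * Real.pi * Complex.I * ν)) one_pos hs hs').2
  rw [intervalIntegral.integral_of_le zero_le_one, lowerIntegral]
  rw [neg_neg] at h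
  rw [← h]
  refine integral_congr_ae (ae_of_all _ fun x => ?_)
  change unitExp (ν * x) * _ = _
  rw [unitExp]
  push_cast
  ring_nf

/-- For `a = n` the dual term vanishes, in accordance with `0 ^ (re s - 1) = 0`. -/
theorem summable_dualTerm (a : ℝ) {s : ℂ} (hs : s.re < 0) (hs' : 0 < s.im) :
    Summable fun n : ℤ => ‖dualTerm (a - n) s‖ := by
  have h := (Real.summable_one_div_int_add_rpow (-a) (1 - s.re)).2 (by linarith)
  refine Summable.of_nonneg_of_le (fun n => norm_nonneg _) (fun n => norm_dualTerm_le hs')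
    ((h.mul_left (‖Complex.Gamma (1 - s)‖ * Real.exp (Real.pi * s.im / 2) *
      (2 * Real.pi) ^ (s.re - 1))).congr fun n => ?_)
  have e : |(n:ℝ) + -a| = |a - n| := by rw [← abs_neg]; congr 1; ring
  rw [e, Real.mul_rpow (by positivity) (abs_nonneg _), show 1 - s.re = -(s.re - 1) by ring,
    Real.rpow_neg (abs_nonneg _), one_div, inv_inv]
  ring

/-- The functional equation, as a Fourier expansion in the second parameter: the function
`b ↦ e(ab) φ(a, b, s)` extends continuously to the circle when `re s < 0`, and its Fourier
coefficients are dual terms. -/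
theorem IsLerchZeta.hasSum_dualTerm_of_abs_le {a b : ℝ} {F : ℂ → ℂ} (hF : IsLerchZeta a b F)
    (ha : |a| ≤ 1 / 2) (hb : 0 < b) (hb1 : b ≤ 1) {s : ℂ} (hs : s.re < 0) (hs' : 0 < s.im) :
    HasSum (fun n : ℤ => dualTerm (a - n) s * unitExp (n * b)) (unitExp (a * b) * F s) := by
  have ha0 := unitExpTail_zero_ne_zero ha
  obtain ⟨k, hk⟩ := exists_nat_gt (1 - s.re)
  have hks : 1 - (k:ℝ) < s.re := by linarith
  have hs0 : -s ≠ 0 := fun h => by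
    have := congrArg Complex.im h
    simp at this
    linarith
  set Φ : ℝ → ℂ := fun x => unitExp (a * x) * ((x : ℂ) ^ (-s) + unitExp a * lerchCont a k (1 + x) s)
    with hΦ
  have hΦb : ∀ x, 0 < x → Φ x = unitExp (a * x) * lerchCont a k x s := fun x hx => by
    simp only [hΦ]
    rw [lerchCont_eq_add ha0 k hx hks hs', add_comm 1 x]
  have h01 : Φ 0 = Φ 1 := by
    rw [hΦb 1 one_pos]
    simp [hΦ, Complex.zero_cpow hs0, unitExp_zero]
  have hcL : ContinuousOn (fun x : ℝ => lerchCont a k (1 + x) s) (Icc 0 1) :=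
    (continuousOn_lerchCont ha0 k).comp (f := fun x : ℝ => ((1 + x, s) : ℝ × ℂ)) (by fun_prop)
      fun x hx => ⟨by linarith [hx.1], hks, hs'⟩
  have hcp : Continuous fun x : ℝ => (x : ℂ) ^ (-s) :=
    Complex.continuous_ofReal_cpow_const (by simpa using hs)
  have hce : ∀ ν : ℝ, Continuous fun x : ℝ => unitExp (ν * x) := fun ν =>
    continuous_unitExp.comp (by fun_prop)
  have hcΦ : ContinuousOn Φ (Icc 0 1) :=
    (hce a).continuousOn.mul (hcp.continuousOn.add (continuousOn_const.mul hcL))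
  have : Fact (0 < (1:ℝ)) := ⟨one_pos⟩
  let f : C(AddCircle (1:ℝ), ℂ) := ⟨AddCircle.liftIco 1 0 Φ,
    AddCircle.liftIco_zero_continuous h01 hcΦ⟩
  have hfI : ∀ x ∈ Ico (0:ℝ) 1, f (x : AddCircle (1:ℝ)) = Φ x := fun x hx => by
    change AddCircle.liftIco 1 0 Φ (x : AddCircle (1:ℝ)) = Φ x
    exact AddCircle.liftIco_zero_coe_apply hx
  have hf4 : ∀ (n : ℤ) (x : ℝ), fourier n (x : AddCircle (1:ℝ)) = unitExp (n * x) := fun n x => by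
    rw [fourier_coe_apply, unitExp]
    push_cast
    ring_nf
  have hcoef : ∀ n : ℤ, fourierCoeff f n = dualTerm (a - n) s := by
    intro n
    have e1 : fourierCoeff f n = ∫ x in (0:ℝ)..1, unitExp (((-n : ℤ) : ℝ) * x) * Φ x := by
      rw [fourierCoeff_eq_intervalIntegral _ _ 0, zero_add]
      rw [div_one, one_smul]
      refine intervalIntegral.integral_congr_Ioo_of_le zero_le_one fun x hx => ?_
      rw [hf4, smul_eq_mul]
      congr 1
      exact hfI x (Ioo_subset_Ico_self hx)
    have e2 : ∀ x : ℝ, unitExp (((-n : ℤ) : ℝ) * x) * Φ x =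
        unitExp ((a + (-n : ℤ)) * x) * (x : ℂ) ^ (-s) +
        unitExp a * (unitExp ((a + (-n : ℤ)) * x) * lerchCont a k (1 + x) s) := fun x => by
      simp only [hΦ]
      rw [add_mul, unitExp_add]
      ring
    rw [e1]
    simp_rw [e2]
    rw [intervalIntegral.integral_add, intervalIntegral.integral_const_mul,
      integral_unitExp_mul_lerchCont ha0 k (-n) one_pos hks hs',
      integral_unitExp_mul_cpow _ (by linarith) hs', ← mul_assoc, ← unitExp_add]
    · have e3 : a + -((a + (-n : ℤ)) * 1) = (n : ℤ) := by push_cast; ring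
      rw [e3, unitExp_int, one_mul]
      push_cast
      rw [← sub_eq_add_neg]
      ring
    · exact ((hce _).mul hcp).intervalIntegrable _ _
    · refine ContinuousOn.intervalIntegrable ?_
      rw [uIcc_of_le zero_le_one]
      exact continuousOn_const.mul ((hce _).continuousOn.mul hcL)
  have hsum : Summable (fourierCoeff f) := by
    refine Summable.of_norm ((summable_dualTerm a hs hs').congr fun n => ?_)
    rw [hcoef]
  have key := has_pointwise_sum_fourier_series_of_summable hsum (b : AddCircle (1:ℝ))
  have hfb : f (b : AddCircle (1:ℝ)) = unitExp (a * b) * F s := by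
    rw [hF.eq_lerchCont ha0 hb k hks hs', ← hΦb b hb]
    rcases hb1.lt_or_eq with h | h
    · exact hfI b ⟨hb.le, h⟩
    · rw [h, ← h01]
      have : ((1:ℝ) : AddCircle (1:ℝ)) = ((0:ℝ) : AddCircle (1:ℝ)) := by
        rw [AddCircle.coe_period]; rfl
      rw [this]
      exact hfI 0 ⟨le_rfl, one_pos⟩
  rw [hfb] at key
  simpa only [hcoef, hf4, smul_eq_mul] using key

/-- The functional equation for `0 < α ≤ 1`, its right hand side divided into the frequencies
`α + n > 0` and `-(1 - α + n) ≤ 0`. -/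
theorem IsLerchZeta.eq_add_tsum_dualTerm {α b : ℝ} {F : ℂ → ℂ} (hF : IsLerchZeta α b F)
    (hα : 0 < α) (hα1 : α ≤ 1) (hb : 0 < b) (hb1 : b ≤ 1) {s : ℂ} (hs : s.re < 0)
    (hs' : 0 < s.im) :
    unitExp (α * b) * F s = (∑' n : ℕ, dualTerm (α + n) s * unitExp (-(n * b))) +
      ∑' n : ℕ, dualTerm (-(1 - α + n)) s * unitExp ((n + 1) * b) := by
  obtain ⟨j, hj, hFj⟩ : ∃ j : ℤ, |α - j| ≤ 1 / 2 ∧ IsLerchZeta (α - j) b F := by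
    rcases le_total α (1 / 2) with h | h
    · exact ⟨0, abs_le.2 ⟨by push_cast; linarith, by push_cast; linarith⟩, by simpa using hF⟩
    · exact ⟨1, abs_le.2 ⟨by push_cast; linarith, by push_cast; linarith⟩, by simpa using hF.sub_one⟩
  have h1 := (hFj.hasSum_dualTerm_of_abs_le hj hb hb1 hs hs').mul_left (unitExp (j * b))
  have e1 : unitExp (j * b) * (unitExp ((α - j) * b) * F s) = unitExp (α * b) * F s := by
    rw [← mul_assoc, ← unitExp_add]
    congr 2; ring
  rw [e1] at h1
  set f : ℤ → ℂ := fun m => dualTerm (α + m) s * unitExp (-(m * b)) with hf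
  have h3 : HasSum f (unitExp (α * b) * F s) := by
    have h4 := (Equiv.neg ℤ).hasSum_iff.2 ((Equiv.subRight j).hasSum_iff.2 h1)
    refine (congrArg (HasSum · _) (funext fun m => ?_)).mp h4
    simp only [Function.comp_apply, Equiv.neg_apply, Equiv.subRight_apply, hf]
    rw [mul_left_comm, ← unitExp_add]
    push_cast
    congr 2 <;> ring
  have hinj : Function.Injective fun n : ℕ => -((n:ℤ) + 1) := fun m n h => by
    simp only at h
    omega
  have h5 : Summable fun n : ℕ => f n := h3.summable.comp_injective Nat.cast_injective
  have h6 : Summable fun n : ℕ => f (-((n:ℤ) + 1)) := h3.summable.comp_injective hinj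
  rw [← h3.tsum_eq, tsum_of_nat_of_neg_add_one h5 h6]
  congr 1
  refine tsum_congr fun n => ?_
  simp only [hf]
  push_cast
  congr 2 <;> ring

/-- A series with terms of size `D (y + n) ^ (-x)`, `0 < y ≤ 1`, is dominated by its first term,
if `∑ (n + 2) ^ (-x) ≤ θ < 1`, because `y + n ≥ y (1 + n)`. -/
theorem tsum_norm_bounds {f : ℕ → ℂ} {D y x θ : ℝ} (hD : 0 ≤ D) (hy : 0 < y) (hy1 : y ≤ 1)
    (hx : 0 ≤ x) (hf : ∀ n, ‖f n‖ = D * (y + n) ^ (-x))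
    (hθ : ∀ N : ℕ, ∑ n ∈ Finset.range N, ((n:ℝ) + 2) ^ (-x) ≤ θ) :
    Summable f ∧ (1 - θ) * (D * y ^ (-x)) ≤ ‖∑' n, f n‖ ∧ ‖∑' n, f n‖ ≤ (1 + θ) * (D * y ^ (-x)) := by
  have hle : ∀ n : ℕ, ‖f (n + 1)‖ ≤ D * y ^ (-x) * ((n:ℝ) + 2) ^ (-x) := fun n => by
    rw [hf, mul_assoc, ← Real.mul_rpow hy.le (by positivity)]
    refine mul_le_mul_of_nonneg_left (Real.rpow_le_rpow_of_nonpos (by positivity) ?_ (by linarith)) hD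
    push_cast
    nlinarith [(Nat.cast_nonneg n : (0:ℝ) ≤ n)]
  have hs2 : Summable fun n : ℕ => ((n:ℝ) + 2) ^ (-x) :=
    summable_of_sum_range_le (fun n => by positivity) hθ
  have hs1 : Summable fun n : ℕ => f (n + 1) := Summable.of_norm_bounded (hs2.mul_left _) hle
  have hs : Summable f := (summable_nat_add_iff 1).1 hs1
  have htail : ‖∑' n, f (n + 1)‖ ≤ D * y ^ (-x) * θ := by
    refine (tsum_of_norm_bounded (hs2.mul_left _).hasSum hle).trans ?_
    rw [tsum_mul_left]
    exact mul_le_mul_of_nonneg_left (hs2.tsum_le_of_sum_range_le hθ) (by positivity)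
  have h0 : ‖f 0‖ = D * y ^ (-x) := by rw [hf]; simp
  have e : ∑' n, f n = f 0 + ∑' n, f (n + 1) := hs.tsum_eq_zero_add
  refine ⟨hs, ?_, ?_⟩
  · have h1 := norm_sub_norm_le (f 0) (-∑' n, f (n + 1))
    rw [norm_neg, sub_neg_eq_add, ← e, h0] at h1
    linarith
  · have h1 := norm_add_le (f 0) (∑' n, f (n + 1))
    rw [← e, h0] at h1
    linarith

theorem sum_natCast_add_two_rpow_le_of_two_le {x : ℝ} (hx : 2 ≤ x) (N : ℕ) :
    ∑ n ∈ Finset.range N, ((n:ℝ) + 2) ^ (-x) ≤ 2 / 3 := by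
  have h := sum_rpow_le_midpoint (x := 2) (d := 1) (by norm_num) one_pos N
  refine le_trans (Finset.sum_le_sum fun n _ => ?_) (h.trans (le_of_eq ?_))
  · rw [add_comm]
    exact Real.rpow_le_rpow_of_exponent_le (by linarith [(Nat.cast_nonneg n : (0:ℝ) ≤ n)]) (by linarith)
  · rw [Real.rpow_neg_one]; norm_num

theorem exists_two_pi_rpow_le_Gamma : ∃ c : ℝ, 0 < c ∧
    ∀ A : ℝ, 2 ≤ A → c ≤ Real.Gamma A * (2 * Real.pi) ^ (-A) := by
  have hpi := Real.pi_gt_three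
  refine ⟨Real.exp (-(2 * Real.pi)) * (2 * Real.pi) ^ (-2 : ℝ), by positivity, fun A hA => ?_⟩
  obtain ⟨n, hn⟩ : ∃ n : ℕ, ⌊A⌋₊ = n + 1 :=
    ⟨⌊A⌋₊ - 1, by have : 2 ≤ ⌊A⌋₊ := Nat.le_floor (by exact_mod_cast hA)
                  omega⟩
  have h1 : ((n + 1 : ℕ) : ℝ) ≤ A := hn ▸ Nat.floor_le (by linarith)
  have h2 : A < ((n + 1 : ℕ) : ℝ) + 1 := hn ▸ Nat.lt_floor_add_one A
  have h3 : (2:ℝ) ≤ ((n + 1 : ℕ) : ℝ) := by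
    have : 2 ≤ ⌊A⌋₊ := Nat.le_floor (by exact_mod_cast hA)
    rw [hn] at this
    exact_mod_cast this
  have hG : (n.factorial : ℝ) ≤ Real.Gamma A := by
    rw [← Real.Gamma_nat_eq_factorial]
    refine Real.Gamma_strictMonoOn_Ici.monotoneOn ?_ hA ?_
    · simpa using h3
    · simpa using h1
  have hexp := Real.pow_div_factorial_le_exp (2 * Real.pi) (by positivity) n
  rw [div_le_iff₀ (by positivity)] at hexp
  push_cast at h2
  calc Real.exp (-(2 * Real.pi)) * (2 * Real.pi) ^ (-2 : ℝ)
      ≤ Real.exp (-(2 * Real.pi)) * (2 * Real.pi) ^ (n - A) := by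
        gcongr
        · linarith
        · linarith
    _ = Real.exp (-(2 * Real.pi)) * ((2 * Real.pi) ^ n * (2 * Real.pi) ^ (-A)) := by
        rw [sub_eq_add_neg, Real.rpow_add (by positivity), Real.rpow_natCast]
    _ ≤ Real.exp (-(2 * Real.pi)) * (Real.exp (2 * Real.pi) * n.factorial * (2 * Real.pi) ^ (-A)) := by
        gcongr
    _ = n.factorial * (2 * Real.pi) ^ (-A) := by
        rw [← mul_assoc, ← mul_assoc, ← Real.exp_add, neg_add_cancel, Real.exp_zero, one_mul]
    _ ≤ _ := by gcongr

/-! ### The half-planes `re s ≤ -1` and `re s ≥ 26 / 15` -/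

/-- The sum over the frequencies `-(β + n) ≤ 0` is dominated by its first nonzero term. -/
theorem tsum_dualTerm_neg_bounds {β : ℝ} (hβ : 0 ≤ β) (hβ1 : β < 1) : ∃ y : ℝ, 0 < y ∧ y ≤ 1 ∧
    ∀ (s : ℂ) (z : ℕ → ℂ), s.re ≤ -1 → 0 < s.im → (∀ n, ‖z n‖ = 1) →
      1 / 3 * (‖Complex.Gamma (1 - s)‖ * Real.exp (-(Real.pi * s.im / 2)) *
        (2 * Real.pi) ^ (s.re - 1) * y ^ (s.re - 1)) ≤ ‖∑' n : ℕ, dualTerm (-(β + n)) s * z n‖ ∧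
      ‖∑' n : ℕ, dualTerm (-(β + n)) s * z n‖ ≤
        5 / 3 * (‖Complex.Gamma (1 - s)‖ * Real.exp (-(Real.pi * s.im / 2)) *
        (2 * Real.pi) ^ (s.re - 1) * y ^ (s.re - 1)) := by
  have hnorm : ∀ (s z : ℂ) (x : ℝ), 0 < x → ‖z‖ = 1 → ‖dualTerm (-x) s * z‖ =
      ‖Complex.Gamma (1 - s)‖ * Real.exp (-(Real.pi * s.im / 2)) * (2 * Real.pi) ^ (s.re - 1) *
        x ^ (-(1 - s.re)) := fun s z x hx hz => by
    rw [norm_mul, hz, mul_one, norm_dualTerm_of_neg (by linarith), abs_neg, abs_of_pos hx,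
      Real.mul_rpow (by positivity) hx.le, neg_sub, ← mul_assoc]
  rcases hβ.eq_or_lt with h0 | h0
  · refine ⟨1, one_pos, le_rfl, fun s z hs hs' hz => ?_⟩
    have hz0 : dualTerm (-(β + (0:ℕ))) s * z 0 = 0 := by
      rw [← h0, Nat.cast_zero, add_zero, neg_zero, dualTerm_zero, zero_mul]
      rintro rfl
      simp at hs'
    have h := tsum_norm_bounds (f := fun n => dualTerm (-(β + (n + 1 : ℕ))) s * z (n + 1))
      (D := ‖Complex.Gamma (1 - s)‖ * Real.exp (-(Real.pi * s.im / 2)) * (2 * Real.pi) ^ (s.re - 1))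
      (x := 1 - s.re) (by have := Real.pi_pos; positivity) one_pos le_rfl (by linarith) (fun n => by
        rw [← h0, hnorm s _ _ (by positivity) (hz _)]
        push_cast
        congr 2
        ring) (sum_natCast_add_two_rpow_le_of_two_le (by linarith))
    have hsum : Summable fun n : ℕ => dualTerm (-(β + n)) s * z n :=
      (summable_nat_add_iff 1).1 h.1
    rw [hsum.tsum_eq_zero_add, hz0, zero_add]
    rw [neg_sub] at h
    norm_num at h ⊢
    exact h.2
  · refine ⟨β, h0, hβ1.le, fun s z hs hs' hz => ?_⟩
    have h := tsum_norm_bounds (f := fun n => dualTerm (-(β + n)) s * z n)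
      (D := ‖Complex.Gamma (1 - s)‖ * Real.exp (-(Real.pi * s.im / 2)) * (2 * Real.pi) ^ (s.re - 1))
      (x := 1 - s.re) (by have := Real.pi_pos; positivity) h0 hβ1.le (by linarith) (fun n =>
        hnorm s _ _ (by positivity) (hz _)) (sum_natCast_add_two_rpow_le_of_two_le (by linarith))
    rw [neg_sub] at h
    norm_num at h ⊢
    exact h.2

theorem tsum_dualTerm_pos_bounds {α : ℝ} (hα : 0 < α) (hα1 : α ≤ 1) {s : ℂ} {z : ℕ → ℂ}
    (hs : s.re ≤ -1) (hz : ∀ n, ‖z n‖ = 1) :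
    1 / 3 * (‖Complex.Gamma (1 - s)‖ * Real.exp (Real.pi * s.im / 2) *
      (2 * Real.pi) ^ (s.re - 1) * α ^ (s.re - 1)) ≤ ‖∑' n : ℕ, dualTerm (α + n) s * z n‖ ∧
    ‖∑' n : ℕ, dualTerm (α + n) s * z n‖ ≤
      5 / 3 * (‖Complex.Gamma (1 - s)‖ * Real.exp (Real.pi * s.im / 2) *
      (2 * Real.pi) ^ (s.re - 1) * α ^ (s.re - 1)) := by
  have h := tsum_norm_bounds (f := fun n => dualTerm (α + n) s * z n)
    (D := ‖Complex.Gamma (1 - s)‖ * Real.exp (Real.pi * s.im / 2) * (2 * Real.pi) ^ (s.re - 1))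
    (x := 1 - s.re) (by have := Real.pi_pos; positivity) hα hα1 (by linarith) (fun n => by
      have hx : 0 < α + n := by positivity
      rw [norm_mul, hz, mul_one, norm_dualTerm_of_pos hx, Real.mul_rpow (by positivity) hx.le,
        neg_sub, ← mul_assoc]) (sum_natCast_add_two_rpow_le_of_two_le (by linarith))
  rw [neg_sub] at h
  norm_num at h ⊢
  exact h.2

theorem exists_le_norm_Gamma_one_sub_mul : ∃ c : ℝ, 0 < c ∧ ∀ s : ℂ, s.re ≤ -1 → 0 < s.im →
    c ≤ ‖Complex.Gamma (1 - s)‖ * Real.exp (Real.pi * s.im / 2) * (2 * Real.pi) ^ (s.re - 1) := by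
  obtain ⟨c, hc, h⟩ := exists_two_pi_rpow_le_Gamma
  have hpi := Real.pi_pos
  refine ⟨c / 2, by positivity, fun s hs hs' => ?_⟩
  have h1 := norm_Gamma_mul_le (s := 1 / 2 + s.im * Complex.I) (r := 1 / 2 - s.re) (by simp)
    (by linarith)
  have e1 : (1 / 2 + s.im * Complex.I + (1 / 2 - s.re : ℝ) : ℂ) = ⟨1 - s.re, s.im⟩ := by
    apply Complex.ext
    · simp; ring
    · simp
  have e2 : (1 / 2 + s.im * Complex.I : ℂ).re = 1 / 2 := by simp
  rw [e1, ← norm_Gamma_one_sub, e2, Real.Gamma_one_half_eq,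
    show (1 / 2 + (1 / 2 - s.re) : ℝ) = 1 - s.re by ring] at h1
  have h2 := (norm_Gamma_half_mul_exp hs'.le).1
  have h3 : Real.sqrt Real.pi ≤ 2 := Real.sqrt_le_iff.2 ⟨by norm_num, by linarith [Real.pi_le_four]⟩
  have h4 := h (1 - s.re) (by linarith)
  rw [neg_sub] at h4
  have hG : 0 < Real.Gamma (1 - s.re) := Real.Gamma_pos_of_pos (by linarith)
  have h5 : Real.Gamma (1 - s.re) ≤ 2 * (‖Complex.Gamma (1 - s)‖ * Real.exp (Real.pi * s.im / 2)) := by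
    calc Real.Gamma (1 - s.re) ≤ (‖Complex.Gamma (1 / 2 + s.im * Complex.I)‖ *
          Real.exp (Real.pi * s.im / 2)) * Real.Gamma (1 - s.re) := le_mul_of_one_le_left hG.le h2
      _ = (‖Complex.Gamma (1 / 2 + s.im * Complex.I)‖ * Real.Gamma (1 - s.re)) *
          Real.exp (Real.pi * s.im / 2) := by ring
      _ ≤ (‖Complex.Gamma (1 - s)‖ * 2) * Real.exp (Real.pi * s.im / 2) :=
          mul_le_mul_of_nonneg_right (h1.trans (mul_le_mul_of_nonneg_left h3 (norm_nonneg _)))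
            (Real.exp_pos _).le
      _ = _ := by ring
  have h6 := mul_le_mul_of_nonneg_right h5
    (show 0 ≤ (2 * Real.pi) ^ (s.re - 1) by positivity)
  linarith

theorem mul_sub_le_integral {f : ℝ → ℝ} {c x y T T' : ℝ} (hf : ContinuousOn f (Icc T T'))
    (hf0 : ∀ t, 0 ≤ f t) (hTx : T ≤ x) (hxy : x ≤ y) (hyT : y ≤ T') (h : ∀ t ∈ Icc x y, c ≤ f t) :
    c * (y - x) ≤ ∫ t in T..T', f t := by
  have hii : ∀ u v : ℝ, T ≤ u → u ≤ v → v ≤ T' → IntervalIntegrable f volume u v :=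
    fun u v h1 h2 h3 => (hf.mono (by rw [uIcc_of_le h2]; exact Icc_subset_Icc h1 h3)).intervalIntegrable
  calc c * (y - x) = ∫ _ in x..y, c := by simp [mul_comm]
    _ ≤ ∫ t in x..y, f t := intervalIntegral.integral_mono_on hxy intervalIntegrable_const
        (hii _ _ hTx hxy hyT) h
    _ ≤ _ := intervalIntegral.integral_mono_interval hTx hxy hyT (ae_of_all _ hf0)
        (hii _ _ le_rfl (by linarith) le_rfl)

theorem eight_le_exp_pi_mul {r : ℝ} (hr : 3 / 4 ≤ r) : 8 ≤ Real.exp (Real.pi * r) := by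
  have h1 := Real.quadratic_le_exp_of_nonneg (show (0:ℝ) ≤ 3 / 4 by norm_num)
  calc (8:ℝ) = 2 ^ 3 := by norm_num
    _ ≤ Real.exp (3 / 4) ^ 3 := pow_le_pow_left₀ (by norm_num) (by linarith) 3
    _ = Real.exp (3 * (3 / 4)) := by rw [← Real.exp_nat_mul]; norm_num
    _ ≤ _ := Real.exp_le_exp.2 (by nlinarith [Real.pi_gt_three])

/-- In the half-plane `re s ≤ -1` the positive and the negative frequencies are each governed by one
term. Their ratio is monotone in `im s`, so one of them dominates on a fifth of the interval. -/
theorem IsLerchZeta.mul_le_integral_of_re_le : ∃ c : ℝ, 0 < c ∧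
    ∀ (α b : ℝ) (F : ℂ → ℂ) (σ T H : ℝ), 0 < α → α ≤ 1 → 0 < b → b ≤ 1 → IsLerchZeta α b F →
    σ ≤ -1 → 0 < T → 5 / 2 ≤ H → c * H ≤ ∫ t in T..(T + H), ‖F (σ + t * Complex.I)‖ := by
  obtain ⟨c, hc, hG⟩ := exists_le_norm_Gamma_one_sub_mul
  refine ⟨c / 40, by positivity, ?_⟩
  intro α b F σ T H hα hα1 hb hb1 hF hσ hT hH
  obtain ⟨y, hy, hy1, hneg⟩ := tsum_dualTerm_neg_bounds (β := 1 - α) (by linarith) (by linarith)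
  set u : ℝ := α ^ (σ - 1) with hu
  set v : ℝ := y ^ (σ - 1) with hv
  have hu1 : 1 ≤ u := Real.one_le_rpow_of_pos_of_le_one_of_nonpos hα hα1 (by linarith)
  have hv1 : 1 ≤ v := Real.one_le_rpow_of_pos_of_le_one_of_nonpos hy hy1 (by linarith)
  set G : ℝ → ℝ := fun t => ‖Complex.Gamma (1 - (σ + t * Complex.I))‖ * (2 * Real.pi) ^ (σ - 1) with hGdef
  have hG0 : ∀ t, 0 ≤ G t := fun t => by
    have := Real.pi_pos
    simp only [hGdef]; positivity
  have hre : ∀ t : ℝ, (σ + t * Complex.I : ℂ).re = σ := fun t => by simp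
  have him : ∀ t : ℝ, (σ + t * Complex.I : ℂ).im = t := fun t => by simp
  have hGc : ∀ t, 0 < t → c ≤ G t * Real.exp (Real.pi * t / 2) := fun t ht => by
    have := hG (σ + t * Complex.I) (by rw [hre]; exact hσ) (by rw [him]; exact ht)
    rw [hre, him] at this
    simp only [hGdef]
    linarith
  have hpt : ∀ t, 0 < t →
      1 / 3 * (G t * Real.exp (Real.pi * t / 2) * u) -
        5 / 3 * (G t * Real.exp (-(Real.pi * t / 2)) * v) ≤ ‖F (σ + t * Complex.I)‖ ∧
      1 / 3 * (G t * Real.exp (-(Real.pi * t / 2)) * v) -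
        5 / 3 * (G t * Real.exp (Real.pi * t / 2) * u) ≤ ‖F (σ + t * Complex.I)‖ := by
    intro t ht
    have hs : (σ + t * Complex.I : ℂ).re ≤ -1 := by rw [hre]; exact hσ
    have hs' : 0 < (σ + t * Complex.I : ℂ).im := by rw [him]; exact ht
    have h1 := tsum_dualTerm_pos_bounds hα hα1 (z := fun n : ℕ => unitExp (-(n * b))) hs
      fun n => norm_unitExp _
    have h2 := hneg _ (fun n : ℕ => unitExp ((n + 1) * b)) hs hs' fun n => norm_unitExp _
    have h3 := hF.eq_add_tsum_dualTerm hα hα1 hb hb1 (by linarith) hs'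
    have h4 := congrArg norm h3
    rw [norm_mul, norm_unitExp, one_mul] at h4
    rw [hre, him] at h1 h2
    set P := ∑' n : ℕ, dualTerm (α + n) (σ + t * Complex.I) * unitExp (-(n * b))
    set Q := ∑' n : ℕ, dualTerm (-(1 - α + n)) (σ + t * Complex.I) * unitExp ((n + 1) * b)
    have h5 := norm_sub_norm_le P (-Q)
    have h6 := norm_sub_norm_le Q (-P)
    rw [norm_neg, sub_neg_eq_add] at h5 h6
    rw [add_comm Q P] at h6
    simp only [hGdef]
    constructor <;> linarith [h1.1, h1.2, h2.1, h2.2]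
  have hcont : ContinuousOn (fun t : ℝ => ‖F (σ + t * Complex.I)‖) (Icc T (T + H)) :=
    (hF.continuousOn_vertical σ).mono fun t ht => hT.trans_le ht.1
  set m : ℝ := T + H / 2 with hm
  have hsplit : ∀ t, Real.exp (Real.pi * t / 2) =
      Real.exp (Real.pi * m / 2) * Real.exp (Real.pi * (t - m) / 2) := fun t => by
    rw [← Real.exp_add]; ring_nf
  have hsplit' : ∀ t, Real.exp (-(Real.pi * t / 2)) =
      Real.exp (-(Real.pi * m / 2)) * Real.exp (-(Real.pi * (t - m) / 2)) := fun t => by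
    rw [← Real.exp_add]; ring_nf
  have hw : ∀ r : ℝ, Real.exp (Real.pi * r / 2) =
      Real.exp (-(Real.pi * r / 2)) * Real.exp (Real.pi * r) := fun r => by
    rw [← Real.exp_add]; ring_nf
  rcases le_total (Real.exp (-(Real.pi * m / 2)) * v) (Real.exp (Real.pi * m / 2) * u) with hmid | hmid
  · have h := mul_sub_le_integral (c := c / 8) (x := m + 3 / 4) (y := T + H) hcont
      (fun t => norm_nonneg _) (by linarith) (by linarith) le_rfl fun t ht => ?_
    · refine le_trans ?_ h
      have : H / 5 ≤ T + H - (m + 3 / 4) := by linarith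
      nlinarith
    have ht0 : 0 < t := by linarith [ht.1]
    have h8 := eight_le_exp_pi_mul (r := t - m) (by linarith [ht.1])
    have hdom : 8 * (Real.exp (-(Real.pi * t / 2)) * v) ≤ Real.exp (Real.pi * t / 2) * u := by
      rw [hsplit t, hsplit' t, hw (t - m)]
      set e := Real.exp (-(Real.pi * (t - m) / 2))
      have he : 0 < e := Real.exp_pos _
      calc 8 * (Real.exp (-(Real.pi * m / 2)) * e * v)
          = e * 8 * (Real.exp (-(Real.pi * m / 2)) * v) := by ring
        _ ≤ e * Real.exp (Real.pi * (t - m)) * (Real.exp (Real.pi * m / 2) * u) := by gcongr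
        _ = _ := by ring
    have h1 := mul_le_mul_of_nonneg_left hdom (hG0 t)
    have h2 : c ≤ G t * Real.exp (Real.pi * t / 2) * u :=
      (hGc t ht0).trans (le_mul_of_one_le_right (hc.le.trans (hGc t ht0)) hu1)
    linarith [(hpt t ht0).1]
  · have h := mul_sub_le_integral (c := c / 8) (x := T) (y := m - 3 / 4) hcont
      (fun t => norm_nonneg _) le_rfl (by linarith) (by linarith) fun t ht => ?_
    · refine le_trans ?_ h
      have : H / 5 ≤ m - 3 / 4 - T := by linarith
      nlinarith
    have ht0 : 0 < t := by linarith [ht.1]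
    have h8 := eight_le_exp_pi_mul (r := m - t) (by linarith [ht.2])
    have hdom : 8 * (Real.exp (Real.pi * t / 2) * u) ≤ Real.exp (-(Real.pi * t / 2)) * v := by
      have e1 : Real.exp (-(Real.pi * (t - m) / 2)) =
          Real.exp (Real.pi * (t - m) / 2) * Real.exp (Real.pi * (m - t)) := by
        rw [← Real.exp_add]; ring_nf
      rw [hsplit t, hsplit' t, e1]
      set e := Real.exp (Real.pi * (t - m) / 2)
      have he : 0 < e := Real.exp_pos _
      calc 8 * (Real.exp (Real.pi * m / 2) * e * u)
          = e * 8 * (Real.exp (Real.pi * m / 2) * u) := by ring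
        _ ≤ e * Real.exp (Real.pi * (m - t)) * (Real.exp (-(Real.pi * m / 2)) * v) := by gcongr
        _ = _ := by ring
    have h1 := mul_le_mul_of_nonneg_left hdom (hG0 t)
    have h2 : c ≤ G t * Real.exp (Real.pi * t / 2) * u :=
      (hGc t ht0).trans (le_mul_of_one_le_right (hc.le.trans (hGc t ht0)) hu1)
    linarith [(hpt t ht0).2]

/-- In the half-plane `re s ≥ 26 / 15` the first term of the series dominates. -/
theorem IsLerchZeta.mul_le_integral_of_le_re {α b : ℝ} {F : ℂ → ℂ} {σ T H : ℝ} (hb : 0 < b)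
    (hb1 : b ≤ 1) (hF : IsLerchZeta α b F) (hσ : 26 / 15 ≤ σ) (hT : 0 < T) (hH : 0 < H) :
    2 / 1000 * H ≤ ∫ t in T..(T + H), ‖F (σ + t * Complex.I)‖ := by
  have h := mul_sub_le_integral (c := 2 / 1000) (x := T) (y := T + H)
    ((hF.continuousOn_vertical σ).mono fun t ht => hT.trans_le ht.1) (fun t => norm_nonneg _) le_rfl
    (by linarith) le_rfl fun t _ => ?_
  · rwa [add_sub_cancel_left] at h
  have hre : (σ + t * Complex.I : ℂ).re = σ := by simp
  rw [hF.eq_tsum _ (by rw [hre]; linarith), ← lerchSeries_eq_tsum_div, lerchSeries]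
  have h1 := (tsum_norm_bounds (f := fun n : ℕ => unitExp α ^ n * ((n + b : ℝ) : ℂ) ^ (-(σ + t * Complex.I : ℂ)))
    (D := 1) (x := σ) zero_le_one hb hb1 (by linarith) (fun n => by
      rw [norm_mul, norm_pow, norm_unitExp, one_pow, norm_add_ofReal_cpow_neg hb, hre, add_comm])
    (sum_natCast_add_two_rpow_le hσ)).2.1
  refine le_trans ?_ h1
  have h2 : 1 ≤ b ^ (-σ) := Real.one_le_rpow_of_pos_of_le_one_of_nonpos hb hb1 (by linarith)
  linarith

/-- The three ranges of `σ` together. For `σ ≤ -1` the hypothesis on `σ` forces `H ≥ 8 / π`. -/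
theorem IsLerchZeta.exists_mul_min_le_integral : ∃ c : ℝ, 0 < c ∧
    ∀ (α b : ℝ) (F : ℂ → ℂ) (σ T H ε : ℝ), 0 < α → α ≤ 1 → 0 < b → b ≤ 1 → IsLerchZeta α b F →
    16 ≤ T → 0 < H → 0 < ε → ε ≤ 1 →
    1 - Real.pi * H * (1 - ε) / (4 * Real.log (Real.log T)) ≤ σ →
    c * min H ((H / 200) ^ (7 / (6 * H * ε))) ≤
      ∫ t in T..(T + H), ‖F (σ + t * Complex.I)‖ := by
  obtain ⟨c₁, hc₁, h₁⟩ := IsLerchZeta.mul_le_integral_of_re_le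
  obtain ⟨c₂, hc₂, h₂⟩ := IsLerchZeta.lowerBound_le_integral_of_mem_strip
  refine ⟨min (2 / 1000) (min c₁ c₂), by positivity, ?_⟩
  intro α b F σ T H ε hα hα1 hb hb1 hF hT hH hε hε1 hσε
  have hm0 : 0 ≤ min H ((H / 200) ^ (7 / (6 * H * ε))) := le_min hH.le (by positivity)
  rcases le_total σ (-1) with hσ | hσ
  · have hL := one_le_log_log hT
    have h3 := strip_width_mul_le (by linarith) hH hε1 hσε
    have h4 : 2 * 1 ≤ max (1 - σ) 0 * Real.log (Real.log T) :=
      mul_le_mul (le_max_of_le_left (by linarith)) hL zero_le_one (le_max_right _ _)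
    have h5 : Real.pi * H * (1 - ε) ≤ 3.1416 * H * 1 :=
      mul_le_mul (mul_le_mul_of_nonneg_right Real.pi_lt_d4.le hH.le) (by linarith) (by linarith)
        (by positivity)
    exact (mul_le_mul ((min_le_right _ _).trans (min_le_left _ _)) (min_le_left _ _) hm0 hc₁.le).trans
      (h₁ α b F σ T H hα hα1 hb hb1 hF hσ (by linarith) (by linarith))
  rcases le_total σ (26 / 15) with hσ2 | hσ2
  · have hc : min (2 / 1000) (min c₁ c₂) ≤ c₂ := (min_le_right _ _).trans (min_le_right _ _)
    refine (mul_le_mul hc (min_le_lowerBound H ε) hm0 hc₂.le).trans ?_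
    rcases le_total α (1 / 2) with h | h
    · exact h₂ α b F σ T H ε (abs_le.2 ⟨by linarith, h⟩) hb hb1 hF hσ hσ2 hT hH hε hε1 hσε
    · exact h₂ (α - 1) b F σ T H ε (abs_le.2 ⟨by linarith, by linarith⟩) hb hb1 hF.sub_one hσ hσ2 hT
        hH hε hε1 hσε
  · exact (mul_le_mul (min_le_left _ _) (min_le_left _ _) hm0 (by norm_num)).trans
      (hF.mul_le_integral_of_le_re hb hb1 hσ2 (by linarith) hH)

theorem isLerchZeta_one_hurwitzZeta {α : ℝ} (hα : 0 < α) (hα1 : α ≤ 1) :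
    IsLerchZeta 1 α (HurwitzZeta.hurwitzZeta (α : UnitAddCircle)) := by
  refine ⟨fun s hs => (HurwitzZeta.differentiableAt_hurwitzZeta _ hs).differentiableWithinAt,
    fun s hs => ?_⟩
  rw [← (HurwitzZeta.hasSum_hurwitzZeta_of_one_lt_re ⟨hα.le, hα1⟩ hs).tsum_eq]
  refine tsum_congr fun n => ?_
  have : (2 * Real.pi * Complex.I * (1 : ℝ) * n : ℂ) = n * (2 * Real.pi * Complex.I) := by
    push_cast; ring
  rw [this, Complex.exp_nat_mul_two_pi_mul_I]

theorem theorem3 :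
    ∃ c : ℝ, 0 < c ∧ ∀ (T H ε σ α : ℝ), 16 ≤ T → 0 < H → 0 < ε → ε ≤ 1 → 0 < α → α ≤ 1 →
      1 - Real.pi * H * (1 - ε) / (4 * Real.log (Real.log T)) ≤ σ →
      c * min H ((H / 200) ^ (7 / (6 * H * ε))) ≤
          ∫ t in T..(T + H), ‖HurwitzZeta.hurwitzZeta (α : UnitAddCircle) (σ + t * Complex.I)‖ ∧
        ∀ β : ℝ, 0 < β → β ≤ 1 →
          c * min H ((H / 200) ^ (7 / (6 * H * ε))) ≤
            ∫ t in T..(T + H), ‖lerchZeta α β (σ + t * Complex.I)‖ := by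
  obtain ⟨c, hc, h⟩ := IsLerchZeta.exists_mul_min_le_integral
  refine ⟨c, hc, fun T H ε σ α hT hH hε hε1 hα hα1 hσ => ⟨?_, fun β hβ hβ1 => ?_⟩⟩
  · exact h 1 α _ σ T H ε one_pos le_rfl hα hα1 (isLerchZeta_one_hurwitzZeta hα hα1) hT hH hε hε1 hσ
  · exact h α β _ σ T H ε hα hα1 hβ hβ1 (isLerchZeta_lerchZeta α ⟨hβ, hβ1⟩) hT hH hε hε1 hσ
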